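/- Let $M$ be a smooth, connected, Hausdorff, second-countable manifold of dimension $n>1$. For $p,k\in\mathbb{N}$ let $\mathcal{D}^k_p$ be the space of linear differential operators of order at most $k$ from the space $\Omega^p(M)$ of smooth $p$-forms to $C^\infty(M)$, endowed with the action $\mathcal{L}_XD=L_X\circ D-D\circ L_X$ of the Lie algebra $\mathrm{Vect}(M)$ of smooth vector fields, where $L_X$ denotes the Lie derivative. Let $\mathcal{S}^k_p=\Gamma(\wedge^pTM\otimes S^kTM)$ be the space of smooth sections of $\wedge^pTM\otimes S^kTM$, endowed with the action of $\mathrm{Vect}(M)$ by the Lie derivative of tensor fields. Then: 1. for every $p$, $\mathcal{D}^0_p$ is isomorphic to $\mathcal{S}^0_p$ as a $\mathrm{Vect}(M)$-module; 2. for $p=0$ and for $p=n$, $\mathcal{D}^1_p$ is isomorphic to $\mathcal{S}^1_p\oplus\mathcal{S}^0_p$ as a $\mathrm{Vect}(M)$-module. (An isomorphism of $\mathrm{Vect}(M)$-modules is an $\mathbb{R}$-linear bijection that commutes with the action of every $X\in\mathrm{Vect}(M)$.) -/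

import Mathlib

open scoped Manifold ContDiff Topology

set_option maxSynthPendingDepth 3
set_option linter.unusedSectionVars false

noncomputable section

namespace FormOps

/-- Contravariant tensors on `V` of degree `k + p`, as multilinear forms in `k + p` covectors. -/
abbrev MultiCov (k p : ℕ) (V : Type*) [AddCommGroup V] [Module ℝ V] [TopologicalSpace V] : Type _ :=
  ContinuousMultilinearMap ℝ (fun _ : Fin k ⊕ Fin p => (V →L[ℝ] ℝ)) ℝ

section LocalCalculus

variable {E : Type*} [NormedAddCommGroup E] [NormedSpace ℝ E] {k p : ℕ}

/-- The natural action `(ρ(A) θ)(v) = - ∑ i, θ (…, A vᵢ, …)` of `A ∈ gl(E)` on the alternating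
`p`-forms on `E` (see `glForm_apply`). -/
def glForm (A : E →L[ℝ] E) (θ : E [⋀^Fin p]→L[ℝ] ℝ) : E [⋀^Fin p]→L[ℝ] ℝ :=
  -(θ.fderivCompContinuousLinearMap (ContinuousLinearMap.id ℝ E) A)

theorem glForm_apply (A : E →L[ℝ] E) (θ : E [⋀^Fin p]→L[ℝ] ℝ) (v : Fin p → E) :
    glForm A θ v = -∑ i, θ (Function.update v i (A (v i))) := by
  simp only [glForm, ContinuousAlternatingMap.neg_apply,
    ContinuousAlternatingMap.fderivCompContinuousLinearMap_apply]
  congr 1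
  refine Finset.sum_congr rfl fun i _ => congrArg θ (funext fun j => ?_)
  rcases eq_or_ne j i with rfl | h
  · simp
  · simp [h]

/-- The natural action `(ρ(A) s)(ξ) = ∑ i, s (…, ξᵢ ∘ A, …)` of `A ∈ gl(E)` on contravariant
tensors (see `glSymbol_apply`). -/
def glSymbol (A : E →L[ℝ] E)
    (s : MultiCov k p E) :
    MultiCov k p E :=
  s.fderivCompContinuousLinearMap (fun _ => ContinuousLinearMap.id ℝ (E →L[ℝ] ℝ))
    (fun _ => ContinuousLinearMap.precomp ℝ A)

theorem glSymbol_apply (A : E →L[ℝ] E)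
    (s : MultiCov k p E)
    (ξ : Fin k ⊕ Fin p → (E →L[ℝ] ℝ)) :
    glSymbol A s ξ = ∑ i, s (Function.update ξ i ((ξ i).comp A)) := by
  simp only [glSymbol, ContinuousMultilinearMap.fderivCompContinuousLinearMap_apply]
  refine Finset.sum_congr rfl fun i _ => congrArg s (funext fun j => ?_)
  rcases eq_or_ne j i with rfl | h
  · simp
  · simp [h]

/-- The Lie derivative `(X.θ)_y - ρ(D_y X) θ_y` of a `p`-form in a chart. -/
def lieFormLocal (X : E → E) (θ : E → E [⋀^Fin p]→L[ℝ] ℝ) (y : E) : E [⋀^Fin p]→L[ℝ] ℝ :=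
  fderiv ℝ θ y (X y) - glForm (fderiv ℝ X y) (θ y)

/-- The Lie derivative `(X.s)_y - ρ(D_y X) s_y` of a contravariant tensor field in a chart. -/
def lieSymbolLocal (X : E → E)
    (s : E → MultiCov k p E) (y : E) :
    MultiCov k p E :=
  fderiv ℝ s y (X y) - glSymbol (fderiv ℝ X y) (s y)

theorem fderiv_related {X Y τ : E → E} {y : E} (hτ : ContDiffAt ℝ 2 τ y)
    (hX : DifferentiableAt ℝ X y) (hY : DifferentiableAt ℝ Y (τ y))
    (hXY : ∀ᶠ z in 𝓝 y, Y (τ z) = fderiv ℝ τ z (X z)) (v : E) :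
    fderiv ℝ Y (τ y) (fderiv ℝ τ y v) =
      fderiv ℝ (fderiv ℝ τ) y (X y) v + fderiv ℝ τ y (fderiv ℝ X y v) := by
  have hd : DifferentiableAt ℝ (fderiv ℝ τ) y :=
    (hτ.fderiv_right (m := 1) (by norm_num)).differentiableAt (by norm_num)
  have h1 : fderiv ℝ (fun z => Y (τ z)) y = fderiv ℝ (fun z => fderiv ℝ τ z (X z)) y :=
    Filter.EventuallyEq.fderiv_eq hXY
  have h2 : fderiv ℝ (fun z => Y (τ z)) y v = fderiv ℝ Y (τ y) (fderiv ℝ τ y v) := by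
    have := fderiv_comp y hY (hτ.differentiableAt (by norm_num))
    change fderiv ℝ (Y ∘ τ) y v = _
    rw [this]; rfl
  rw [← h2, h1, fderiv_clm_apply hd hX]
  have hs : IsSymmSndFDerivAt ℝ τ y := hτ.isSymmSndFDerivAt (by simp)
  simp [hs.eq v (X y), add_comm]

theorem lieFormLocal_natural {X Y τ : E → E} {y : E} {α β : E → E [⋀^Fin p]→L[ℝ] ℝ}
    (hτ : ContDiffAt ℝ 2 τ y)
    (hX : DifferentiableAt ℝ X y) (hY : DifferentiableAt ℝ Y (τ y))
    (hβ : DifferentiableAt ℝ β (τ y))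
    (hXY : ∀ᶠ z in 𝓝 y, Y (τ z) = fderiv ℝ τ z (X z))
    (hα : ∀ᶠ z in 𝓝 y, α z = (β (τ z)).compContinuousLinearMap (fderiv ℝ τ z)) :
    lieFormLocal X α y = (lieFormLocal Y β (τ y)).compContinuousLinearMap (fderiv ℝ τ y) := by
  have hd : DifferentiableAt ℝ (fderiv ℝ τ) y :=
    (hτ.fderiv_right (m := 1) (by norm_num)).differentiableAt (by norm_num)
  have hτ' : DifferentiableAt ℝ τ y := hτ.differentiableAt (by norm_num)
  have h1 := Filter.EventuallyEq.fderiv_eq (𝕜 := ℝ) hα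
  have hβτ : DifferentiableAt ℝ (fun z => β (τ z)) y := hβ.comp y hτ'
  rw [fderiv_continuousAlternatingMapCompContinuousLinearMap hβτ hd] at h1
  have h2 : fderiv ℝ (fun z => β (τ z)) y = (fderiv ℝ β (τ y)).comp (fderiv ℝ τ y) :=
    fderiv_comp y hβ hτ'
  have h3 := hXY.self_of_nhds
  have h4 := hα.self_of_nhds
  have key := fderiv_related hτ hX hY hXY
  ext v
  simp only [lieFormLocal, h1, h2, h4, ContinuousAlternatingMap.sub_apply, glForm_apply,
    ContinuousAlternatingMap.compContinuousLinearMap_apply, h3,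
    add_apply, ContinuousLinearMap.comp_apply,
    ContinuousAlternatingMap.add_apply,
    ContinuousAlternatingMap.fderivCompContinuousLinearMap_apply,
    ContinuousAlternatingMap.compContinuousLinearMapCLM_apply, sub_neg_eq_add, add_assoc,
    ← Finset.sum_add_distrib]
  congr 1
  refine Finset.sum_congr rfl fun i _ => ?_
  have e1 : (fun j => Function.update (fun _ => fderiv ℝ τ y) i (fderiv ℝ (fderiv ℝ τ) y (X y)) j
      (v j)) = Function.update (fun j => fderiv ℝ τ y (v j)) i
        (fderiv ℝ (fderiv ℝ τ) y (X y) (v i)) := by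
    funext j; rcases eq_or_ne j i with rfl | h
    · simp
    · simp [h]
  have e2 : (fderiv ℝ τ y : E → E) ∘ (Function.update v i (fderiv ℝ X y (v i))) =
      Function.update (fun j => fderiv ℝ τ y (v j)) i (fderiv ℝ τ y (fderiv ℝ X y (v i))) := by
    funext j; rcases eq_or_ne j i with rfl | h
    · simp
    · simp [h]
  rw [e1, e2, ← ContinuousAlternatingMap.map_update_add, ← key]
  rfl

theorem lieSymbolLocal_natural {X Y τ : E → E} {y : E}
    {s t : E → MultiCov k p E}
    (hτ : ContDiffAt ℝ 2 τ y)
    (hX : DifferentiableAt ℝ X y) (hY : DifferentiableAt ℝ Y (τ y))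
    (hs : DifferentiableAt ℝ s y) (ht : DifferentiableAt ℝ t (τ y))
    (hXY : ∀ᶠ z in 𝓝 y, Y (τ z) = fderiv ℝ τ z (X z))
    (hst : ∀ᶠ z in 𝓝 y, t (τ z) =
      (s z).compContinuousLinearMap fun _ => ContinuousLinearMap.precomp ℝ (fderiv ℝ τ z)) :
    lieSymbolLocal Y t (τ y) = (lieSymbolLocal X s y).compContinuousLinearMap
      fun _ => ContinuousLinearMap.precomp ℝ (fderiv ℝ τ y) := by
  have hd : DifferentiableAt ℝ (fderiv ℝ τ) y :=
    (hτ.fderiv_right (m := 1) (by norm_num)).differentiableAt (by norm_num)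
  have hτ' : DifferentiableAt ℝ τ y := hτ.differentiableAt (by norm_num)
  have key := fderiv_related hτ hX hY hXY
  have h3 := hXY.self_of_nhds
  have h4 := hst.self_of_nhds
  ext ξ
  have h5 : ∀ᶠ z in 𝓝 y, t (τ z) ξ = s z fun i => (ξ i).comp (fderiv ℝ τ z) := by
    filter_upwards [hst] with z hz
    rw [hz]; rfl
  have h1 := Filter.EventuallyEq.fderiv_eq (𝕜 := ℝ) h5
  have hg : ∀ i, HasFDerivAt (fun z => (ξ i).comp (fderiv ℝ τ z))
      ((ContinuousLinearMap.compL ℝ E E ℝ (ξ i)).comp (fderiv ℝ (fderiv ℝ τ) y)) y := fun i =>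
    (ContinuousLinearMap.compL ℝ E E ℝ (ξ i)).hasFDerivAt.comp y hd.hasFDerivAt
  rw [(hs.hasFDerivAt.continuousMultilinearMap_apply hg).fderiv] at h1
  have h2 : fderiv ℝ (fun z => t (τ z) ξ) y (X y) = fderiv ℝ t (τ y) (Y (τ y)) ξ := by
    have := ((ht.hasFDerivAt.comp y hτ'.hasFDerivAt).continuousMultilinear_apply_const ξ).fderiv
    rw [h3]
    exact congrArg (fun f => f (X y)) this
  have h6 := congrArg (fun f => f (X y)) h1
  simp only [h2] at h6
  simp only [lieSymbolLocal, sub_apply, h6,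
    ContinuousMultilinearMap.compContinuousLinearMap_apply, glSymbol_apply, h4,
    add_apply, ContinuousLinearMap.comp_apply,
    sum_apply, ContinuousLinearMap.precomp_apply]
  rw [add_sub_assoc, sub_eq_add_neg (_ : ℝ) (∑ i, (s y) (Function.update _ _ _))]
  refine congrArg₂ (· + ·) rfl ?_
  rw [sub_eq_iff_eq_add, neg_add_eq_sub, eq_sub_iff_add_eq, ← Finset.sum_add_distrib]
  refine Finset.sum_congr rfl fun i _ => ?_
  have e1 : (fun j => (Function.update ξ i ((ξ i).comp (fderiv ℝ Y (τ y))) j).comp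
      (fderiv ℝ τ y)) = Function.update (fun j => (ξ j).comp (fderiv ℝ τ y)) i
        (((ξ i).comp (fderiv ℝ Y (τ y))).comp (fderiv ℝ τ y)) := by
    funext j; rcases eq_or_ne j i with rfl | h
    · simp
    · simp [h]
  have e2 : ((ξ i).comp (fderiv ℝ Y (τ y))).comp (fderiv ℝ τ y) =
      (ξ i).comp (fderiv ℝ (fderiv ℝ τ) y (X y)) +
        ((ξ i).comp (fderiv ℝ τ y)).comp (fderiv ℝ X y) := by
    ext v
    simp [key v]
  rw [e1, e2, ContinuousMultilinearMap.map_update_add]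
  rfl

theorem contDiffOn_lieFormLocal {U : Set E} (hU : IsOpen U) {X : E → E}
    {θ : E → E [⋀^Fin p]→L[ℝ] ℝ} (hX : ContDiffOn ℝ ∞ X U) (hθ : ContDiffOn ℝ ∞ θ U) :
    ContDiffOn ℝ ∞ (lieFormLocal X θ) U := by
  have hX' : ContDiffOn ℝ ∞ (fderiv ℝ X) U := hX.fderiv_of_isOpen hU (by simp)
  have hθ' : ContDiffOn ℝ ∞ (fderiv ℝ θ) U := hθ.fderiv_of_isOpen hU (by simp)
  have h : ContDiffOn ℝ ∞ (fun y =>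
      ContinuousAlternatingMap.fderivCompContinuousLinearMapCLM (ι := Fin p) ℝ
        (ContinuousLinearMap.id ℝ E) (θ y) (fderiv ℝ X y)) U :=
    ((ContinuousLinearMap.contDiff _).comp_contDiffOn hθ).clm_apply hX'
  exact (hθ'.clm_apply hX).sub h.neg

theorem contDiffOn_lieSymbolLocal {U : Set E} (hU : IsOpen U) {X : E → E}
    {s : E → MultiCov k p E}
    (hX : ContDiffOn ℝ ∞ X U) (hs : ContDiffOn ℝ ∞ s U) :
    ContDiffOn ℝ ∞ (lieSymbolLocal X s) U := by
  have hX' : ContDiffOn ℝ ∞ (fderiv ℝ X) U := hX.fderiv_of_isOpen hU (by simp)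
  have hs' : ContDiffOn ℝ ∞ (fderiv ℝ s) U := hs.fderiv_of_isOpen hU (by simp)
  let m := ContinuousMultilinearMap.compContinuousLinearMapContinuousMultilinear ℝ
    (fun _ : Fin k ⊕ Fin p => (E →L[ℝ] ℝ)) (fun _ : Fin k ⊕ Fin p => (E →L[ℝ] ℝ)) ℝ
  have hc : ContDiffOn ℝ ∞ (fun y => (fun _ : Fin k ⊕ Fin p =>
      (ContinuousLinearMap.compL ℝ E E ℝ).flip (fderiv ℝ X y))) U :=
    contDiffOn_pi.2 fun _ => (ContinuousLinearMap.contDiff _).comp_contDiffOn hX'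
  have h : ContDiffOn ℝ ∞ (fun y => m.linearDeriv
      (fun _ => ContinuousLinearMap.id ℝ (E →L[ℝ] ℝ))
      (fun _ => (ContinuousLinearMap.compL ℝ E E ℝ).flip (fderiv ℝ X y)) (s y)) U :=
    ((ContinuousLinearMap.contDiff _).comp_contDiffOn hc).clm_apply hs
  refine (hs'.clm_apply hX).sub (h.congr fun y _ => ?_)
  ext ξ
  simp only [glSymbol, ContinuousMultilinearMap.fderivCompContinuousLinearMap_apply]
  simp [m]
  rfl

theorem lieFormLocal_add {X : E → E} {θ θ' : E → E [⋀^Fin p]→L[ℝ] ℝ} {y : E}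
    (h : DifferentiableAt ℝ θ y) (h' : DifferentiableAt ℝ θ' y) :
    lieFormLocal X (fun z => θ z + θ' z) y = lieFormLocal X θ y + lieFormLocal X θ' y := by
  have hs : fderiv ℝ (fun z => θ z + θ' z) y = fderiv ℝ θ y + fderiv ℝ θ' y := fderiv_add h h'
  ext v
  simp only [lieFormLocal, hs, add_apply, ContinuousAlternatingMap.sub_apply,
    ContinuousAlternatingMap.add_apply, glForm_apply, Finset.sum_add_distrib]
  ring

theorem lieFormLocal_smul {X : E → E} {θ : E → E [⋀^Fin p]→L[ℝ] ℝ} {y : E} (c : ℝ)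
    (h : DifferentiableAt ℝ θ y) :
    lieFormLocal X (fun z => c • θ z) y = c • lieFormLocal X θ y := by
  have hs : fderiv ℝ (fun z => c • θ z) y = c • fderiv ℝ θ y := fderiv_const_smul h c
  ext v
  simp only [lieFormLocal, hs, smul_apply, ContinuousAlternatingMap.sub_apply,
    ContinuousAlternatingMap.smul_apply, glForm_apply, ← Finset.smul_sum, smul_sub, smul_neg]

theorem lieSymbolLocal_add {X : E → E} {y : E}
    {s s' : E → MultiCov k p E}
    (h : DifferentiableAt ℝ s y) (h' : DifferentiableAt ℝ s' y) :
    lieSymbolLocal X (fun z => s z + s' z) y = lieSymbolLocal X s y + lieSymbolLocal X s' y := by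
  have hs : fderiv ℝ (fun z => s z + s' z) y = fderiv ℝ s y + fderiv ℝ s' y := fderiv_add h h'
  ext v
  simp only [lieSymbolLocal, hs, add_apply, sub_apply, glSymbol_apply, Finset.sum_add_distrib]
  ring

theorem lieSymbolLocal_smul {X : E → E} {y : E} (c : ℝ)
    {s : E → MultiCov k p E}
    (h : DifferentiableAt ℝ s y) :
    lieSymbolLocal X (fun z => c • s z) y = c • lieSymbolLocal X s y := by
  have hs : fderiv ℝ (fun z => c • s z) y = c • fderiv ℝ s y := fderiv_const_smul h c
  ext v
  simp only [lieSymbolLocal, hs, smul_apply, sub_apply, glSymbol_apply, ← Finset.smul_sum,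
    smul_sub]

end LocalCalculus

section Fibre

variable (k p : ℕ) (V : Type) [AddCommGroup V] [Module ℝ V] [TopologicalSpace V]

/-- The fibre `⋀^p V ⊗ S^k V` for `V` of finite dimension, realised as the space of multilinear
forms in `k + p` covectors that are symmetric in the first `k` arguments and alternating in the last
`p` arguments (such a form is the polarisation of a homogeneous polynomial of degree `k` in a
covector, with values in the `p`-vectors). -/
def symbolFibre :
    Submodule ℝ (MultiCov k p V) where
  carrier := {s |
    (∀ (σ : Equiv.Perm (Fin k)) (ξ : Fin k → (V →L[ℝ] ℝ)) (η : Fin p → (V →L[ℝ] ℝ)),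
      s (Sum.elim (ξ ∘ σ) η) = s (Sum.elim ξ η)) ∧
    (∀ (ξ : Fin k → (V →L[ℝ] ℝ)) (η : Fin p → (V →L[ℝ] ℝ)) (i j : Fin p),
      i ≠ j → η i = η j → s (Sum.elim ξ η) = 0)}
  add_mem' := by
    rintro a b ⟨ha, ha'⟩ ⟨hb, hb'⟩
    refine ⟨fun σ ξ η => ?_, fun ξ η i j hij h => ?_⟩
    · simp [ha σ ξ η, hb σ ξ η]
    · simp [ha' ξ η i j hij h, hb' ξ η i j hij h]
  zero_mem' := by simp
  smul_mem' := by
    rintro c a ⟨ha, ha'⟩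
    refine ⟨fun σ ξ η => ?_, fun ξ η i j hij h => ?_⟩
    · simp [ha σ ξ η]
    · simp [ha' ξ η i j hij h]

variable {k p V}

theorem symbolFibre_comp {W : Type} [AddCommGroup W] [Module ℝ W]
    [TopologicalSpace W]
    {s : MultiCov k p V}
    (hs : s ∈ symbolFibre k p V) (T : (W →L[ℝ] ℝ) →L[ℝ] (V →L[ℝ] ℝ)) :
    s.compContinuousLinearMap (fun _ => T) ∈ symbolFibre k p W := by
  have e : ∀ (ξ : Fin k → (W →L[ℝ] ℝ)) (η : Fin p → (W →L[ℝ] ℝ)),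
      (s.compContinuousLinearMap fun _ => T) (Sum.elim ξ η) =
        s (Sum.elim (fun i => T (ξ i)) (fun i => T (η i))) := by
    intro ξ η
    rw [ContinuousMultilinearMap.compContinuousLinearMap_apply]
    congr 1
    funext i
    rcases i with i | i <;> rfl
  refine ⟨fun σ ξ η => ?_, fun ξ η i j hij h => ?_⟩
  · rw [e, e]
    exact hs.1 σ (fun i => T (ξ i)) (fun i => T (η i))
  · rw [e]
    exact hs.2 _ _ i j hij (congrArg T h)

end Fibre

section FibreLocal

variable {E : Type} [NormedAddCommGroup E] [NormedSpace ℝ E] {k p : ℕ}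

/-- A derivative of a curve in the fibre stays in the fibre. -/
theorem symbolFibre_fderiv {F : Type*} [NormedAddCommGroup F] [NormedSpace ℝ F]
    {s : F → MultiCov k p E} {y : F}
    (hs : DifferentiableAt ℝ s y) (hm : ∀ᶠ z in 𝓝 y, s z ∈ symbolFibre k p E) (v : F) :
    fderiv ℝ s y v ∈ symbolFibre k p E := by
  have h : ∀ ξ, fderiv ℝ (fun z => s z ξ) y v = fderiv ℝ s y v ξ := fun ξ => by
    rw [(hs.hasFDerivAt.continuousMultilinear_apply_const ξ).fderiv]; rfl
  refine ⟨fun σ ξ η => ?_, fun ξ η i j hij he => ?_⟩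
  · rw [← h, ← h]
    exact congrArg (fun f : F →L[ℝ] ℝ => f v) (Filter.EventuallyEq.fderiv_eq (𝕜 := ℝ)
      (hm.mono fun z hz => hz.1 σ ξ η))
  · rw [← h, Filter.EventuallyEq.fderiv_eq (f := fun _ => (0 : ℝ))
      (hm.mono fun z hz => hz.2 ξ η i j hij he)]
    simp

theorem glSymbol_mem (A : E →L[ℝ] E)
    {s : MultiCov k p E}
    (hs : s ∈ symbolFibre k p E) : glSymbol A s ∈ symbolFibre k p E := by
  let g : ((E →L[ℝ] ℝ) →L[ℝ] (E →L[ℝ] ℝ)) →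
      MultiCov k p E :=
    fun T => s.compContinuousLinearMap fun _ => T
  have hid : HasFDerivAt (fun T : (E →L[ℝ] ℝ) →L[ℝ] (E →L[ℝ] ℝ) => T)
      (ContinuousLinearMap.id ℝ ((E →L[ℝ] ℝ) →L[ℝ] (E →L[ℝ] ℝ)))
      (ContinuousLinearMap.id ℝ (E →L[ℝ] ℝ)) := hasFDerivAt_id _
  have hc : HasFDerivAt (fun _ : (E →L[ℝ] ℝ) →L[ℝ] (E →L[ℝ] ℝ) => s)
      (0 : ((E →L[ℝ] ℝ) →L[ℝ] (E →L[ℝ] ℝ)) →L[ℝ] MultiCov k p E)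
      (ContinuousLinearMap.id ℝ (E →L[ℝ] ℝ)) := hasFDerivAt_const _ _
  have hg := hc.continuousMultilinearMapCompContinuousLinearMap
    (fun _ : Fin k ⊕ Fin p => hid)
  have := symbolFibre_fderiv (s := g) hg.differentiableAt
    (Filter.Eventually.of_forall fun T => symbolFibre_comp hs T)
    (ContinuousLinearMap.precomp ℝ A)
  rw [hg.fderiv] at this
  convert this using 1
  ext ξ
  simp [glSymbol]

theorem lieSymbolLocal_mem {X : E → E} {y : E}
    {s : E → MultiCov k p E}
    (hs : DifferentiableAt ℝ s y) (hm : ∀ᶠ z in 𝓝 y, s z ∈ symbolFibre k p E) :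
    lieSymbolLocal X s y ∈ symbolFibre k p E :=
  Submodule.sub_mem _ (symbolFibre_fderiv hs hm _) (glSymbol_mem _ hm.self_of_nhds)

end FibreLocal

section Jets

variable {E F G H : Type*} [NormedAddCommGroup E] [NormedSpace ℝ E]
  [NormedAddCommGroup F] [NormedSpace ℝ F] [NormedAddCommGroup G] [NormedSpace ℝ G]
  [NormedAddCommGroup H] [NormedSpace ℝ H] {U : Set E} {N : ℕ}

/-- Differential operators of order at most `N` with smooth coefficients on an open subset `U` of a
normed space. -/
def IsLocOp (U : Set E) (N : ℕ) (P : (E → F) → E → G) : Prop :=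
  ∃ C : (i : ℕ) → E → ((E [×i]→L[ℝ] F) →L[ℝ] G), (∀ i, ContDiffOn ℝ ∞ (C i) U) ∧
    ∀ f, ContDiffOn ℝ ∞ f U → ∀ y ∈ U,
      P f y = ∑ i ∈ Finset.range (N + 1), C i y (iteratedFDeriv ℝ i f y)

theorem IsLocOp.congr {P Q : (E → F) → E → G} (hP : IsLocOp U N P)
    (h : ∀ f, ContDiffOn ℝ ∞ f U → ∀ y ∈ U, Q f y = P f y) : IsLocOp U N Q := by
  obtain ⟨C, hC, hP⟩ := hP
  exact ⟨C, hC, fun f hf y hy => (h f hf y hy).trans (hP f hf y hy)⟩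

theorem IsLocOp.add {P Q : (E → F) → E → G} (hP : IsLocOp U N P) (hQ : IsLocOp U N Q) :
    IsLocOp U N (fun f y => P f y + Q f y) := by
  obtain ⟨C, hC, hP⟩ := hP
  obtain ⟨C', hC', hQ⟩ := hQ
  refine ⟨fun i y => C i y + C' i y, fun i => (hC i).add (hC' i), fun f hf y hy => ?_⟩
  simp [hP f hf y hy, hQ f hf y hy, Finset.sum_add_distrib]

theorem IsLocOp.sum {ι : Type*} (s : Finset ι) {P : ι → (E → F) → E → G}
    (hP : ∀ i ∈ s, IsLocOp U N (P i)) : IsLocOp U N (fun f y => ∑ i ∈ s, P i f y) := by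
  classical
  induction s using Finset.induction_on with
  | empty => exact ⟨fun _ _ => 0, fun _ => contDiffOn_const, fun f _ y _ => by simp⟩
  | insert a s ha ih =>
    refine ((hP a (by simp)).add (ih fun i hi => hP i (by simp [hi]))).congr fun f _ y _ => ?_
    simp [Finset.sum_insert ha]

theorem IsLocOp.clm {P : (E → F) → E → G} (hP : IsLocOp U N P) {B : E → G →L[ℝ] H}
    (hB : ContDiffOn ℝ ∞ B U) : IsLocOp U N (fun f y => B y (P f y)) := by
  obtain ⟨C, hC, hP⟩ := hP
  refine ⟨fun i y => (B y).comp (C i y), fun i => hB.clm_comp (hC i), fun f hf y hy => ?_⟩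
  simp [hP f hf y hy]

theorem isLocOp_jet {j : ℕ} (hj : j ≤ N) {B : E → (E [×j]→L[ℝ] F) →L[ℝ] G}
    (hB : ContDiffOn ℝ ∞ B U) : IsLocOp U N (fun f y => B y (iteratedFDeriv ℝ j f y)) := by
  refine ⟨Function.update (fun _ _ => 0) j B, fun i => ?_, fun f _ y _ => ?_⟩
  · rcases eq_or_ne i j with rfl | h
    · simpa using hB
    · simpa [h] using contDiffOn_const
  · rw [Finset.sum_eq_single j]
    · simp
    · intro b _ hb
      simp [hb]
    · intro h
      exact absurd (Finset.mem_range.2 (by omega)) h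

theorem contDiffOn_iteratedFDeriv (hU : IsOpen U) {f : E → F} (hf : ContDiffOn ℝ ∞ f U) (j : ℕ) :
    ContDiffOn ℝ ∞ (iteratedFDeriv ℝ j f) U := by
  induction j with
  | zero =>
    rw [iteratedFDeriv_zero_eq_comp]
    exact (LinearIsometryEquiv.contDiff _).comp_contDiffOn hf
  | succ j ih =>
    rw [iteratedFDeriv_succ_eq_comp_left]
    exact (LinearIsometryEquiv.contDiff _).comp_contDiffOn (ih.fderiv_of_isOpen hU (by simp))

theorem isLocOp_fderiv {P : (E → F) → E → G} (hU : IsOpen U) (hP : IsLocOp U N P) :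
    IsLocOp U (N + 1) (fun f y => fderiv ℝ (P f) y) := by
  obtain ⟨C, hC, hP⟩ := hP
  refine (IsLocOp.sum (N := N + 1) (Finset.range (N + 1)) (P := fun i f y =>
    ((ContinuousLinearMap.flipₗᵢ ℝ E (E [×i]→L[ℝ] F)
      G).toContinuousLinearEquiv.toContinuousLinearMap (fderiv ℝ (C i) y))
        (iteratedFDeriv ℝ i f y) +
    ((ContinuousLinearMap.compL ℝ E (E [×i]→L[ℝ] F) G (C i y)).comp
      ((continuousMultilinearCurryLeftEquiv ℝ (fun _ : Fin (i + 1) => E)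
        F).toContinuousLinearEquiv.toContinuousLinearMap)) (iteratedFDeriv ℝ (i + 1) f y))
    fun i hi => ?_).congr fun f hf y hy => ?_
  · have hi' : i < N + 1 := Finset.mem_range.1 hi
    refine (isLocOp_jet (by omega) ?_).add (isLocOp_jet (by omega) ?_)
    · exact (ContinuousLinearMap.contDiff _).comp_contDiffOn
        ((hC i).fderiv_of_isOpen hU (by simp))
    · exact ((ContinuousLinearMap.contDiff _).comp_contDiffOn (hC i)).clm_comp contDiffOn_const
  · have h1 : P f =ᶠ[𝓝 y] fun z => ∑ i ∈ Finset.range (N + 1), C i z (iteratedFDeriv ℝ i f z) := by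
      filter_upwards [hU.mem_nhds hy] with z hz using hP f hf z hz
    rw [h1.fderiv_eq]
    have hd1 : ∀ i, DifferentiableAt ℝ (C i) y := fun i =>
      ((hC i).contDiffAt (hU.mem_nhds hy)).differentiableAt (by simp)
    have hd2 : ∀ i, DifferentiableAt ℝ (iteratedFDeriv ℝ i f) y := fun i =>
      ((contDiffOn_iteratedFDeriv hU hf i).contDiffAt (hU.mem_nhds hy)).differentiableAt (by simp)
    rw [fderiv_fun_sum fun i _ => (hd1 i).clm_apply (hd2 i)]
    refine Finset.sum_congr rfl fun i _ => ?_
    rw [fderiv_clm_apply (hd1 i) (hd2 i), fderiv_iteratedFDeriv, add_comm]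
    rfl

theorem isLocOp_jet_comm (hU : IsOpen U) {X : E → E} (hX : ContDiffOn ℝ ∞ X U)
    {B : E → F →L[ℝ] F} (hB : ContDiffOn ℝ ∞ B U) (j : ℕ) :
    IsLocOp U j (fun (f : E → F) y =>
      iteratedFDeriv ℝ j (fun z => fderiv ℝ f z (X z) + B z (f z)) y -
        fderiv ℝ (iteratedFDeriv ℝ j f) y (X y)) := by
  induction j with
  | zero =>
    let c := continuousMultilinearCurryFin0 ℝ E F
    refine (isLocOp_jet (le_refl 0) (B := fun y =>
      (c.symm.toContinuousLinearEquiv.toContinuousLinearMap.comp (B y)).comp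
        c.toContinuousLinearEquiv.toContinuousLinearMap)
      ((contDiffOn_const.clm_comp hB).clm_comp contDiffOn_const)).congr fun f hf y hy => ?_
    rw [iteratedFDeriv_zero_eq_comp, iteratedFDeriv_zero_eq_comp,
      LinearIsometryEquiv.comp_fderiv]
    have h0 : c.symm (fderiv ℝ f y (X y) + B y (f y)) - c.symm (fderiv ℝ f y (X y)) =
        c.symm (B y (c (c.symm (f y)))) := by
      rw [map_add, add_sub_cancel_left, LinearIsometryEquiv.apply_symm_apply]
    exact h0
  | succ j ih =>
    let cL := continuousMultilinearCurryLeftEquiv ℝ (fun _ : Fin (j + 1) => E) F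
    have h2 : IsLocOp U (j + 1) (fun (f : E → F) y =>
        ((((ContinuousLinearMap.compL ℝ E E (E [×j]→L[ℝ] F)).flip (fderiv ℝ X y)).comp
          cL.toContinuousLinearEquiv.toContinuousLinearMap) (iteratedFDeriv ℝ (j + 1) f y))) :=
      isLocOp_jet le_rfl (((ContinuousLinearMap.contDiff _).comp_contDiffOn
        (hX.fderiv_of_isOpen hU (by simp))).clm_comp contDiffOn_const)
    refine (((isLocOp_fderiv hU ih).add h2).clm (B := fun _ =>
      cL.symm.toContinuousLinearEquiv.toContinuousLinearMap) contDiffOn_const).congr fun f hf y hy => ?_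
    have hn := hU.mem_nhds hy
    have hg : ContDiffOn ℝ ∞ (fun z => fderiv ℝ f z (X z) + B z (f z)) U :=
      ((hf.fderiv_of_isOpen hU (by simp)).clm_apply hX).add (hB.clm_apply hf)
    have hJ := contDiffOn_iteratedFDeriv hU hf j
    have hJ' := hJ.fderiv_of_isOpen (m := ∞) hU (by simp)
    have d1 : DifferentiableAt ℝ
        (iteratedFDeriv ℝ j (fun z => fderiv ℝ f z (X z) + B z (f z))) y :=
      ((contDiffOn_iteratedFDeriv hU hg j).contDiffAt hn).differentiableAt (by simp)
    have d2 : DifferentiableAt ℝ (fderiv ℝ (iteratedFDeriv ℝ j f)) y :=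
      (hJ'.contDiffAt hn).differentiableAt (by simp)
    have d3 : DifferentiableAt ℝ X y := (hX.contDiffAt hn).differentiableAt (by simp)
    have hs : IsSymmSndFDerivAt ℝ (iteratedFDeriv ℝ j f) y :=
      (hJ.contDiffAt hn).isSymmSndFDerivAt (by
        simp only [minSmoothness_of_isRCLikeNormedField]
        exact WithTop.coe_le_coe.2 (le_top : (2 : ℕ∞) ≤ ⊤))
    rw [fderiv_fun_sub d1 (d2.clm_apply d3), fderiv_clm_apply d2 d3,
      iteratedFDeriv_succ_eq_comp_left, iteratedFDeriv_succ_eq_comp_left,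
      LinearIsometryEquiv.comp_fderiv]
    have e1 : (fderiv ℝ (fderiv ℝ (iteratedFDeriv ℝ j f)) y).flip (X y) =
        fderiv ℝ (fderiv ℝ (iteratedFDeriv ℝ j f)) y (X y) := by
      ext1 v
      exact hs.eq v (X y)
    rw [e1]
    have h0 : cL.symm (fderiv ℝ (iteratedFDeriv ℝ j
          (fun z => fderiv ℝ f z (X z) + B z (f z))) y) -
        cL.symm (fderiv ℝ (fderiv ℝ (iteratedFDeriv ℝ j f)) y (X y)) =
        cL.symm ((fderiv ℝ (iteratedFDeriv ℝ j
          (fun z => fderiv ℝ f z (X z) + B z (f z))) y -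
          ((fderiv ℝ (iteratedFDeriv ℝ j f) y).comp (fderiv ℝ X y) +
            fderiv ℝ (fderiv ℝ (iteratedFDeriv ℝ j f)) y (X y))) +
          (cL (cL.symm (fderiv ℝ (iteratedFDeriv ℝ j f) y))).comp (fderiv ℝ X y)) := by
      rw [LinearIsometryEquiv.apply_symm_apply, ← map_sub]
      congr 1
      abel
    exact h0

theorem isLocOp_commutator (hU : IsOpen U) {X : E → E} (hX : ContDiffOn ℝ ∞ X U)
    {B : E → F →L[ℝ] F} (hB : ContDiffOn ℝ ∞ B U)
    {A : (i : ℕ) → E → ((E [×i]→L[ℝ] F) →L[ℝ] G)} (hA : ∀ i, ContDiffOn ℝ ∞ (A i) U) :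
    IsLocOp U N (fun (f : E → F) y =>
      fderiv ℝ (fun z => ∑ i ∈ Finset.range (N + 1), A i z (iteratedFDeriv ℝ i f z)) y (X y) -
      ∑ i ∈ Finset.range (N + 1),
        A i y (iteratedFDeriv ℝ i (fun z => fderiv ℝ f z (X z) + B z (f z)) y)) := by
  have hmono : ∀ i ∈ Finset.range (N + 1), IsLocOp U N (fun (f : E → F) y =>
      (fderiv ℝ (A i) y (X y)) (iteratedFDeriv ℝ i f y) + (-A i y) (iteratedFDeriv ℝ i
        (fun z => fderiv ℝ f z (X z) + B z (f z)) y -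
        fderiv ℝ (iteratedFDeriv ℝ i f) y (X y))) := by
    intro i hi
    have hi' : i ≤ N := by have := Finset.mem_range.1 hi; omega
    refine (isLocOp_jet hi' (((hA i).fderiv_of_isOpen hU (by simp)).clm_apply hX)).add
      (IsLocOp.clm ?_ (hA i).neg)
    obtain ⟨C, hC, h⟩ := isLocOp_jet_comm hU hX hB i
    refine (IsLocOp.sum (Finset.range (i + 1)) fun l hl =>
      isLocOp_jet (N := N) (j := l) ?_ (hC l)).congr fun f hf y hy => h f hf y hy
    have := Finset.mem_range.1 hl
    omega
  refine (IsLocOp.sum _ hmono).congr fun f hf y hy => ?_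
  have hn := hU.mem_nhds hy
  have hd1 : ∀ i, DifferentiableAt ℝ (A i) y := fun i =>
    ((hA i).contDiffAt hn).differentiableAt (by simp)
  have hd2 : ∀ i, DifferentiableAt ℝ (iteratedFDeriv ℝ i f) y := fun i =>
    ((contDiffOn_iteratedFDeriv hU hf i).contDiffAt hn).differentiableAt (by simp)
  rw [fderiv_fun_sum fun i _ => (hd1 i).clm_apply (hd2 i), sum_apply, ← Finset.sum_sub_distrib]
  refine Finset.sum_congr rfl fun i _ => ?_
  rw [fderiv_clm_apply (hd1 i) (hd2 i)]
  simp
  abel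

end Jets

/-- The model space `ℝⁿ`. -/
abbrev Model (n : ℕ) : Type := EuclideanSpace ℝ (Fin n)

section Geometry

variable {n k p : ℕ} {M : Type*} [TopologicalSpace M] [ChartedSpace (Model n) M]

/-- The differential `T_x M → ℝⁿ` of a chart `φ` at `x`. -/
def dChart (φ : OpenPartialHomeomorph M (Model n)) (x : M) :
    TangentSpace (𝓡 n) x →L[ℝ] Model n :=
  mfderiv (𝓡 n) (𝓡 n) φ x

/-- The expression of a field of `p`-forms in the chart `φ`. -/
def localForm (φ : OpenPartialHomeomorph M (Model n))
    (θ : Π x : M, TangentSpace (𝓡 n) x [⋀^Fin p]→L[ℝ] ℝ) (y : Model n) :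
    Model n [⋀^Fin p]→L[ℝ] ℝ :=
  (θ (φ.symm y)).compContinuousLinearMap (dChart φ (φ.symm y)).inverse

/-- The expression of a contravariant tensor field in the chart `φ`. -/
def localSymbol (φ : OpenPartialHomeomorph M (Model n))
    (s : Π x : M, MultiCov k p (TangentSpace (𝓡 n) x)) (y : Model n) : MultiCov k p (Model n) :=
  (s (φ.symm y)).compContinuousLinearMap
    fun _ => ContinuousLinearMap.precomp ℝ (dChart φ (φ.symm y))

variable [IsManifold (𝓡 n) ∞ M]

/-- `Vect(M)`: the smooth vector fields on `M`. -/
abbrev Vect (n : ℕ) (M : Type*) [TopologicalSpace M] [ChartedSpace (Model n) M]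
    [IsManifold (𝓡 n) ∞ M] : Type _ :=
  Cₛ^∞⟮𝓡 n; Model n, (TangentSpace (𝓡 n) : M → Type)⟯

/-- The expression of a vector field in the chart `φ`. -/
def localVect (φ : OpenPartialHomeomorph M (Model n)) (X : Vect n M) (y : Model n) : Model n :=
  dChart φ (φ.symm y) (X (φ.symm y))

theorem chart_mdiff {φ : OpenPartialHomeomorph M (Model n)}
    (hφ : φ ∈ IsManifold.maximalAtlas (𝓡 n) ∞ M) :
    OpenPartialHomeomorph.MDifferentiable (𝓡 n) (𝓡 n) φ :=
  ⟨(contMDiffOn_of_mem_maximalAtlas hφ).mdifferentiableOn (by simp),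
    (contMDiffOn_symm_of_mem_maximalAtlas hφ).mdifferentiableOn (by simp)⟩

theorem dChart_isInvertible {φ : OpenPartialHomeomorph M (Model n)}
    (hφ : φ ∈ IsManifold.maximalAtlas (𝓡 n) ∞ M) {x : M} (hx : x ∈ φ.source) :
    (dChart φ x).IsInvertible :=
  ⟨(chart_mdiff hφ).mfderiv hx, rfl⟩

section Pair

variable {e φ : OpenPartialHomeomorph M (Model n)}

theorem contDiffOn_transition (he : e ∈ IsManifold.maximalAtlas (𝓡 n) ∞ M)
    (hφ : φ ∈ IsManifold.maximalAtlas (𝓡 n) ∞ M)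
 :
    ContDiffOn ℝ ∞ (φ ∘ e.symm) (e.target ∩ e.symm ⁻¹' φ.source) := by
  rw [← contMDiffOn_iff_contDiffOn]
  exact (contMDiffOn_of_mem_maximalAtlas hφ).comp'
    (contMDiffOn_symm_of_mem_maximalAtlas he)

theorem fderiv_transition_comp (he : e ∈ IsManifold.maximalAtlas (𝓡 n) ∞ M)
    (hφ : φ ∈ IsManifold.maximalAtlas (𝓡 n) ∞ M)
    {x : M} (hx : x ∈ e.source) (hx' : x ∈ φ.source) :
    (fderiv ℝ (φ ∘ e.symm) (e x)).comp (dChart e x) = dChart φ x := by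
  have hm : MDifferentiableAt (𝓡 n) (𝓡 n) e x :=
    (chart_mdiff he).mdifferentiableAt hx
  have hz : e x ∈ e.target ∩ e.symm ⁻¹' φ.source :=
    ⟨e.map_source hx, by simpa [e.left_inv hx] using hx'⟩
  have ho : IsOpen (e.target ∩ e.symm ⁻¹' φ.source) := e.isOpen_inter_preimage_symm φ.open_source
  have hd : DifferentiableAt ℝ (φ ∘ e.symm) (e x) :=
    ((contDiffOn_transition he hφ).contDiffAt (ho.mem_nhds hz)).differentiableAt (by simp)
  have h1 := mfderiv_comp x hd.mdifferentiableAt hm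
  rw [mfderiv_eq_fderiv] at h1
  have h2 : mfderiv (𝓡 n) (𝓡 n) ((φ ∘ e.symm) ∘ e) x = mfderiv (𝓡 n) (𝓡 n) φ x := by
    apply Filter.EventuallyEq.mfderiv_eq
    filter_upwards [e.open_source.mem_nhds hx] with w hw
    simp [e.left_inv hw]
  exact h1.symm.trans h2

theorem localVect_transition (he : e ∈ IsManifold.maximalAtlas (𝓡 n) ∞ M)
    (hφ : φ ∈ IsManifold.maximalAtlas (𝓡 n) ∞ M)
    (X : Vect n M) {z : Model n}
    (hz : z ∈ e.target ∩ e.symm ⁻¹' φ.source) :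
    localVect φ X ((φ ∘ e.symm) z) = fderiv ℝ (φ ∘ e.symm) z (localVect e X z) := by
  have hx : e.symm z ∈ e.source := e.map_target hz.1
  have h := fderiv_transition_comp he hφ hx hz.2
  rw [e.right_inv hz.1] at h
  have h0 : localVect φ X ((φ ∘ e.symm) z) = dChart φ (e.symm z) (X (e.symm z)) :=
    congrArg (fun w => dChart φ w (X w)) (φ.left_inv hz.2)
  rw [h0, ← h]
  rfl

theorem localForm_transition (he : e ∈ IsManifold.maximalAtlas (𝓡 n) ∞ M)
    (hφ : φ ∈ IsManifold.maximalAtlas (𝓡 n) ∞ M)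
    (θ : Π x : M, TangentSpace (𝓡 n) x [⋀^Fin p]→L[ℝ] ℝ) {z : Model n}
    (hz : z ∈ e.target ∩ e.symm ⁻¹' φ.source) :
    localForm e θ z = (localForm φ θ ((φ ∘ e.symm) z)).compContinuousLinearMap
      (fderiv ℝ (φ ∘ e.symm) z) := by
  have hx : e.symm z ∈ e.source := e.map_target hz.1
  have h := fderiv_transition_comp he hφ hx hz.2
  rw [e.right_inv hz.1] at h
  have h0 : localForm φ θ ((φ ∘ e.symm) z) =
      (θ (e.symm z)).compContinuousLinearMap (dChart φ (e.symm z)).inverse :=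
    congrArg (fun w => (θ w).compContinuousLinearMap (dChart φ w).inverse) (φ.left_inv hz.2)
  obtain ⟨a, ha⟩ := dChart_isInvertible he hx
  obtain ⟨b, hb⟩ := dChart_isInvertible hφ hz.2
  rw [h0, localForm]
  ext v
  simp only [ContinuousAlternatingMap.compContinuousLinearMap_apply]
  congr 1
  funext i
  have h3 : fderiv ℝ (φ ∘ e.symm) z (v i) = dChart φ (e.symm z) (a.symm (v i)) := by
    rw [← h, ← ha]; simp
  simp only [Function.comp_apply]
  rw [h3, ← ha, ← hb]
  simp

theorem localSymbol_transition (he : e ∈ IsManifold.maximalAtlas (𝓡 n) ∞ M)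
    (hφ : φ ∈ IsManifold.maximalAtlas (𝓡 n) ∞ M)
    (s : Π x : M, MultiCov k p (TangentSpace (𝓡 n) x)) {z : Model n}
    (hz : z ∈ e.target ∩ e.symm ⁻¹' φ.source) :
    localSymbol φ s ((φ ∘ e.symm) z) = (localSymbol e s z).compContinuousLinearMap
      fun _ => ContinuousLinearMap.precomp ℝ (fderiv ℝ (φ ∘ e.symm) z) := by
  have hx : e.symm z ∈ e.source := e.map_target hz.1
  have h := fderiv_transition_comp he hφ hx hz.2
  rw [e.right_inv hz.1] at h
  have h0 : localSymbol φ s ((φ ∘ e.symm) z) =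
      (s (e.symm z)).compContinuousLinearMap
        fun _ => ContinuousLinearMap.precomp ℝ (dChart φ (e.symm z)) :=
    congrArg (fun w => (s w).compContinuousLinearMap
      fun _ => ContinuousLinearMap.precomp ℝ (dChart φ w)) (φ.left_inv hz.2)
  rw [h0, localSymbol, ← h]
  rfl

end Pair

theorem contDiffOn_localVect {φ : OpenPartialHomeomorph M (Model n)}
    (hφ : φ ∈ IsManifold.maximalAtlas (𝓡 n) ∞ M) (X : Vect n M) :
    ContDiffOn ℝ ∞ (localVect φ X) φ.target := by
  rw [← contMDiffOn_iff_contDiffOn]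
  have h1 : ContMDiffOn (𝓡 n).tangent (𝓡 n).tangent ∞
      (tangentMapWithin (𝓡 n) (𝓡 n) φ φ.source)
      (Bundle.TotalSpace.proj ⁻¹' φ.source) :=
    (contMDiffOn_of_mem_maximalAtlas hφ).contMDiffOn_tangentMapWithin (by simp)
      φ.open_source.uniqueMDiffOn
  have h2 : ContMDiffOn (𝓡 n) (𝓡 n).tangent ∞
      (fun y => (⟨φ.symm y, X (φ.symm y)⟩ : TangentBundle (𝓡 n) M)) φ.target :=
    X.contMDiff.comp_contMDiffOn (contMDiffOn_symm_of_mem_maximalAtlas hφ)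
  have h3 := (contMDiff_snd_tangentBundle_modelSpace (Model n) (𝓡 n) (n := ∞)).comp_contMDiffOn
    (h1.comp h2 fun y hy => φ.map_target hy)
  refine h3.congr fun y hy => ?_
  exact congrArg (fun L : TangentSpace (𝓡 n) (φ.symm y) →L[ℝ] TangentSpace (𝓡 n)
    (φ (φ.symm y)) => L (X (φ.symm y)))
    (mfderivWithin_of_isOpen φ.open_source (φ.map_target hy)).symm

/-- `Ω^p(M)`: the smooth `p`-forms on `M`. -/
def Form (n : ℕ) (M : Type*) [TopologicalSpace M] [ChartedSpace (Model n) M] (p : ℕ) :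
    Submodule ℝ (Π x : M, TangentSpace (𝓡 n) x [⋀^Fin p]→L[ℝ] ℝ) where
  carrier := {θ | ∀ φ ∈ IsManifold.maximalAtlas (𝓡 n) ∞ M,
    ContDiffOn ℝ ∞ (localForm φ θ) φ.target}
  add_mem' := fun ha hb φ hφ => (ha φ hφ).add (hb φ hφ)
  zero_mem' := fun _ _ => contDiffOn_const (c := 0)
  smul_mem' := fun c _ ha φ hφ => (ha φ hφ).const_smul c

/-- `S^k_p`: the smooth sections of `⋀^p TM ⊗ S^k TM`. -/
def Symbol (n : ℕ) (M : Type*) [TopologicalSpace M] [ChartedSpace (Model n) M] (k p : ℕ) :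
    Submodule ℝ (Π x : M, MultiCov k p (TangentSpace (𝓡 n) x)) where
  carrier := {s | (∀ x, s x ∈ symbolFibre k p (TangentSpace (𝓡 n) x)) ∧
    ∀ φ ∈ IsManifold.maximalAtlas (𝓡 n) ∞ M, ContDiffOn ℝ ∞ (localSymbol φ s) φ.target}
  add_mem' := fun ha hb => ⟨fun x => add_mem (ha.1 x) (hb.1 x),
    fun φ hφ => (ha.2 φ hφ).add (hb.2 φ hφ)⟩
  zero_mem' := ⟨fun _ => zero_mem _, fun _ _ => contDiffOn_const (c := 0)⟩
  smul_mem' := fun c _ ha => ⟨fun x => Submodule.smul_mem _ c (ha.1 x),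
    fun φ hφ => (ha.2 φ hφ).const_smul c⟩

/-- The Lie derivative of a field of `p`-forms at `x`, computed in the preferred chart at `x`. By
`localForm_lieFormAt` every chart gives the same result. -/
def lieFormAt (X : Vect n M) (θ : Π x : M, TangentSpace (𝓡 n) x [⋀^Fin p]→L[ℝ] ℝ) (x : M) :
    TangentSpace (𝓡 n) x [⋀^Fin p]→L[ℝ] ℝ :=
  (lieFormLocal (localVect (chartAt (Model n) x) X) (localForm (chartAt (Model n) x) θ)
    (chartAt (Model n) x x)).compContinuousLinearMap (dChart (chartAt (Model n) x) x)

/-- The Lie derivative of a contravariant tensor field at `x`, computed in the preferred chart at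
`x`. By `localSymbol_lieSymbolAt` every chart gives the same result. -/
def lieSymbolAt (X : Vect n M) (s : Π x : M, MultiCov k p (TangentSpace (𝓡 n) x)) (x : M) :
    MultiCov k p (TangentSpace (𝓡 n) x) :=
  (lieSymbolLocal (localVect (chartAt (Model n) x) X) (localSymbol (chartAt (Model n) x) s)
    (chartAt (Model n) x x)).compContinuousLinearMap
      fun _ => ContinuousLinearMap.precomp ℝ (dChart (chartAt (Model n) x) x).inverse

theorem localForm_lieFormAt {φ : OpenPartialHomeomorph M (Model n)}
    (hφ : φ ∈ IsManifold.maximalAtlas (𝓡 n) ∞ M) (X : Vect n M)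
    {θ : Π x : M, TangentSpace (𝓡 n) x [⋀^Fin p]→L[ℝ] ℝ} (hθ : θ ∈ Form n M p)
    {y : Model n} (hy : y ∈ φ.target) :
    localForm φ (lieFormAt X θ) y = lieFormLocal (localVect φ X) (localForm φ θ) y := by
  set x := φ.symm y with hxdef
  have hx : x ∈ φ.source := φ.map_target hy
  set e := chartAt (Model n) x with hedef
  have he : e ∈ IsManifold.maximalAtlas (𝓡 n) ∞ M := IsManifold.chart_mem_maximalAtlas x
  have hxe : x ∈ e.source := mem_chart_source _ x
  have ho : IsOpen (φ.target ∩ φ.symm ⁻¹' e.source) := φ.isOpen_inter_preimage_symm e.open_source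
  have hz : y ∈ φ.target ∩ φ.symm ⁻¹' e.source := ⟨hy, hxe⟩
  have hτ := (contDiffOn_transition hφ he).contDiffAt (ho.mem_nhds hz)
  have het : (e ∘ φ.symm) y ∈ e.target := e.map_source hxe
  have key := lieFormLocal_natural (τ := e ∘ φ.symm) (y := y)
    (X := localVect φ X) (Y := localVect e X) (α := localForm φ θ) (β := localForm e θ)
    (hτ.of_le (WithTop.coe_le_coe.2 (le_top : (2 : ℕ∞) ≤ ⊤)))
    (((contDiffOn_localVect hφ X).contDiffAt (φ.open_target.mem_nhds hy)).differentiableAt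
      (by simp))
    (((contDiffOn_localVect he X).contDiffAt (e.open_target.mem_nhds het)).differentiableAt
      (by simp))
    (((hθ e he).contDiffAt (e.open_target.mem_nhds het)).differentiableAt (by simp))
    (by filter_upwards [ho.mem_nhds hz] with z hz using localVect_transition hφ he X hz)
    (by filter_upwards [ho.mem_nhds hz] with z hz using localForm_transition hφ he θ hz)
  rw [key]
  have h := fderiv_transition_comp hφ he hx hxe
  rw [hxdef, φ.right_inv hy, ← hxdef] at h
  obtain ⟨b, hb⟩ := dChart_isInvertible hφ hx
  ext v
  have h1 : localForm φ (lieFormAt X θ) y v =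
      lieFormLocal (localVect e X) (localForm e θ) (e x)
        fun i => dChart e x ((dChart φ x).inverse (v i)) := rfl
  rw [h1, ContinuousAlternatingMap.compContinuousLinearMap_apply]
  have h2 : (fun i => dChart e x ((dChart φ x).inverse (v i))) =
      (fderiv ℝ (e ∘ φ.symm) y) ∘ v := by
    funext i
    rw [← h, ← hb]
    simp
  rw [h2]
  rfl

theorem localSymbol_lieSymbolAt {φ : OpenPartialHomeomorph M (Model n)}
    (hφ : φ ∈ IsManifold.maximalAtlas (𝓡 n) ∞ M) (X : Vect n M)
    {s : Π x : M, MultiCov k p (TangentSpace (𝓡 n) x)} (hs : s ∈ Symbol n M k p)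
    {y : Model n} (hy : y ∈ φ.target) :
    localSymbol φ (lieSymbolAt X s) y = lieSymbolLocal (localVect φ X) (localSymbol φ s) y := by
  set x := φ.symm y with hxdef
  have hx : x ∈ φ.source := φ.map_target hy
  set e := chartAt (Model n) x with hedef
  have he : e ∈ IsManifold.maximalAtlas (𝓡 n) ∞ M := IsManifold.chart_mem_maximalAtlas x
  have hxe : x ∈ e.source := mem_chart_source _ x
  have ho : IsOpen (e.target ∩ e.symm ⁻¹' φ.source) := e.isOpen_inter_preimage_symm φ.open_source
  have het : e x ∈ e.target := e.map_source hxe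
  have hz : e x ∈ e.target ∩ e.symm ⁻¹' φ.source :=
    ⟨het, by simpa only [Set.mem_preimage, e.left_inv hxe] using hx⟩
  have hτ := (contDiffOn_transition he hφ).contDiffAt (ho.mem_nhds hz)
  have hyx : (φ ∘ e.symm) (e x) = y := by
    simp only [Function.comp_apply, e.left_inv hxe]
    exact φ.right_inv hy
  have key := lieSymbolLocal_natural (τ := φ ∘ e.symm) (y := e x)
    (X := localVect e X) (Y := localVect φ X) (s := localSymbol e s) (t := localSymbol φ s)
    (hτ.of_le (WithTop.coe_le_coe.2 (le_top : (2 : ℕ∞) ≤ ⊤)))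
    (((contDiffOn_localVect he X).contDiffAt (e.open_target.mem_nhds het)).differentiableAt
      (by simp))
    (((contDiffOn_localVect hφ X).contDiffAt
      (φ.open_target.mem_nhds (hyx ▸ hy))).differentiableAt (by simp))
    (((hs.2 e he).contDiffAt (e.open_target.mem_nhds het)).differentiableAt (by simp))
    (((hs.2 φ hφ).contDiffAt (φ.open_target.mem_nhds (hyx ▸ hy))).differentiableAt (by simp))
    (by filter_upwards [ho.mem_nhds hz] with z hz using localVect_transition he hφ X hz)
    (by filter_upwards [ho.mem_nhds hz] with z hz using localSymbol_transition he hφ s hz)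
  rw [hyx] at key
  rw [key]
  have h := fderiv_transition_comp he hφ hxe hx
  obtain ⟨a, ha⟩ := dChart_isInvertible he hxe
  ext ξ
  have h1 : localSymbol φ (lieSymbolAt X s) y ξ =
      lieSymbolLocal (localVect e X) (localSymbol e s) (e x)
        fun i => ((ξ i).comp (dChart φ x)).comp (dChart e x).inverse := rfl
  rw [h1, ContinuousMultilinearMap.compContinuousLinearMap_apply]
  congr 1
  funext i
  ext v
  simp only [ContinuousLinearMap.precomp_apply, ContinuousLinearMap.comp_apply]
  rw [← h, ← ha]
  simp

/-- The Lie derivative `L_X` on `Ω^p(M)`. -/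
def lieForm (X : Vect n M) : Form n M p →ₗ[ℝ] Form n M p where
  toFun θ := ⟨lieFormAt X θ, fun φ hφ =>
    (contDiffOn_lieFormLocal φ.open_target (contDiffOn_localVect hφ X) (θ.2 φ hφ)).congr
      fun _ hy => localForm_lieFormAt hφ X θ.2 hy⟩
  map_add' θ θ' := by
    ext1
    funext x
    have hd : ∀ θ : Form n M p, DifferentiableAt ℝ
        (localForm (chartAt (Model n) x) θ.1) (chartAt (Model n) x x) := fun θ =>
      ((θ.2 _ (IsManifold.chart_mem_maximalAtlas x)).contDiffAt
        ((chartAt (Model n) x).open_target.mem_nhds (mem_chart_target _ x))).differentiableAt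
        (by simp)
    exact congrArg (fun w => ContinuousAlternatingMap.compContinuousLinearMap w
      (dChart (chartAt (Model n) x) x)) (lieFormLocal_add (hd θ) (hd θ'))
  map_smul' c θ := by
    ext1
    funext x
    have hd : DifferentiableAt ℝ
        (localForm (chartAt (Model n) x) θ.1) (chartAt (Model n) x x) :=
      ((θ.2 _ (IsManifold.chart_mem_maximalAtlas x)).contDiffAt
        ((chartAt (Model n) x).open_target.mem_nhds (mem_chart_target _ x))).differentiableAt
        (by simp)
    exact congrArg (fun w => ContinuousAlternatingMap.compContinuousLinearMap w
      (dChart (chartAt (Model n) x) x)) (lieFormLocal_smul c hd)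

/-- The Lie derivative `L_X` on `S^k_p`: the action of `Vect(M)` on symbols. -/
def lieSymbol (X : Vect n M) : Symbol n M k p →ₗ[ℝ] Symbol n M k p where
  toFun s := ⟨lieSymbolAt X s, fun x => by
      have he := IsManifold.chart_mem_maximalAtlas (I := 𝓡 n) (n := ∞) x
      have hn := (chartAt (Model n) x).open_target.mem_nhds (mem_chart_target _ x)
      exact symbolFibre_comp (lieSymbolLocal_mem
        (((s.2.2 _ he).contDiffAt hn).differentiableAt (by simp))
        (Filter.Eventually.of_forall fun z => symbolFibre_comp (s.2.1 _) _)) _,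
    fun φ hφ =>
    (contDiffOn_lieSymbolLocal φ.open_target (contDiffOn_localVect hφ X) (s.2.2 φ hφ)).congr
      fun _ hy => localSymbol_lieSymbolAt hφ X s.2 hy⟩
  map_add' s s' := by
    ext1
    funext x
    have hd : ∀ s : Symbol n M k p, DifferentiableAt ℝ
        (localSymbol (chartAt (Model n) x) s.1) (chartAt (Model n) x x) := fun s =>
      ((s.2.2 _ (IsManifold.chart_mem_maximalAtlas x)).contDiffAt
        ((chartAt (Model n) x).open_target.mem_nhds (mem_chart_target _ x))).differentiableAt
        (by simp)
    exact congrArg (fun w => ContinuousMultilinearMap.compContinuousLinearMap w fun _ =>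
      ContinuousLinearMap.precomp ℝ (dChart (chartAt (Model n) x) x).inverse)
      (lieSymbolLocal_add (hd s) (hd s'))
  map_smul' c s := by
    ext1
    funext x
    have hd : DifferentiableAt ℝ
        (localSymbol (chartAt (Model n) x) s.1) (chartAt (Model n) x x) :=
      ((s.2.2 _ (IsManifold.chart_mem_maximalAtlas x)).contDiffAt
        ((chartAt (Model n) x).open_target.mem_nhds (mem_chart_target _ x))).differentiableAt
        (by simp)
    exact congrArg (fun w => ContinuousMultilinearMap.compContinuousLinearMap w fun _ =>
      ContinuousLinearMap.precomp ℝ (dChart (chartAt (Model n) x) x).inverse)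
      (lieSymbolLocal_smul c hd)

/-- The Lie derivative `L_X f = X.f` on `C^∞(M)`. -/
def lieFun (X : Vect n M) : C^∞⟮𝓡 n, M; ℝ⟯ →ₗ[ℝ] C^∞⟮𝓡 n, M; ℝ⟯ where
  toFun f := ⟨fun x => mfderiv (𝓡 n) 𝓘(ℝ, ℝ) f x (X x), by
    have h1 : ContMDiff (𝓡 n).tangent 𝓘(ℝ, ℝ).tangent ∞ (tangentMap (𝓡 n) 𝓘(ℝ, ℝ) f) :=
      f.contMDiff.contMDiff_tangentMap (by simp)
    exact (contMDiff_snd_tangentBundle_modelSpace ℝ 𝓘(ℝ, ℝ) (n := ∞)).comp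
      (h1.comp X.contMDiff)⟩
  map_add' f g := by
    ext x
    have hf := f.contMDiff.mdifferentiableAt (x := x) (by simp)
    have hg := g.contMDiff.mdifferentiableAt (x := x) (by simp)
    exact congrArg (fun w => w (X x)) (mfderiv_add hf hg)
  map_smul' c f := by
    ext x
    have hf := f.contMDiff.mdifferentiableAt (x := x) (by simp)
    exact congrArg (fun w => w (X x)) (const_smul_mfderiv hf c)

theorem lieFun_local {φ : OpenPartialHomeomorph M (Model n)}
    (hφ : φ ∈ IsManifold.maximalAtlas (𝓡 n) ∞ M) (X : Vect n M) (f : C^∞⟮𝓡 n, M; ℝ⟯)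
    {y : Model n} (hy : y ∈ φ.target) :
    lieFun X f (φ.symm y) = fderiv ℝ (f ∘ φ.symm) y (localVect φ X y) := by
  have hx : φ.symm y ∈ φ.source := φ.map_target hy
  have hd : DifferentiableAt ℝ (f ∘ φ.symm) (φ (φ.symm y)) := by
    rw [φ.right_inv hy, ← mdifferentiableAt_iff_differentiableAt]
    exact (f.contMDiff.mdifferentiableAt (by simp)).comp y
      ((chart_mdiff hφ).symm.mdifferentiableAt hy)
  have h1 := mfderiv_comp (φ.symm y) hd.mdifferentiableAt ((chart_mdiff hφ).mdifferentiableAt hx)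
  rw [mfderiv_eq_fderiv] at h1
  have h2 : mfderiv (𝓡 n) 𝓘(ℝ, ℝ) ((f ∘ φ.symm) ∘ φ) (φ.symm y) =
      mfderiv (𝓡 n) 𝓘(ℝ, ℝ) f (φ.symm y) := by
    apply Filter.EventuallyEq.mfderiv_eq
    filter_upwards [φ.open_source.mem_nhds hx] with w hw
    simp [φ.left_inv hw]
  have h3 : (fderiv ℝ (f ∘ φ.symm) (φ (φ.symm y))).comp (dChart φ (φ.symm y)) =
      mfderiv (𝓡 n) 𝓘(ℝ, ℝ) f (φ.symm y) := h1.symm.trans h2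
  rw [φ.right_inv hy] at h3
  exact (congrArg (fun L : TangentSpace (𝓡 n) (φ.symm y) →L[ℝ] ℝ => L (X (φ.symm y))) h3).symm

/-- `D^k_p`: the linear differential operators of order at most `k` from `Ω^p(M)` to `C^∞(M)`, i.e.
the linear maps which in every chart are of the form `(D θ)(y) = ∑_{j ≤ k} A_j(y) (∂^j θ)(y)` with
smooth coefficients `A_j`, where `∂^j θ` is the `j`-th derivative of the expression of `θ` in the
chart (the array of all its partial derivatives of order `j`). -/
def DiffOp (n : ℕ) (M : Type*) [TopologicalSpace M] [ChartedSpace (Model n) M] (k p : ℕ) :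
    Submodule ℝ (Form n M p →ₗ[ℝ] C^∞⟮𝓡 n, M; ℝ⟯) where
  carrier := {D | ∀ φ ∈ IsManifold.maximalAtlas (𝓡 n) ∞ M,
    ∃ A : (j : ℕ) → Model n →
        ((Model n [×j]→L[ℝ] (Model n [⋀^Fin p]→L[ℝ] ℝ)) →L[ℝ] ℝ),
      (∀ j, ContDiffOn ℝ ∞ (A j) φ.target) ∧
      ∀ θ : Form n M p, ∀ y ∈ φ.target, D θ (φ.symm y) =
        ∑ j ∈ Finset.range (k + 1), A j y (iteratedFDeriv ℝ j (localForm φ θ.1) y)}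
  add_mem' := by
    intro D D' hD hD' φ hφ
    obtain ⟨A, hA, h⟩ := hD φ hφ
    obtain ⟨A', hA', h'⟩ := hD' φ hφ
    refine ⟨fun j y => A j y + A' j y, fun j => (hA j).add (hA' j), fun θ y hy => ?_⟩
    simp [h θ y hy, h' θ y hy, Finset.sum_add_distrib]
  zero_mem' := fun φ _ => ⟨fun _ _ => 0, fun _ => contDiffOn_const, fun θ y _ => by simp⟩
  smul_mem' := by
    intro c D hD φ hφ
    obtain ⟨A, hA, h⟩ := hD φ hφ
    refine ⟨fun j y => c • A j y, fun j => (hA j).const_smul c, fun θ y hy => ?_⟩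
    simp [h θ y hy, Finset.mul_sum]

theorem commutator_mem (X : Vect n M) {D : Form n M p →ₗ[ℝ] C^∞⟮𝓡 n, M; ℝ⟯}
    (hD : D ∈ DiffOp n M k p) : lieFun X ∘ₗ D - D ∘ₗ lieForm X ∈ DiffOp n M k p := by
  intro φ hφ
  obtain ⟨A, hA, h⟩ := hD φ hφ
  have hX := contDiffOn_localVect hφ X
  have hB : ContDiffOn ℝ ∞ (fun y =>
      (ContinuousAlternatingMap.fderivCompContinuousLinearMapCLM (ι := Fin p) ℝ
        (ContinuousLinearMap.id ℝ (Model n))).flip (fderiv ℝ (localVect φ X) y)) φ.target :=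
    (ContinuousLinearMap.contDiff _).comp_contDiffOn (hX.fderiv_of_isOpen φ.open_target (by simp))
  obtain ⟨C, hC, hC'⟩ := isLocOp_commutator (N := k) φ.open_target hX hB hA
  refine ⟨C, hC, fun θ y hy => ?_⟩
  rw [← hC' (localForm φ θ.1) (θ.2 φ hφ) y hy]
  have hn := φ.open_target.mem_nhds hy
  have h1 : (lieFun X ∘ₗ D - D ∘ₗ lieForm X) θ (φ.symm y) =
      lieFun X (D θ) (φ.symm y) - D (lieForm X θ) (φ.symm y) := rfl
  rw [h1, lieFun_local hφ X _ hy, h _ y hy]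
  congr 1
  · have h2 : (D θ ∘ φ.symm) =ᶠ[𝓝 y] fun z =>
        ∑ j ∈ Finset.range (k + 1), A j z (iteratedFDeriv ℝ j (localForm φ θ.1) z) := by
      filter_upwards [hn] with z hz using h θ z hz
    rw [h2.fderiv_eq]
  · refine Finset.sum_congr rfl fun j _ => ?_
    have h3 : localForm φ (lieForm X θ).1 =ᶠ[𝓝 y] fun z =>
        fderiv ℝ (localForm φ θ.1) z (localVect φ X z) +
          (ContinuousAlternatingMap.fderivCompContinuousLinearMapCLM (ι := Fin p) ℝ
            (ContinuousLinearMap.id ℝ (Model n))).flip (fderiv ℝ (localVect φ X) z)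
            (localForm φ θ.1 z) := by
      filter_upwards [hn] with z hz
      refine (localForm_lieFormAt hφ X θ.2 hz).trans ?_
      rw [lieFormLocal, glForm, sub_neg_eq_add]
      rfl
    rw [(h3.iteratedFDeriv ℝ j).self_of_nhds]

/-- The action `𝓛_X D = L_X ∘ D - D ∘ L_X` of `Vect(M)` on `D^k_p`. -/
def lieDiffOp (X : Vect n M) : DiffOp n M k p →ₗ[ℝ] DiffOp n M k p where
  toFun D := ⟨lieFun X ∘ₗ D.1 - D.1 ∘ₗ lieForm X, commutator_mem X D.2⟩
  map_add' D D' := by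
    ext1
    simp only [Submodule.coe_add, LinearMap.comp_add, LinearMap.add_comp]
    abel
  map_smul' c D := by
    ext1
    simp only [Submodule.coe_smul, LinearMap.comp_smul, LinearMap.smul_comp, smul_sub,
      RingHom.id_apply]

end Geometry

end FormOps

end

/-!
Operators of order zero are functionals on forms: `cosymb0` pairs a `p`-vector with a `p`-form, and
`symb0` inverts it on the fibres `⋀^p TM`. Both are natural under linear maps (`cosymb0_comp`) and
under `gl(n)` (`cosymb0_gl`), so that the pairing `IsPairing` is independent of charts and commutes
with Lie derivatives. The same holds for `symb1` and `cosymb1`, which identify functionals `a` on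
first derivatives of forms with the fibres of `⋀^p TM ⊗ TM`; this is the principal symbol of an
operator of order one, which is written `f ↦ a(∂f) + b f` in a chart.

The coefficient `b` is not a tensor in general. For `p = 0` and `p = n`, however, `p`-forms are
densities of weight `δ = 0` and `δ = 1` (`isWeight_zero`, `isWeight_top`). Under a change of charts
`τ`, the derivative of the form contributes `δ` times the logarithmic derivative of the Jacobian
determinant of `τ`, inserted in the symbol `a`, while the divergence of `a` contributes `1 + δ`
times the same term. Hence `c = b - κ div a` is a tensor if `κ (1 + δ) = δ`, that is for `κ = 0`
and `κ = 1 / 2` respectively (`firstOrder_transition`), and the infinitesimal form of this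
computation shows that it depends equivariantly on the operator (`firstOrder_equivariant`). For
`p = n`, functions are dual to `n`-forms, and `c` is the symmetric part of the operator under
formal adjunction; for `p = 0` it is the value of the operator on the constant function `1`.

The relation `IsSplit` between an operator and a pair of tensor fields says that this decomposition
holds in every chart of the maximal atlas. It is the graph of an isomorphism
(`exists_linearEquiv_of_rel`): locally defined tensor fields and operators that agree under changes
of charts glue (`exists_symbol`, `exists_diffOp`), and bump functions provide enough global forms
to detect the coefficients of an operator (`exists_form`).
-/

noncomputable section

namespace FormOps

/-! ### Normed structures on the coefficients of operators -/

-- These are found by inference, but slowly, as the types are nested spaces of linear maps.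
instance {n p : ℕ} : NormedAddCommGroup (Model n [⋀^Fin p]→L[ℝ] ℝ) :=
  inferInstance
instance {n p : ℕ} : NormedSpace ℝ (Model n [⋀^Fin p]→L[ℝ] ℝ) :=
  inferInstance
instance {n p : ℕ} : NormedAddCommGroup ((Model n [⋀^Fin p]→L[ℝ] ℝ) →L[ℝ] ℝ) :=
  inferInstance
instance {n p : ℕ} : NormedSpace ℝ ((Model n [⋀^Fin p]→L[ℝ] ℝ) →L[ℝ] ℝ) :=
  inferInstance
instance {n p : ℕ} : NormedAddCommGroup (Model n →L[ℝ] Model n [⋀^Fin p]→L[ℝ] ℝ) :=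
  inferInstance
instance {n p : ℕ} : NormedSpace ℝ (Model n →L[ℝ] Model n [⋀^Fin p]→L[ℝ] ℝ) :=
  inferInstance
instance {n p : ℕ} : NormedAddCommGroup ((Model n →L[ℝ] Model n [⋀^Fin p]→L[ℝ] ℝ) →L[ℝ] ℝ) :=
  inferInstance
instance {n p : ℕ} : NormedSpace ℝ ((Model n →L[ℝ] Model n [⋀^Fin p]→L[ℝ] ℝ) →L[ℝ] ℝ) :=
  inferInstance

/-! ### Exterior products of covectors -/

section Wedge

variable {n k p : ℕ}

/-- The `i`-th vector of the standard basis of `ℝⁿ`. -/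
def stdVec (i : Fin n) : Model n := EuclideanSpace.single i (1 : ℝ)

/-- The `i`-th coordinate on `ℝⁿ`: the dual of the standard basis. -/
def stdCov (i : Fin n) : Model n →L[ℝ] ℝ := EuclideanSpace.proj i

@[simp] theorem stdCov_apply (i : Fin n) (v : Model n) : stdCov i v = v i := rfl

theorem sum_stdCov_smul_stdVec (v : Model n) : ∑ i, stdCov i v • stdVec i = v := by
  ext j
  simp [stdVec, Finset.sum_apply, Pi.single_apply]

theorem sum_apply_stdVec_smul_stdCov (ξ : Model n →L[ℝ] ℝ) : ∑ i, ξ (stdVec i) • stdCov i = ξ := by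
  ext v
  conv_rhs => rw [← sum_stdCov_smul_stdVec v]
  simp [mul_comm]

theorem multilinear_expand_vec {ι : Type*} [Fintype ι] [DecidableEq ι] {H : Type*}
    [AddCommGroup H] [Module ℝ H] (f : MultilinearMap ℝ (fun _ : ι => Model n) H)
    (v : ι → Model n) :
    f v = ∑ J : ι → Fin n, (∏ i, stdCov (J i) (v i)) • f fun i => stdVec (J i) := by
  conv_lhs => rw [← funext fun i => sum_stdCov_smul_stdVec (v i)]
  rw [f.map_sum]
  exact Finset.sum_congr rfl fun J _ => f.map_smul_univ _ _

theorem multilinear_expand_cov {ι : Type*} [Fintype ι] [DecidableEq ι] {H : Type*}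
    [AddCommGroup H] [Module ℝ H] (f : MultilinearMap ℝ (fun _ : ι => Model n →L[ℝ] ℝ) H)
    (η : ι → Model n →L[ℝ] ℝ) :
    f η = ∑ J : ι → Fin n, (∏ i, η i (stdVec (J i))) • f fun i => stdCov (J i) := by
  conv_lhs => rw [← funext fun i => sum_apply_stdVec_smul_stdCov (η i)]
  rw [f.map_sum]
  exact Finset.sum_congr rfl fun J _ => f.map_smul_univ _ _

/-- The exterior product `η₁ ∧ … ∧ η_p`, normalised as `v ↦ det (ηᵢ (vⱼ))`. -/
def wedge (η : Fin p → (Model n →L[ℝ] ℝ)) : Model n [⋀^Fin p]→L[ℝ] ℝ :=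
  { Matrix.detRowAlternating.compLinearMap (LinearMap.pi fun i => (η i).toLinearMap) with
    cont := by
      change Continuous fun v : Fin p → Model n => Matrix.det (Matrix.of fun j i => η i (v j))
      refine Continuous.matrix_det (continuous_matrix fun j i => ?_)
      exact (η i).continuous.comp (continuous_apply j) }

theorem wedge_apply (η : Fin p → (Model n →L[ℝ] ℝ)) (v : Fin p → Model n) :
    wedge η v = Matrix.det (Matrix.of fun i j => η i (v j)) := by
  rw [← Matrix.det_transpose]
  rfl

theorem wedge_apply_sum_vec (η : Fin p → (Model n →L[ℝ] ℝ)) (v : Fin p → Model n) :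
    wedge η v = ∑ σ : Equiv.Perm (Fin p), (Equiv.Perm.sign σ : ℝ) * ∏ i, η i (v (σ i)) := by
  rw [wedge_apply, ← Matrix.det_transpose, Matrix.det_apply']
  rfl

theorem wedge_apply_sum_cov (η : Fin p → (Model n →L[ℝ] ℝ)) (v : Fin p → Model n) :
    wedge η v = ∑ σ : Equiv.Perm (Fin p), (Equiv.Perm.sign σ : ℝ) * ∏ i, η (σ i) (v i) := by
  rw [wedge_apply, Matrix.det_apply']
  rfl

theorem sign_mul_self (σ : Equiv.Perm (Fin p)) :
    (Equiv.Perm.sign σ : ℝ) * (Equiv.Perm.sign σ : ℝ) = 1 := by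
  rw [← Int.cast_mul, ← Units.val_mul, Int.units_mul_self]; simp

/-- The expansion of a form in decomposable ones. The sum runs over all multi-indices, so every
increasing one is counted `p!` times. -/
theorem sum_apply_smul_wedge (θ : Model n [⋀^Fin p]→L[ℝ] ℝ) :
    (p.factorial : ℝ)⁻¹ • ∑ J : Fin p → Fin n,
      θ (fun i => stdVec (J i)) • wedge (fun i => stdCov (J i)) = θ := by
  have hp : (p.factorial : ℝ) ≠ 0 := by exact_mod_cast p.factorial_ne_zero
  rw [inv_smul_eq_iff₀ hp]
  ext v
  have h : ∀ σ : Equiv.Perm (Fin p), (Equiv.Perm.sign σ : ℝ) *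
      ∑ J : Fin p → Fin n, (∏ i, stdCov (J i) (v (σ i))) * θ (fun i => stdVec (J i)) = θ v := by
    intro σ
    have h1 := multilinear_expand_vec θ.toMultilinearMap (v ∘ σ)
    have h2 := θ.toAlternatingMap.map_perm v σ
    have h3 : θ (v ∘ σ) = (Equiv.Perm.sign σ : ℝ) * θ v := by
      refine h2.trans ?_
      rw [Units.smul_def, zsmul_eq_mul]; rfl
    have h4 : θ (v ∘ σ) = ∑ J : Fin p → Fin n,
      (∏ i, stdCov (J i) (v (σ i))) * θ (fun i => stdVec (J i)) := h1
    rw [← h4, h3, ← mul_assoc, sign_mul_self, one_mul]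
  have h5 := Finset.sum_congr (rfl : (Finset.univ : Finset (Equiv.Perm (Fin p))) = _)
    fun σ _ => h σ
  rw [Finset.sum_const, Finset.card_univ, Fintype.card_perm, Fintype.card_fin] at h5
  rw [ContinuousAlternatingMap.smul_apply, smul_eq_mul, ← nsmul_eq_mul, ← h5,
    ContinuousAlternatingMap.sum_apply]
  simp only [ContinuousAlternatingMap.smul_apply, wedge_apply_sum_vec, smul_eq_mul,
    Finset.mul_sum]
  rw [Finset.sum_comm]
  refine Finset.sum_congr rfl fun σ _ => Finset.sum_congr rfl fun J _ => ?_
  ring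

/-- The expansion of an alternating function of `p` covectors in the coordinates of
`η₁ ∧ … ∧ η_p`. -/
theorem sum_alternating_mul_wedge (g : (Model n →L[ℝ] ℝ) [⋀^Fin p]→ₗ[ℝ] ℝ)
    (η : Fin p → (Model n →L[ℝ] ℝ)) :
    (p.factorial : ℝ)⁻¹ * ∑ J : Fin p → Fin n,
      g (fun i => stdCov (J i)) * wedge η (fun i => stdVec (J i)) = g η := by
  have hp : (p.factorial : ℝ) ≠ 0 := by exact_mod_cast p.factorial_ne_zero
  rw [inv_mul_eq_iff_eq_mul₀ hp]
  have h : ∀ σ : Equiv.Perm (Fin p), (Equiv.Perm.sign σ : ℝ) *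
      ∑ J : Fin p → Fin n, (∏ i, η (σ i) (stdVec (J i))) * g (fun i => stdCov (J i)) = g η := by
    intro σ
    have h1 := multilinear_expand_cov g.toMultilinearMap (η ∘ σ)
    have h2 := g.map_perm η σ
    have h3 : g (η ∘ σ) = (Equiv.Perm.sign σ : ℝ) * g η := by
      refine h2.trans ?_
      rw [Units.smul_def, zsmul_eq_mul]
    have h4 : g (η ∘ σ) = ∑ J : Fin p → Fin n,
      (∏ i, η (σ i) (stdVec (J i))) * g (fun i => stdCov (J i)) := h1
    rw [← h4, h3, ← mul_assoc, sign_mul_self, one_mul]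
  have h5 := Finset.sum_congr (rfl : (Finset.univ : Finset (Equiv.Perm (Fin p))) = _)
    fun σ _ => h σ
  rw [Finset.sum_const, Finset.card_univ, Fintype.card_perm, Fintype.card_fin] at h5
  rw [← nsmul_eq_mul, ← h5]
  simp only [wedge_apply_sum_cov, Finset.mul_sum]
  rw [Finset.sum_comm]
  refine Finset.sum_congr rfl fun σ _ => Finset.sum_congr rfl fun J _ => ?_
  ring

theorem wedge_update_add (η : Fin p → (Model n →L[ℝ] ℝ)) (i : Fin p) (a b : Model n →L[ℝ] ℝ) :
    wedge (Function.update η i (a + b)) =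
      wedge (Function.update η i a) + wedge (Function.update η i b) := by
  have e : ∀ (c : Model n →L[ℝ] ℝ) (v : Fin p → Model n),
      (Matrix.of fun k j => Function.update η i c k (v j)) =
        (Matrix.of fun k j => η k (v j)).updateRow i fun j => c (v j) := by
    intro c v
    ext k j
    rcases eq_or_ne k i with rfl | h
    · simp
    · simp [h]
  ext v
  simp only [wedge_apply, ContinuousAlternatingMap.add_apply, e]
  exact Matrix.det_updateRow_add _ _ _ _

theorem wedge_update_smul (η : Fin p → (Model n →L[ℝ] ℝ)) (i : Fin p) (c : ℝ)
    (a : Model n →L[ℝ] ℝ) :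
    wedge (Function.update η i (c • a)) = c • wedge (Function.update η i a) := by
  have e : ∀ (c : Model n →L[ℝ] ℝ) (v : Fin p → Model n),
      (Matrix.of fun k j => Function.update η i c k (v j)) =
        (Matrix.of fun k j => η k (v j)).updateRow i fun j => c (v j) := by
    intro c v
    ext k j
    rcases eq_or_ne k i with rfl | h
    · simp
    · simp [h]
  ext v
  simp only [wedge_apply, ContinuousAlternatingMap.smul_apply, e]
  exact Matrix.det_updateRow_smul _ _ _ _

theorem continuous_wedge :
    Continuous (wedge : (Fin p → (Model n →L[ℝ] ℝ)) → Model n [⋀^Fin p]→L[ℝ] ℝ) := by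
  have h : (wedge : (Fin p → (Model n →L[ℝ] ℝ)) → Model n [⋀^Fin p]→L[ℝ] ℝ) = fun η =>
      (p.factorial : ℝ)⁻¹ • ∑ J : Fin p → Fin n,
        wedge η (fun i => stdVec (J i)) • wedge (fun i => stdCov (J i)) :=
    funext fun η => (sum_apply_smul_wedge (wedge η)).symm
  rw [h]
  simp only [wedge_apply]
  have hd : ∀ J : Fin p → Fin n, Continuous fun η : Fin p → (Model n →L[ℝ] ℝ) =>
      Matrix.det (Matrix.of fun i j => η i (stdVec (J j))) := fun J => by
    refine Continuous.matrix_det (continuous_matrix fun i j => ?_)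
    exact (ContinuousLinearMap.apply ℝ ℝ (stdVec (J j) : Model n)).continuous.comp
      (continuous_apply i)
  fun_prop

theorem wedge_comp (η : Fin p → (Model n →L[ℝ] ℝ)) (T : Model n →L[ℝ] Model n) :
    wedge (fun i => (η i).comp T) = (wedge η).compContinuousLinearMap T := by
  ext v
  simp [wedge_apply]

theorem wedge_eq_zero {η : Fin p → (Model n →L[ℝ] ℝ)} {i j : Fin p} (hij : i ≠ j)
    (h : η i = η j) : wedge η = 0 := by
  ext v
  rw [wedge_apply]
  exact Matrix.det_zero_of_row_eq hij (by ext k; simp [h])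

/-- The action of `gl(n)` on decomposable forms. In the expansion of the determinant over
permutations `σ`, replacing the `i`-th row amounts to replacing the column `σ i`. -/
theorem sum_wedge_update_comp (η : Fin p → (Model n →L[ℝ] ℝ)) (A : Model n →L[ℝ] Model n) :
    ∑ i, wedge (Function.update η i ((η i).comp A)) = -glForm A (wedge η) := by
  ext v
  simp only [ContinuousAlternatingMap.sum_apply, ContinuousAlternatingMap.neg_apply, glForm_apply,
    neg_neg, wedge_apply_sum_vec]
  rw [Finset.sum_comm, Finset.sum_comm (s := Finset.univ (α := Fin p))]
  refine Finset.sum_congr rfl fun σ _ => ?_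
  refine Eq.trans ?_ (Equiv.sum_comp σ _)
  refine Finset.sum_congr rfl fun i _ => ?_
  congr 1
  refine Finset.prod_congr rfl fun k _ => ?_
  rcases eq_or_ne k i with rfl | h
  · simp
  · simp [h, σ.injective.ne h]

end Wedge

/-! ### Symbols as functionals on jets -/

section Functionals

variable {n k p : ℕ}

/-- A tensor in the fibre is alternating in its last `p` arguments. -/
def alternatingSlice {s : MultiCov k p (Model n)} (hs : s ∈ symbolFibre k p (Model n))
    (ξ : Fin k → (Model n →L[ℝ] ℝ)) : (Model n →L[ℝ] ℝ) [⋀^Fin p]→ₗ[ℝ] ℝ where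
  toFun η := s (Sum.elim ξ η)
  map_update_add' η i a b := by
    have e : ∀ x, Sum.elim ξ (Function.update η i x) =
        Function.update (Sum.elim ξ η) (Sum.inr i) x := fun x => Sum.update_elim_inr.symm
    simp only [e, s.map_update_add]
  map_update_smul' η i c a := by
    have e : ∀ x, Sum.elim ξ (Function.update η i x) =
        Function.update (Sum.elim ξ η) (Sum.inr i) x := fun x => Sum.update_elim_inr.symm
    simp only [e, s.map_update_smul]
  map_eq_zero_of_eq' η i j h hij := hs.2 ξ η i j hij h

/-- The decomposable `p`-form attached to a family of `0 + p` covectors. -/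
def decomp0 : ContinuousMultilinearMap ℝ (fun _ : Fin 0 ⊕ Fin p => (Model n →L[ℝ] ℝ))
    (Model n [⋀^Fin p]→L[ℝ] ℝ) where
  toFun ζ := wedge fun i => ζ (Sum.inr i)
  map_update_add' ζ i a b := by
    rcases i with i | i
    · exact i.elim0
    · have e : ∀ c, (fun j => Function.update ζ (Sum.inr i) c (Sum.inr j)) =
          Function.update (fun j => ζ (Sum.inr j)) i c := fun c =>
        Function.update_comp_eq_of_injective ζ Sum.inr_injective i c
      rw [e, e, e, wedge_update_add]
  map_update_smul' ζ i c a := by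
    rcases i with i | i
    · exact i.elim0
    · have e : ∀ c, (fun j => Function.update ζ (Sum.inr i) c (Sum.inr j)) =
          Function.update (fun j => ζ (Sum.inr j)) i c := fun c =>
        Function.update_comp_eq_of_injective ζ Sum.inr_injective i c
      rw [e, e, wedge_update_smul]
  cont := continuous_wedge.comp (continuous_pi fun i => continuous_apply _)

/-- The rank one map `v ↦ ξ(v) η₁ ∧ … ∧ η_p` attached to a family of `1 + p` covectors. -/
def decomp1 : ContinuousMultilinearMap ℝ (fun _ : Fin 1 ⊕ Fin p => (Model n →L[ℝ] ℝ))
    (Model n →L[ℝ] Model n [⋀^Fin p]→L[ℝ] ℝ) where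
  toFun ζ := ContinuousLinearMap.smulRightL ℝ (Model n) (Model n [⋀^Fin p]→L[ℝ] ℝ)
    (ζ (Sum.inl 0)) (wedge fun i => ζ (Sum.inr i))
  map_update_add' ζ i a b := by
    rcases i with i | i
    · obtain rfl := Subsingleton.elim i 0
      simp
    · have e : ∀ c, (fun j => Function.update ζ (Sum.inr i) c (Sum.inr j)) =
          Function.update (fun j => ζ (Sum.inr j)) i c := fun c =>
        Function.update_comp_eq_of_injective ζ Sum.inr_injective i c
      rw [e, e, e, wedge_update_add, map_add]
      simp
  map_update_smul' ζ i c a := by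
    rcases i with i | i
    · obtain rfl := Subsingleton.elim i 0
      simp
    · have e : ∀ c, (fun j => Function.update ζ (Sum.inr i) c (Sum.inr j)) =
          Function.update (fun j => ζ (Sum.inr j)) i c := fun c =>
        Function.update_comp_eq_of_injective ζ Sum.inr_injective i c
      rw [e, e, wedge_update_smul, map_smul]
      simp
  cont := ((ContinuousLinearMap.continuous _).comp (continuous_apply _)).clm_apply
    (continuous_wedge.comp (continuous_pi fun i => continuous_apply _))

@[simp] theorem decomp0_apply (ζ : Fin 0 ⊕ Fin p → (Model n →L[ℝ] ℝ)) :
    decomp0 ζ = wedge fun i => ζ (Sum.inr i) := rfl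

theorem decomp1_apply (ζ : Fin 1 ⊕ Fin p → (Model n →L[ℝ] ℝ)) :
    decomp1 ζ = (ζ (Sum.inl 0)).smulRight (wedge fun i => ζ (Sum.inr i)) := rfl

/-- The tensor in `⋀^p ℝⁿ` defined by a functional on `p`-forms. -/
def symb0 : ((Model n [⋀^Fin p]→L[ℝ] ℝ) →L[ℝ] ℝ) →L[ℝ] MultiCov 0 p (Model n) :=
  (ContinuousLinearMap.compContinuousMultilinearMapL ℝ _ _ ℝ).flip decomp0

/-- The tensor in `ℝⁿ ⊗ ⋀^p ℝⁿ` defined by a functional on first derivatives of `p`-forms. -/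
def symb1 : ((Model n →L[ℝ] Model n [⋀^Fin p]→L[ℝ] ℝ) →L[ℝ] ℝ) →L[ℝ] MultiCov 1 p (Model n) :=
  (ContinuousLinearMap.compContinuousMultilinearMapL ℝ _ _ ℝ).flip decomp1

@[simp] theorem symb0_apply (l : (Model n [⋀^Fin p]→L[ℝ] ℝ) →L[ℝ] ℝ)
    (ζ : Fin 0 ⊕ Fin p → (Model n →L[ℝ] ℝ)) : symb0 l ζ = l (decomp0 ζ) := rfl

@[simp] theorem symb1_apply (l : (Model n →L[ℝ] Model n [⋀^Fin p]→L[ℝ] ℝ) →L[ℝ] ℝ)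
    (ζ : Fin 1 ⊕ Fin p → (Model n →L[ℝ] ℝ)) : symb1 l ζ = l (decomp1 ζ) := rfl

theorem symb0_mem (l : (Model n [⋀^Fin p]→L[ℝ] ℝ) →L[ℝ] ℝ) :
    symb0 l ∈ symbolFibre 0 p (Model n) := by
  refine ⟨fun σ ξ η => ?_, fun ξ η i j hij h => ?_⟩
  · rw [Subsingleton.elim (ξ ∘ σ) ξ]
  · rw [symb0_apply, decomp0_apply,
      wedge_eq_zero (η := fun i => Sum.elim ξ η (Sum.inr i)) hij h, map_zero]

theorem symb1_mem (l : (Model n →L[ℝ] Model n [⋀^Fin p]→L[ℝ] ℝ) →L[ℝ] ℝ) :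
    symb1 l ∈ symbolFibre 1 p (Model n) := by
  refine ⟨fun σ ξ η => ?_, fun ξ η i j hij h => ?_⟩
  · rw [Subsingleton.elim σ 1]; rfl
  · rw [symb1_apply, decomp1_apply, wedge_eq_zero (η := fun i => Sum.elim ξ η (Sum.inr i)) hij h]
    simp

/-- The pairing of contravariant tensors with `p`-forms, the inverse of `symb0` on `⋀^p ℝⁿ`. The
factor `1 / p!` compensates for the sum over all multi-indices instead of increasing ones. -/
def cosymb0 : MultiCov 0 p (Model n) →L[ℝ] (Model n [⋀^Fin p]→L[ℝ] ℝ) →L[ℝ] ℝ :=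
  (p.factorial : ℝ)⁻¹ • ∑ J : Fin p → Fin n, (ContinuousLinearMap.smulRightL ℝ
    (MultiCov 0 p (Model n)) ((Model n [⋀^Fin p]→L[ℝ] ℝ) →L[ℝ] ℝ)
      (ContinuousMultilinearMap.apply ℝ _ ℝ (Sum.elim Fin.elim0 fun i => stdCov (J i))))
    (ContinuousAlternatingMap.apply ℝ (Model n) ℝ fun i => stdVec (J i))

/-- The pairing of contravariant tensors with first derivatives of `p`-forms, the inverse of `symb1`
on `ℝⁿ ⊗ ⋀^p ℝⁿ`. -/
def cosymb1 : MultiCov 1 p (Model n) →L[ℝ] (Model n →L[ℝ] Model n [⋀^Fin p]→L[ℝ] ℝ) →L[ℝ] ℝ :=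
  (p.factorial : ℝ)⁻¹ • ∑ a : Fin n, ∑ J : Fin p → Fin n, (ContinuousLinearMap.smulRightL ℝ
    (MultiCov 1 p (Model n)) ((Model n →L[ℝ] Model n [⋀^Fin p]→L[ℝ] ℝ) →L[ℝ] ℝ)
      (ContinuousMultilinearMap.apply ℝ _ ℝ (Sum.elim (fun _ => stdCov a) fun i => stdCov (J i))))
    ((ContinuousAlternatingMap.apply ℝ (Model n) ℝ fun i => stdVec (J i)).comp
      (ContinuousLinearMap.apply ℝ (Model n [⋀^Fin p]→L[ℝ] ℝ) (stdVec a)))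

theorem cosymb0_apply (s : MultiCov 0 p (Model n)) (θ : Model n [⋀^Fin p]→L[ℝ] ℝ) :
    cosymb0 s θ = (p.factorial : ℝ)⁻¹ * ∑ J : Fin p → Fin n,
      s (Sum.elim Fin.elim0 fun i => stdCov (J i)) * θ fun i => stdVec (J i) := by
  simp [cosymb0, sum_apply, smul_apply]

theorem cosymb1_apply (s : MultiCov 1 p (Model n))
    (L : Model n →L[ℝ] Model n [⋀^Fin p]→L[ℝ] ℝ) :
    cosymb1 s L = (p.factorial : ℝ)⁻¹ * ∑ a : Fin n, ∑ J : Fin p → Fin n,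
      s (Sum.elim (fun _ => stdCov a) fun i => stdCov (J i)) *
        L (stdVec a) fun i => stdVec (J i) := by
  simp [cosymb1, sum_apply, smul_apply]

theorem cosymb0_symb0 (l : (Model n [⋀^Fin p]→L[ℝ] ℝ) →L[ℝ] ℝ) : cosymb0 (symb0 l) = l := by
  ext θ
  rw [cosymb0_apply]
  conv_rhs => rw [← sum_apply_smul_wedge θ]
  simp [mul_comm]

theorem cosymb1_symb1 (l : (Model n →L[ℝ] Model n [⋀^Fin p]→L[ℝ] ℝ) →L[ℝ] ℝ) :
    cosymb1 (symb1 l) = l := by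
  ext L
  rw [cosymb1_apply]
  have h : L = ∑ a, (stdCov a).smulRight ((p.factorial : ℝ)⁻¹ • ∑ J : Fin p → Fin n,
      (L (stdVec a)) (fun i => stdVec (J i)) • wedge (fun i => stdCov (J i))) := by
    ext1 v
    conv_lhs => rw [← sum_stdCov_smul_stdVec v]
    simp only [sum_apply_smul_wedge]
    rw [map_sum, sum_apply]
    exact Finset.sum_congr rfl fun a _ => map_smul _ _ _
  conv_rhs => rw [h]
  rw [map_sum, Finset.mul_sum]
  refine Finset.sum_congr rfl fun a _ => ?_
  have h1 : ∀ w, l ((stdCov a).smulRight w) =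
      (l.comp (ContinuousLinearMap.smulRightL ℝ _ _ (stdCov a))) w := fun w => rfl
  rw [h1, map_smul, map_sum, smul_eq_mul]
  congr 1
  refine Finset.sum_congr rfl fun J _ => ?_
  rw [map_smul, mul_comm]
  rfl

theorem symb0_cosymb0 {s : MultiCov 0 p (Model n)} (hs : s ∈ symbolFibre 0 p (Model n)) :
    symb0 (cosymb0 s) = s := by
  ext ζ
  rw [symb0_apply, cosymb0_apply, decomp0_apply]
  refine (sum_alternating_mul_wedge (alternatingSlice hs Fin.elim0) fun i => ζ (Sum.inr i)).trans
    (congrArg s ?_)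
  ext1 i
  rcases i with i | i
  · exact i.elim0
  · rfl

theorem symb1_cosymb1 {s : MultiCov 1 p (Model n)} (hs : s ∈ symbolFibre 1 p (Model n)) :
    symb1 (cosymb1 s) = s := by
  ext ζ
  rw [symb1_apply, cosymb1_apply, decomp1_apply, Finset.mul_sum]
  have h : ∀ a : Fin n, (p.factorial : ℝ)⁻¹ * ∑ J : Fin p → Fin n,
      s (Sum.elim (fun _ => stdCov a) fun i => stdCov (J i)) *
        (ζ (Sum.inl 0)).smulRight (wedge fun i => ζ (Sum.inr i)) (stdVec a)
          (fun i => stdVec (J i)) =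
      ζ (Sum.inl 0) (stdVec a) • s (Function.update ζ (Sum.inl 0) (stdCov a)) := by
    intro a
    have h1 := sum_alternating_mul_wedge (alternatingSlice hs fun _ => stdCov a)
      fun i => ζ (Sum.inr i)
    have h2 : (alternatingSlice hs fun _ => stdCov a) (fun i => ζ (Sum.inr i)) =
        s (Function.update ζ (Sum.inl 0) (stdCov a)) := by
      refine congrArg s ?_
      ext1 i
      rcases i with i | i
      · obtain rfl := Subsingleton.elim i 0
        simp
      · simp
    rw [← h2, ← h1, smul_eq_mul, mul_left_comm]
    congr 1
    rw [Finset.mul_sum]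
    refine Finset.sum_congr rfl fun J _ => ?_
    rw [ContinuousLinearMap.smulRight_apply, ContinuousAlternatingMap.smul_apply, smul_eq_mul,
      mul_left_comm]
    rfl
  rw [Finset.sum_congr rfl fun a _ => h a]
  have h3 : s (Function.update ζ (Sum.inl 0) (∑ a, ζ (Sum.inl 0) (stdVec a) • stdCov a)) = s ζ := by
    rw [sum_apply_stdVec_smul_stdCov, Function.update_eq_self]
  rw [← h3]
  refine Eq.trans ?_ (s.toMultilinearMap.map_update_sum _ _ _ _).symm
  exact Finset.sum_congr rfl fun a _ => (s.map_update_smul _ _ _ _).symm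

end Functionals

/-! ### Naturality of the pairings -/

section Naturality

variable {n p : ℕ}

theorem decomp0_comp (ζ : Fin 0 ⊕ Fin p → (Model n →L[ℝ] ℝ)) (T : Model n →L[ℝ] Model n) :
    decomp0 (fun i => (ζ i).comp T) = (decomp0 ζ).compContinuousLinearMap T :=
  wedge_comp _ T

theorem decomp1_comp (ζ : Fin 1 ⊕ Fin p → (Model n →L[ℝ] ℝ)) (T : Model n →L[ℝ] Model n) :
    decomp1 (fun i => (ζ i).comp T) =
      (ContinuousAlternatingMap.compContinuousLinearMapCLM T).comp ((decomp1 ζ).comp T) := by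
  ext1 v
  simp only [decomp1_apply, wedge_comp]
  rfl

theorem cosymb0_comp {s : MultiCov 0 p (Model n)} (hs : s ∈ symbolFibre 0 p (Model n))
    (T : Model n →L[ℝ] Model n) (θ : Model n [⋀^Fin p]→L[ℝ] ℝ) :
    cosymb0 (s.compContinuousLinearMap fun _ => ContinuousLinearMap.precomp ℝ T) θ =
      cosymb0 s (θ.compContinuousLinearMap T) := by
  have h : s.compContinuousLinearMap (fun _ => ContinuousLinearMap.precomp ℝ T) =
      symb0 ((cosymb0 s).comp (ContinuousAlternatingMap.compContinuousLinearMapCLM T)) := by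
    ext ζ
    conv_lhs => rw [← symb0_cosymb0 hs]
    exact congrArg (cosymb0 s) (decomp0_comp ζ T)
  rw [h, cosymb0_symb0]
  rfl

theorem cosymb1_comp {s : MultiCov 1 p (Model n)} (hs : s ∈ symbolFibre 1 p (Model n))
    (T : Model n →L[ℝ] Model n) (L : Model n →L[ℝ] Model n [⋀^Fin p]→L[ℝ] ℝ) :
    cosymb1 (s.compContinuousLinearMap fun _ => ContinuousLinearMap.precomp ℝ T) L =
      cosymb1 s ((ContinuousAlternatingMap.compContinuousLinearMapCLM T).comp (L.comp T)) := by
  have h : s.compContinuousLinearMap (fun _ => ContinuousLinearMap.precomp ℝ T) =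
      symb1 ((cosymb1 s).comp ((ContinuousLinearMap.compL ℝ _ _ _
        (ContinuousAlternatingMap.compContinuousLinearMapCLM T)).comp
          (ContinuousLinearMap.precomp _ T))) := by
    ext ζ
    conv_lhs => rw [← symb1_cosymb1 hs]
    exact congrArg (cosymb1 s) (decomp1_comp ζ T)
  rw [h, cosymb1_symb1]
  rfl

/-- The map `θ ↦ ρ(A) θ` as a continuous linear map. -/
def glFormL (A : Model n →L[ℝ] Model n) :
    (Model n [⋀^Fin p]→L[ℝ] ℝ) →L[ℝ] (Model n [⋀^Fin p]→L[ℝ] ℝ) :=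
  -(ContinuousAlternatingMap.fderivCompContinuousLinearMapCLM (ι := Fin p) ℝ
    (ContinuousLinearMap.id ℝ (Model n))).flip A

theorem glFormL_apply (A : Model n →L[ℝ] Model n) (θ : Model n [⋀^Fin p]→L[ℝ] ℝ) :
    glFormL A θ = glForm A θ := rfl

theorem sum_decomp0_update (ζ : Fin 0 ⊕ Fin p → (Model n →L[ℝ] ℝ)) (A : Model n →L[ℝ] Model n) :
    ∑ i, decomp0 (Function.update ζ i ((ζ i).comp A)) = -glFormL A (decomp0 ζ) := by
  rw [Fintype.sum_sum_type, Finset.univ_eq_empty, Finset.sum_empty, zero_add, glFormL_apply,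
    decomp0_apply, ← sum_wedge_update_comp]
  exact Finset.sum_congr rfl fun i _ => congrArg wedge
    (Function.update_comp_eq_of_injective ζ Sum.inr_injective i _)

theorem sum_decomp1_update (ζ : Fin 1 ⊕ Fin p → (Model n →L[ℝ] ℝ)) (A : Model n →L[ℝ] Model n) :
    ∑ i, decomp1 (Function.update ζ i ((ζ i).comp A)) =
      (decomp1 ζ).comp A - (glFormL A).comp (decomp1 ζ) := by
  have h : ∀ i : Fin p, decomp1 (Function.update ζ (Sum.inr i) ((ζ (Sum.inr i)).comp A)) =
      ContinuousLinearMap.smulRightL ℝ _ _ (ζ (Sum.inl 0)) (wedge (Function.update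
        (fun j => ζ (Sum.inr j)) i ((ζ (Sum.inr i)).comp A))) := fun i => by
    have := Function.update_comp_eq_of_injective ζ Sum.inr_injective i ((ζ (Sum.inr i)).comp A)
    rw [← show _ = Function.update (fun j => ζ (Sum.inr j)) i ((ζ (Sum.inr i)).comp A) from this]
    rfl
  rw [Fintype.sum_sum_type, Finset.sum_congr rfl fun i _ => h i,
    ← map_sum (ContinuousLinearMap.smulRightL ℝ _ _ (ζ (Sum.inl 0))), sum_wedge_update_comp,
    Fin.sum_univ_one]
  ext1 v
  rw [sub_eq_add_neg, add_apply, add_apply]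
  congr 1
  simp [decomp1_apply, glFormL_apply]

theorem cosymb0_gl {s : MultiCov 0 p (Model n)} (hs : s ∈ symbolFibre 0 p (Model n))
    (A : Model n →L[ℝ] Model n) (θ : Model n [⋀^Fin p]→L[ℝ] ℝ) :
    cosymb0 (glSymbol A s) θ = -cosymb0 s (glForm A θ) := by
  have h : glSymbol A s = symb0 (-(cosymb0 s).comp (glFormL A)) := by
    ext ζ
    have h1 := fun ζ => congrArg (fun t : MultiCov 0 p (Model n) => t ζ) (symb0_cosymb0 hs)
    simp only [symb0_apply] at h1
    rw [glSymbol_apply, ← Finset.sum_congr rfl fun i _ => h1 _, ← map_sum, sum_decomp0_update,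
      map_neg]
    rfl
  rw [h, cosymb0_symb0]
  rfl

theorem cosymb1_gl {s : MultiCov 1 p (Model n)} (hs : s ∈ symbolFibre 1 p (Model n))
    (A : Model n →L[ℝ] Model n) (L : Model n →L[ℝ] Model n [⋀^Fin p]→L[ℝ] ℝ) :
    cosymb1 (glSymbol A s) L = cosymb1 s (L.comp A - (glFormL A).comp L) := by
  have h : glSymbol A s = symb1 ((cosymb1 s).comp (ContinuousLinearMap.precomp _ A -
      ContinuousLinearMap.compL ℝ _ _ _ (glFormL A))) := by
    ext ζ
    have h1 := fun ζ => congrArg (fun t : MultiCov 1 p (Model n) => t ζ) (symb1_cosymb1 hs)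
    simp only [symb1_apply] at h1
    rw [glSymbol_apply, ← Finset.sum_congr rfl fun i _ => h1 _, ← map_sum, sum_decomp1_update]
    rfl
  rw [h, cosymb1_symb1]
  rfl

end Naturality

/-! ### Traces, divergences and the weight of a form -/

section Trace

variable {n p : ℕ}

/-- The trace of an endomorphism of `ℝⁿ`. -/
def traceL : (Model n →L[ℝ] Model n) →L[ℝ] ℝ :=
  ∑ i, (stdCov i).comp (ContinuousLinearMap.apply ℝ (Model n) (stdVec i))

theorem traceL_apply (A : Model n →L[ℝ] Model n) :
    traceL A = ∑ i, stdCov i (A (stdVec i)) := by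
  simp only [traceL, sum_apply]
  rfl

/-- Forms of degree `p` are densities of weight `δ`: `gl(n)` acts on them through `-δ` times the
trace. -/
def IsWeight (n p : ℕ) (δ : ℝ) : Prop :=
  ∀ (A : Model n →L[ℝ] Model n) (θ : Model n [⋀^Fin p]→L[ℝ] ℝ),
    glForm A θ = -((δ * traceL A) • θ)

theorem isWeight_zero : IsWeight n 0 0 := by
  intro A θ
  ext v
  simp [glForm_apply]

theorem isWeight_top : IsWeight n n 1 := by
  intro A θ
  let b := (EuclideanSpace.basisFun (Fin n) ℝ).toBasis
  have hb : ∀ i, b i = stdVec i := fun i => by simp [b, stdVec]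
  apply ContinuousAlternatingMap.toAlternatingMap_injective
  refine Module.Basis.ext_alternating b fun v hv => ?_
  obtain ⟨σ, rfl⟩ : ∃ σ : Equiv.Perm (Fin n), v = σ :=
    ⟨Equiv.ofBijective v (Finite.injective_iff_bijective.1 hv), rfl⟩
  have ht : traceL A = ∑ i, stdCov (σ i) (A (stdVec (σ i))) :=
    (traceL_apply A).trans (Equiv.sum_comp σ fun j => stdCov j (A (stdVec j))).symm
  change glForm A θ (fun i => b (σ i)) = (-((1 * traceL A) • θ)) fun i => b (σ i)
  rw [glForm_apply, ContinuousAlternatingMap.neg_apply, ContinuousAlternatingMap.smul_apply,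
    one_mul, ht, smul_eq_mul, Finset.sum_mul]
  congr 1
  refine Finset.sum_congr rfl fun i _ => ?_
  simp only [hb]
  conv_lhs => rw [← sum_stdCov_smul_stdVec (A (stdVec (σ i)))]
  have h := θ.toMultilinearMap.map_update_sum Finset.univ i
    (fun j => stdCov j (A (stdVec (σ i))) • stdVec j) (fun k => stdVec (σ k))
  refine Eq.trans h ?_
  rw [Finset.sum_eq_single (σ i)]
  · rw [MultilinearMap.map_update_smul]
    congr 1
    exact congrArg θ (Function.update_eq_self i fun k => (stdVec (σ k) : Model n))
  · intro j _ hj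
    rw [MultilinearMap.map_update_smul]
    have hne : σ.symm j ≠ i := fun h => hj (by rw [← h]; simp)
    have h0 : θ (Function.update (fun k => stdVec (σ k)) i (stdVec j)) = 0 :=
      θ.map_eq_zero_of_eq _ (by simp [hne]) hne
    exact (congrArg _ h0).trans (smul_zero _)
  · simp

/-- The contraction of a derivative `B` of a field of functionals on `Hom(ℝⁿ, F)`. Applied to the
derivative of `a`, it is the divergence `w ↦ ∑ᵢ ∂ᵢ a(eⁱ ⊗ w)`. -/
def contr {F : Type*} [NormedAddCommGroup F] [NormedSpace ℝ F] :
    (Model n →L[ℝ] (Model n →L[ℝ] F) →L[ℝ] ℝ) →L[ℝ] F →L[ℝ] ℝ :=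
  ∑ i, ((ContinuousLinearMap.compL ℝ F (Model n →L[ℝ] F) ℝ).flip
    (ContinuousLinearMap.smulRightL ℝ (Model n) F (stdCov i))).comp
      (ContinuousLinearMap.apply ℝ ((Model n →L[ℝ] F) →L[ℝ] ℝ) (stdVec i))

variable {F : Type*} [NormedAddCommGroup F] [NormedSpace ℝ F]

theorem contr_apply (B : Model n →L[ℝ] (Model n →L[ℝ] F) →L[ℝ] ℝ) (w : F) :
    contr B w = ∑ i, B (stdVec i) ((stdCov i).smulRight w) := by
  simp only [contr, sum_apply]
  rfl

/-- The canonical element `∑ eᵢ ⊗ eⁱ` is invariant. -/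
theorem sum_stdVec_stdCov_comp {H : Type*} [AddCommGroup H] [Module ℝ H]
    (B : Model n →ₗ[ℝ] (Model n →L[ℝ] ℝ) →ₗ[ℝ] H) (T : Model n →L[ℝ] Model n) :
    ∑ i, B (T (stdVec i)) (stdCov i) = ∑ i, B (stdVec i) ((stdCov i).comp T) := by
  have h1 : ∀ i, B (T (stdVec i)) (stdCov i) =
      ∑ j, stdCov j (T (stdVec i)) • B (stdVec j) (stdCov i) := fun i => by
    conv_lhs => rw [← sum_stdCov_smul_stdVec (T (stdVec i))]
    simp only [map_sum, map_smul, LinearMap.sum_apply, LinearMap.smul_apply]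
  have h2 : ∀ i, B (stdVec i) ((stdCov i).comp T) =
      ∑ j, stdCov i (T (stdVec j)) • B (stdVec i) (stdCov j) := fun i => by
    conv_lhs => rw [← sum_apply_stdVec_smul_stdCov ((stdCov i).comp T)]
    simp only [map_sum, map_smul]
    rfl
  rw [Finset.sum_congr rfl fun i _ => h1 i, Finset.sum_congr rfl fun i _ => h2 i,
    Finset.sum_comm]

end Trace

/-! ### The splitting in a chart -/

section Local

variable {n p : ℕ} {δ κ : ℝ}

theorem glFormL_of_isWeight (hw : IsWeight n p δ) (A : Model n →L[ℝ] Model n) :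
    glFormL (p := p) A = -((δ * traceL A) • ContinuousLinearMap.id ℝ _) := by
  ext1 θ
  exact hw A θ

/-- The logarithmic derivative of the pullback of forms of weight `δ`. -/
theorem fderivComp_of_isWeight (hw : IsWeight n p δ) (T : Model n ≃L[ℝ] Model n)
    (B : Model n →L[ℝ] Model n) (w : Model n [⋀^Fin p]→L[ℝ] ℝ) :
    w.fderivCompContinuousLinearMap (T : Model n →L[ℝ] Model n) B =
      (δ * traceL ((T.symm : Model n →L[ℝ] Model n).comp B)) •
        w.compContinuousLinearMap (T : Model n →L[ℝ] Model n) := by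
  have h := hw ((T.symm : Model n →L[ℝ] Model n).comp B)
    (w.compContinuousLinearMap (T : Model n →L[ℝ] Model n))
  rw [← neg_eq_iff_eq_neg] at h
  rw [← h]
  ext v
  rw [ContinuousAlternatingMap.neg_apply, glForm_apply, neg_neg,
    ContinuousAlternatingMap.fderivCompContinuousLinearMap_apply]
  refine Finset.sum_congr rfl fun i _ => ?_
  rw [ContinuousAlternatingMap.compContinuousLinearMap_apply]
  refine congrArg w (funext fun j => ?_)
  rcases eq_or_ne j i with rfl | hj
  · simp
  · simp [hj]

/-- If `D²τ` is symmetric, the contraction of `eⁱ ∘ (Dτ)⁻¹ ∘ D²τ(eᵢ)` is the logarithmic derivative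
of the Jacobian determinant. -/
theorem sum_stdCov_comp_of_symm (K : Model n →L[ℝ] Model n →L[ℝ] Model n)
    (hK : ∀ u v, K u v = K v u) (S : Model n →L[ℝ] Model n) :
    ∑ i, (stdCov i).comp (S.comp (K (stdVec i))) =
      traceL.comp ((ContinuousLinearMap.compL ℝ _ _ _ S).comp K) := by
  ext v
  simp only [sum_apply, ContinuousLinearMap.comp_apply, traceL_apply,
    ContinuousLinearMap.compL_apply]
  exact Finset.sum_congr rfl fun i _ => by rw [hK]

theorem sum_apply_smul_stdCov_smulRight {F : Type*} [NormedAddCommGroup F] [NormedSpace ℝ F]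
    (l : (Model n →L[ℝ] F) →L[ℝ] ℝ) (γ : Model n →L[ℝ] ℝ) (w : F) :
    ∑ i, γ (stdVec i) * l ((stdCov i).smulRight w) = l (γ.smulRight w) := by
  have h : γ.smulRight w = ∑ i, γ (stdVec i) • (stdCov i).smulRight w := by
    conv_lhs => rw [← sum_apply_stdVec_smul_stdCov γ]
    ext1 v
    simp [sum_apply, Finset.sum_smul, mul_smul]
  rw [h, map_sum]
  simp

theorem sum_apply_smulRight {F : Type*} [NormedAddCommGroup F] [NormedSpace ℝ F]
    (l : (Model n →L[ℝ] F) →L[ℝ] ℝ) (ξ : Fin n → (Model n →L[ℝ] ℝ)) (w : F) :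
    ∑ i, l ((ξ i).smulRight w) = l ((∑ i, ξ i).smulRight w) := by
  have h : (∑ i, ξ i).smulRight w = ∑ i, (ξ i).smulRight w := by
    ext1 v
    simp [sum_apply, Finset.sum_smul]
  rw [h, map_sum]

variable {F : Type*} [NormedAddCommGroup F] [NormedSpace ℝ F]

theorem smulRight_smul' (ξ : Model n →L[ℝ] ℝ) (c : ℝ) (w : F) :
    ξ.smulRight (c • w) = c • ξ.smulRight w :=
  map_smul (ContinuousLinearMap.smulRightL ℝ (Model n) F ξ) c w

variable {X τ : Model n → Model n} {y : Model n}

/-- The first-order operator `a(∂θ) + κ (div a) θ` does not depend on the chart, if `a` transforms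
as a tensor and `κ (1 + δ) = δ`: the second derivatives of the change of charts `τ` enter with the
coefficient `δ` through the derivative of the form, and with `κ (1 + δ)` through the divergence.
Here `P` is the pullback of forms by `τ`, and its logarithmic derivative is assumed to be `δ` times
that of the Jacobian determinant of `τ`. -/
theorem firstOrder_transition (hκ : κ * (1 + δ) = δ)
    {a b : Model n → (Model n →L[ℝ] F) →L[ℝ] ℝ} {α β : Model n → F}
    {P : Model n → F →L[ℝ] F} {P' : Model n →L[ℝ] F →L[ℝ] F}
    (hτ : ContDiffAt ℝ 2 τ y) (T : Model n ≃L[ℝ] Model n)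
    (hT : fderiv ℝ τ y = (T : Model n →L[ℝ] Model n))
    (hP : HasFDerivAt P P' y)
    (hP' : ∀ u, P' u = (δ * traceL ((T.symm : Model n →L[ℝ] Model n).comp
      (fderiv ℝ (fderiv ℝ τ) y u))) • P y)
    (ha : DifferentiableAt ℝ a y) (hb : DifferentiableAt ℝ b (τ y))
    (hβ : DifferentiableAt ℝ β (τ y)) (hα : ∀ᶠ z in 𝓝 y, α z = P z (β (τ z)))
    (hab : ∀ᶠ z in 𝓝 y, ∀ L, b (τ z) L = a z ((P z).comp (L.comp (fderiv ℝ τ z)))) :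
    b (τ y) (fderiv ℝ β (τ y)) + κ * contr (fderiv ℝ b (τ y)) (β (τ y)) =
      a y (fderiv ℝ α y) + κ * contr (fderiv ℝ a y) (α y) := by
  have hd : DifferentiableAt ℝ (fderiv ℝ τ) y :=
    (hτ.fderiv_right (m := 1) (by norm_num)).differentiableAt (by norm_num)
  have hτ' : DifferentiableAt ℝ τ y := hτ.differentiableAt (by norm_num)
  have hs : IsSymmSndFDerivAt ℝ τ y := hτ.isSymmSndFDerivAt (by simp)
  set K := fderiv ℝ (fderiv ℝ τ) y with hK
  set S : Model n →L[ℝ] Model n := (T.symm : Model n →L[ℝ] Model n) with hS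
  -- the logarithmic derivative of the Jacobian determinant
  set γ : Model n →L[ℝ] ℝ := traceL.comp ((ContinuousLinearMap.compL ℝ _ _ _ S).comp K) with hγ
  have hγP : ∀ u, P' u = (δ * γ u) • P y := hP'
  have hα0 : α y = P y (β (τ y)) := hα.self_of_nhds
  -- the derivative of the pullback
  have h1 : fderiv ℝ α y =
      (P y).comp ((fderiv ℝ β (τ y)).comp (T : Model n →L[ℝ] Model n)) +
        δ • γ.smulRight (P y (β (τ y))) := by
    have hβτ : HasFDerivAt (fun z => β (τ z)) ((fderiv ℝ β (τ y)).comp (fderiv ℝ τ y)) y :=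
      hβ.hasFDerivAt.comp y hτ'.hasFDerivAt
    rw [Filter.EventuallyEq.fderiv_eq (𝕜 := ℝ) hα, (hP.clm_apply hβτ).fderiv, hT]
    ext1 u
    simp [hγP, mul_smul]
  -- the derivative of the law of transformation of `a`
  have h2 : ∀ (ξ : Model n →L[ℝ] ℝ) (w : F) (u : Model n),
      fderiv ℝ b (τ y) (T u) (ξ.smulRight w) =
        fderiv ℝ a y u ((ξ.comp (T : Model n →L[ℝ] Model n)).smulRight (P y w)) +
          a y ((ξ.comp (K u)).smulRight (P y w)) +
          δ * (γ u * a y ((ξ.comp (T : Model n →L[ℝ] Model n)).smulRight (P y w))) := by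
    intro ξ w u
    have e1 : HasFDerivAt (fun z => b (τ z) (ξ.smulRight w))
        (((fderiv ℝ b (τ y)).comp (fderiv ℝ τ y)).flip (ξ.smulRight w)) y := by
      have := (hb.hasFDerivAt.comp y hτ'.hasFDerivAt).clm_apply
        (hasFDerivAt_const (ξ.smulRight w) y)
      simpa using this
    have e2 : HasFDerivAt (fun z => ξ.comp (fderiv ℝ τ z))
        ((ContinuousLinearMap.compL ℝ _ _ _ ξ).comp K) y :=
      (ContinuousLinearMap.compL ℝ (Model n) (Model n) ℝ ξ).hasFDerivAt.comp y hd.hasFDerivAt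
    have e3 : HasFDerivAt (fun z => P z w) (P'.flip w) y := by
      have := hP.clm_apply (hasFDerivAt_const w y)
      simpa using this
    have e0 : HasFDerivAt (fun z => ContinuousLinearMap.smulRightL ℝ (Model n) F
        (ξ.comp (fderiv ℝ τ z))) ((ContinuousLinearMap.smulRightL ℝ (Model n) F).comp
          ((ContinuousLinearMap.compL ℝ _ _ _ ξ).comp K)) y :=
      (ContinuousLinearMap.smulRightL ℝ (Model n) F).hasFDerivAt.comp y e2
    have e4 := ha.hasFDerivAt.clm_apply (e0.clm_apply e3)
    have e5 := e1.unique (e4.congr_of_eventuallyEq (by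
      filter_upwards [hab] with z hz
      rw [hz]
      congr 1
      ext1 v
      simp))
    have e6 := congrArg (fun f => f u) e5
    have e7 : ∀ (η : Model n →L[ℝ] ℝ) (θ : F),
        ContinuousLinearMap.smulRightL ℝ (Model n) F η θ = η.smulRight θ := fun _ _ => rfl
    simp only [hT, add_apply, ContinuousLinearMap.comp_apply, ContinuousLinearMap.flip_apply,
      map_add, hγP, smul_apply, smulRight_smul', map_smul, smul_eq_mul, e7,
      ContinuousLinearMap.compL_apply] at e6
    refine e6.trans ?_
    ring
  have hKs : ∀ u v, K u v = K v u := fun u v => hs.eq u v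
  have h3 : ∀ w, contr (fderiv ℝ b (τ y)) w =
      contr (fderiv ℝ a y) (P y w) + (1 + δ) * a y (γ.smulRight (P y w)) := by
    intro w
    let B : Model n →ₗ[ℝ] (Model n →L[ℝ] ℝ) →ₗ[ℝ] ℝ :=
      LinearMap.mk₂ ℝ (fun u ξ => fderiv ℝ b (τ y) (T u)
        (ContinuousLinearMap.smulRightL ℝ (Model n) F ξ w))
        (fun _ _ _ => by simp only [map_add, add_apply])
        (fun _ _ _ => by simp only [map_smul, smul_apply])
        (fun _ _ _ => by simp only [map_add, add_apply])
        (fun _ _ _ => by simp only [map_smul, smul_apply])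
    have hB : ∀ u ξ, B u ξ = fderiv ℝ b (τ y) (T u) (ξ.smulRight w) := fun _ _ => rfl
    have hST : ∀ ξ : Model n →L[ℝ] ℝ, (ξ.comp S).comp (T : Model n →L[ℝ] Model n) = ξ := by
      intro ξ
      ext v
      simp [hS]
    have e1 : ∀ i, fderiv ℝ b (τ y) (stdVec i) ((stdCov i).smulRight w) =
        B (S (stdVec i)) (stdCov i) := fun i => by
      rw [hB]
      simp [hS]
    have e2 : ∀ i, B (stdVec i) ((stdCov i).comp S) =
        fderiv ℝ a y (stdVec i) ((stdCov i).smulRight (P y w)) +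
          a y (((stdCov i).comp (S.comp (K (stdVec i)))).smulRight (P y w)) +
          δ * (γ (stdVec i) * a y ((stdCov i).smulRight (P y w))) := fun i => by
      rw [hB, h2, hST]
      rfl
    rw [contr_apply, Finset.sum_congr rfl fun i _ => e1 i, sum_stdVec_stdCov_comp,
      Finset.sum_congr rfl fun i _ => e2 i, Finset.sum_add_distrib, Finset.sum_add_distrib,
      ← Finset.mul_sum, sum_apply_smul_stdCov_smulRight, sum_apply_smulRight,
      sum_stdCov_comp_of_symm K hKs, ← contr_apply]
    ring
  have h4 : b (τ y) (fderiv ℝ β (τ y)) =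
      a y ((P y).comp ((fderiv ℝ β (τ y)).comp (T : Model n →L[ℝ] Model n))) := by
    rw [hab.self_of_nhds, hT]
  rw [h3, h4, h1, map_add, map_smul, smul_eq_mul, hα0]
  linear_combination (a y (γ.smulRight (P y (β (τ y))))) * hκ

/-- The derivative of the Lie derivative `a'` of `a`. -/
theorem fderiv_lie_apply {a a' : Model n → (Model n →L[ℝ] F) →L[ℝ] ℝ}
    (hX : ContDiffAt ℝ 2 X y) (ha : ContDiffAt ℝ 2 a y) (hda' : DifferentiableAt ℝ a' y)
    (ha' : ∀ᶠ z in 𝓝 y, ∀ L, a' z L = fderiv ℝ a z (X z) L -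
      a z (L.comp (fderiv ℝ X z) + (δ * traceL (fderiv ℝ X z)) • L))
    (u : Model n) (L : Model n →L[ℝ] F) :
    fderiv ℝ a' y u L =
      fderiv ℝ (fderiv ℝ a) y (X y) u L + fderiv ℝ a y (fderiv ℝ X y u) L -
        fderiv ℝ a y u (L.comp (fderiv ℝ X y)) - a y (L.comp (fderiv ℝ (fderiv ℝ X) y u)) -
        δ * (traceL (fderiv ℝ (fderiv ℝ X) y u) * a y L) -
        δ * traceL (fderiv ℝ X y) * fderiv ℝ a y u L := by
  have hdX := (hX.differentiableAt (by norm_num)).hasFDerivAt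
  have hda := (ha.differentiableAt (by norm_num)).hasFDerivAt
  have hddX := ((hX.fderiv_right (m := 1) (by norm_num)).differentiableAt (by norm_num)).hasFDerivAt
  have hdda := ((ha.fderiv_right (m := 1) (by norm_num)).differentiableAt (by norm_num)).hasFDerivAt
  have hsa : fderiv ℝ (fderiv ℝ a) y u (X y) = fderiv ℝ (fderiv ℝ a) y (X y) u :=
    (ha.isSymmSndFDerivAt (by simp)).eq u (X y)
  have hL := hasFDerivAt_const (𝕜 := ℝ) L y
  have e1 := hda'.hasFDerivAt.clm_apply hL
  have e2 := (hdda.clm_apply hdX).clm_apply hL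
  have e3 := hda.clm_apply ((ContinuousLinearMap.compL ℝ (Model n) (Model n) F L).hasFDerivAt.comp y
    hddX)
  have e4 := ((traceL.hasFDerivAt.comp y hddX).const_mul δ).mul (hda.clm_apply hL)
  have e5 := e1.unique (((e2.sub e3).sub e4).congr_of_eventuallyEq (by
    filter_upwards [ha'] with z hz
    refine (hz L).trans ?_
    rw [map_add, map_smul, ← sub_sub]
    rfl))
  have e6 := congrArg (fun f => f u) e5
  simp only [add_apply, sub_apply, smul_apply, ContinuousLinearMap.comp_apply,
    ContinuousLinearMap.flip_apply, zero_apply, map_zero, zero_add, smul_eq_mul, hsa,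
    ContinuousLinearMap.compL_apply, Function.comp_apply] at e6
  rw [e6]
  ring

/-- The divergence of the Lie derivative of `a`: with `D = ∂a'`, `D₂ = ∂²a(X)`, `D₁ = ∂a`, `l = a`,
`A = ∂X` and `K = ∂²X` at a given point. -/
theorem contr_lie {D D₁ D₂ : Model n →L[ℝ] (Model n →L[ℝ] F) →L[ℝ] ℝ}
    {l : (Model n →L[ℝ] F) →L[ℝ] ℝ} {A : Model n →L[ℝ] Model n}
    {K : Model n →L[ℝ] Model n →L[ℝ] Model n} (hK : ∀ u v, K u v = K v u)
    (hD : ∀ u L, D u L = D₂ u L + D₁ (A u) L - D₁ u (L.comp A) - l (L.comp (K u)) -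
      δ * (traceL (K u) * l L) - δ * traceL A * D₁ u L) (w : F) :
    contr D w = contr D₂ w - (1 + δ) * l ((traceL.comp K).smulRight w) -
      δ * traceL A * contr D₁ w := by
  let B : Model n →ₗ[ℝ] (Model n →L[ℝ] ℝ) →ₗ[ℝ] ℝ :=
    LinearMap.mk₂ ℝ (fun u ξ => D₁ u (ContinuousLinearMap.smulRightL ℝ (Model n) F ξ w))
      (fun _ _ _ => by simp only [map_add, add_apply])
      (fun _ _ _ => by simp only [map_smul, smul_apply])
      (fun _ _ _ => by simp only [map_add, add_apply])
      (fun _ _ _ => by simp only [map_smul, smul_apply])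
  have e1 : ∑ i, D₁ (A (stdVec i)) ((stdCov i).smulRight w) =
      ∑ i, D₁ (stdVec i) (((stdCov i).comp A).smulRight w) :=
    sum_stdVec_stdCov_comp B A
  have e2 : ∑ i, (stdCov i).comp (K (stdVec i)) = traceL.comp K :=
    sum_stdCov_comp_of_symm K hK (ContinuousLinearMap.id ℝ (Model n))
  have e3 : ∑ i, traceL (K (stdVec i)) * l ((stdCov i).smulRight w) =
      l ((traceL.comp K).smulRight w) :=
    sum_apply_smul_stdCov_smulRight l (traceL.comp K) w
  have e4 : ∀ i, D (stdVec i) ((stdCov i).smulRight w) =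
      D₂ (stdVec i) ((stdCov i).smulRight w) + D₁ (A (stdVec i)) ((stdCov i).smulRight w) -
        D₁ (stdVec i) (((stdCov i).comp A).smulRight w) -
        l (((stdCov i).comp (K (stdVec i))).smulRight w) -
        δ * (traceL (K (stdVec i)) * l ((stdCov i).smulRight w)) -
        δ * traceL A * D₁ (stdVec i) ((stdCov i).smulRight w) :=
    fun i => hD (stdVec i) ((stdCov i).smulRight w)
  rw [contr_apply, Finset.sum_congr rfl fun i _ => e4 i]
  simp only [Finset.sum_sub_distrib, Finset.sum_add_distrib, ← Finset.mul_sum]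
  rw [e1, sum_apply_smulRight, e2, e3, ← contr_apply, ← contr_apply]
  ring

/-- The first-order operator `a(∂θ) + κ (div a) θ` depends equivariantly on `a`, if
`κ (1 + δ) = δ`. Here `θ'` is the Lie derivative of a form `θ` of weight `δ`, and `a'` is the Lie
derivative of `a`. -/
theorem firstOrder_equivariant (hκ : κ * (1 + δ) = δ)
    {a a' : Model n → (Model n →L[ℝ] F) →L[ℝ] ℝ} {θ θ' : Model n → F}
    (hX : ContDiffAt ℝ 2 X y) (ha : ContDiffAt ℝ 2 a y) (hθ : ContDiffAt ℝ 2 θ y)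
    (hda' : DifferentiableAt ℝ a' y)
    (hθ' : ∀ᶠ z in 𝓝 y, θ' z = fderiv ℝ θ z (X z) + (δ * traceL (fderiv ℝ X z)) • θ z)
    (ha' : ∀ᶠ z in 𝓝 y, ∀ L, a' z L = fderiv ℝ a z (X z) L -
      a z (L.comp (fderiv ℝ X z) + (δ * traceL (fderiv ℝ X z)) • L)) :
    fderiv ℝ (fun z => a z (fderiv ℝ θ z) + κ * contr (fderiv ℝ a z) (θ z)) y (X y) -
      (a y (fderiv ℝ θ' y) + κ * contr (fderiv ℝ a y) (θ' y)) =
    a' y (fderiv ℝ θ y) + κ * contr (fderiv ℝ a' y) (θ y) := by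
  have hdX := (hX.differentiableAt (by norm_num)).hasFDerivAt
  have hda := (ha.differentiableAt (by norm_num)).hasFDerivAt
  have hdθ := (hθ.differentiableAt (by norm_num)).hasFDerivAt
  have hddX := ((hX.fderiv_right (m := 1) (by norm_num)).differentiableAt (by norm_num)).hasFDerivAt
  have hdda := ((ha.fderiv_right (m := 1) (by norm_num)).differentiableAt (by norm_num)).hasFDerivAt
  have hddθ := ((hθ.fderiv_right (m := 1) (by norm_num)).differentiableAt (by norm_num)).hasFDerivAt
  have hsX : ∀ u v, fderiv ℝ (fderiv ℝ X) y u v = fderiv ℝ (fderiv ℝ X) y v u :=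
    fun u v => (hX.isSymmSndFDerivAt (by simp)).eq u v
  have hsθ : ∀ u v, fderiv ℝ (fderiv ℝ θ) y u v = fderiv ℝ (fderiv ℝ θ) y v u :=
    fun u v => (hθ.isSymmSndFDerivAt (by simp)).eq u v
  set K := fderiv ℝ (fderiv ℝ X) y with hK
  set DX := fderiv ℝ X y with hDX
  set t := traceL DX with ht
  -- the differential of the divergence of `X`
  set η : Model n →L[ℝ] ℝ := traceL.comp K with hη
  have hdt : HasFDerivAt (fun z => δ * traceL (fderiv ℝ X z)) (δ • η) y :=
    (traceL.hasFDerivAt.comp y hddX).const_mul δ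
  have h1 : fderiv ℝ (fun z => a z (fderiv ℝ θ z) + κ * contr (fderiv ℝ a z) (θ z)) y (X y) =
      fderiv ℝ a y (X y) (fderiv ℝ θ y) + a y (fderiv ℝ (fderiv ℝ θ) y (X y)) +
        κ * (contr (fderiv ℝ (fderiv ℝ a) y (X y)) (θ y) +
          contr (fderiv ℝ a y) (fderiv ℝ θ y (X y))) := by
    have hc : HasFDerivAt (fun z => contr (fderiv ℝ a z))
        (contr.comp (fderiv ℝ (fderiv ℝ a) y)) y :=
      (contr (n := n) (F := F)).hasFDerivAt.comp y hdda
    have := (hda.clm_apply hddθ).add ((hc.clm_apply hdθ).const_mul κ)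
    have h := congrArg (fun f => f (X y)) this.fderiv
    refine Eq.trans h ?_
    simp only [add_apply, ContinuousLinearMap.comp_apply, ContinuousLinearMap.flip_apply,
      smul_apply, smul_eq_mul]
    ring
  have h2 : fderiv ℝ θ' y = fderiv ℝ (fderiv ℝ θ) y (X y) + (fderiv ℝ θ y).comp DX +
      (δ • η.smulRight (θ y) + (δ * t) • fderiv ℝ θ y) := by
    refine (Filter.EventuallyEq.fderiv_eq (𝕜 := ℝ) hθ').trans
      (((hddθ.clm_apply hdX).add (hdt.smul hdθ)).fderiv.trans ?_)
    ext1 v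
    simp only [add_apply, ContinuousLinearMap.comp_apply, ContinuousLinearMap.flip_apply,
      smul_apply, ContinuousLinearMap.smulRight_apply, smul_eq_mul, mul_smul, hsθ v (X y)]
    abel
  have h4 := contr_lie (δ := δ) (D := fderiv ℝ a' y) (D₁ := fderiv ℝ a y)
    (D₂ := fderiv ℝ (fderiv ℝ a) y (X y)) (l := a y) (A := DX) hsX
    (fderiv_lie_apply hX ha hda' ha') (θ y)
  rw [h1, h2, h4, hθ'.self_of_nhds, ha'.self_of_nhds]
  simp only [map_add, map_smul, smul_eq_mul, ← hDX, ← ht]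
  linear_combination (a y (η.smulRight (θ y))) * hκ

end Local

/-! ### Pullback of forms as a smooth function of the linear map -/

section Pullback

variable {n p : ℕ}

/-- The pullback of `p`-forms by a linear map. -/
abbrev pull (T : Model n →L[ℝ] Model n) :
    (Model n [⋀^Fin p]→L[ℝ] ℝ) →L[ℝ] (Model n [⋀^Fin p]→L[ℝ] ℝ) :=
  ContinuousAlternatingMap.compContinuousLinearMapCLM T

theorem contDiff_pull : ContDiff ℝ ∞ (pull : (Model n →L[ℝ] Model n) → _ →L[ℝ]
    (Model n [⋀^Fin p]→L[ℝ] ℝ)) := by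
  -- the matrix entries of the pullback are polynomials in those of `T`
  have h : (pull : (Model n →L[ℝ] Model n) → _ →L[ℝ] (Model n [⋀^Fin p]→L[ℝ] ℝ)) = fun T =>
      (p.factorial : ℝ)⁻¹ • ∑ J : Fin p → Fin n, ∑ I : Fin p → Fin n,
        (∏ i, stdCov (I i) (T (stdVec (J i)))) •
          (ContinuousAlternatingMap.apply ℝ (Model n) ℝ fun i => stdVec (I i)).smulRight
            (wedge fun i => stdCov (J i)) := by
    funext T
    ext1 w
    conv_lhs => rw [← sum_apply_smul_wedge (pull T w)]
    simp only [smul_apply, sum_apply, ContinuousLinearMap.smulRight_apply]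
    congr 1
    refine Finset.sum_congr rfl fun J _ => ?_
    have h1 : pull T w (fun i => stdVec (J i)) = ∑ I : Fin p → Fin n,
        (∏ i, stdCov (I i) (T (stdVec (J i)))) * w (fun i => stdVec (I i)) :=
      multilinear_expand_vec w.toMultilinearMap fun i => T (stdVec (J i))
    rw [h1, Finset.sum_smul]
    exact Finset.sum_congr rfl fun I _ => mul_smul _ _ _
  rw [h]
  have h2 : ∀ i j : Fin n, ContDiff ℝ ∞ fun T : Model n →L[ℝ] Model n => stdCov i (T (stdVec j)) :=
    fun i j => ((stdCov i).comp (ContinuousLinearMap.apply ℝ (Model n) (stdVec j))).contDiff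
  refine ContDiff.const_smul _ (ContDiff.sum fun J _ => ContDiff.sum fun I _ => ?_)
  exact ContDiff.smul (contDiff_prod fun i _ => h2 _ _) contDiff_const

theorem hasFDerivAt_pull {δ : ℝ} (hw : IsWeight n p δ) {τ : Model n → Model n} {y : Model n}
    (hτ : ContDiffAt ℝ 2 τ y) (T : Model n ≃L[ℝ] Model n)
    (hT : fderiv ℝ τ y = (T : Model n →L[ℝ] Model n)) :
    ∃ P' : Model n →L[ℝ] (Model n [⋀^Fin p]→L[ℝ] ℝ) →L[ℝ] (Model n [⋀^Fin p]→L[ℝ] ℝ),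
      HasFDerivAt (fun z => pull (fderiv ℝ τ z)) P' y ∧
      ∀ u, P' u = (δ * traceL ((T.symm : Model n →L[ℝ] Model n).comp
        (fderiv ℝ (fderiv ℝ τ) y u))) • pull (fderiv ℝ τ y) := by
  have hd : DifferentiableAt ℝ (fderiv ℝ τ) y :=
    (hτ.fderiv_right (m := 1) (by norm_num)).differentiableAt (by norm_num)
  have hP : DifferentiableAt ℝ (fun z => pull (p := p) (fderiv ℝ τ z)) y :=
    (contDiff_pull.contDiffAt.differentiableAt (by simp)).comp y hd
  refine ⟨_, hP.hasFDerivAt, fun u => ?_⟩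
  ext1 w
  have h1 := (hP.hasFDerivAt.clm_apply (hasFDerivAt_const w y)).fderiv
  have h2 := fderiv_continuousAlternatingMapCompContinuousLinearMap
    (differentiableAt_const (𝕜 := ℝ) (x := y) w) hd
  have h3 := congrArg (fun f => f u) (h1.symm.trans h2)
  simp only [ContinuousLinearMap.comp_zero, zero_add, ContinuousLinearMap.flip_apply, hT,
    fderiv_fun_const, Pi.zero_apply, ContinuousLinearMap.comp_apply,
    fderivComp_of_isWeight hw] at h3
  rw [hT]
  exact h3

end Pullback

/-! ### Gluing of fields and operators -/

section Charts

variable {n k p : ℕ} {M : Type*} [TopologicalSpace M] [ChartedSpace (Model n) M]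
  [IsManifold (𝓡 n) ∞ M] {e φ : OpenPartialHomeomorph M (Model n)}

theorem localForm_of_eq (hφ : φ ∈ IsManifold.maximalAtlas (𝓡 n) ∞ M)
    {θ : Π x : M, TangentSpace (𝓡 n) x [⋀^Fin p]→L[ℝ] ℝ} {y : Model n} (hy : y ∈ φ.target)
    {w : Model n [⋀^Fin p]→L[ℝ] ℝ}
    (h : θ (φ.symm y) = w.compContinuousLinearMap (dChart φ (φ.symm y))) :
    localForm φ θ y = w := by
  obtain ⟨b, hb⟩ := dChart_isInvertible hφ (φ.map_target hy)
  rw [localForm, h, ← hb]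
  ext v
  simp only [ContinuousAlternatingMap.compContinuousLinearMap_apply]
  refine congrArg w (funext fun i => ?_)
  simp

theorem localSymbol_of_eq (hφ : φ ∈ IsManifold.maximalAtlas (𝓡 n) ∞ M)
    {s : Π x : M, MultiCov k p (TangentSpace (𝓡 n) x)} {y : Model n} (hy : y ∈ φ.target)
    {t : MultiCov k p (Model n)}
    (h : s (φ.symm y) = t.compContinuousLinearMap
      fun _ => ContinuousLinearMap.precomp ℝ (dChart φ (φ.symm y)).inverse) :
    localSymbol φ s y = t := by
  obtain ⟨b, hb⟩ := dChart_isInvertible hφ (φ.map_target hy)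
  rw [localSymbol, h, ← hb]
  ext ζ
  simp only [ContinuousMultilinearMap.compContinuousLinearMap_apply]
  refine congrArg t (funext fun i => ?_)
  ext v
  simp

theorem symbol_eq_zero {s : Symbol n M k p}
    (h : ∀ φ ∈ IsManifold.maximalAtlas (𝓡 n) ∞ M, ∀ y ∈ φ.target, localSymbol φ s.1 y = 0) :
    s = 0 := by
  ext1
  funext x
  have hx := mem_chart_source (Model n) x
  have h1 := h _ (IsManifold.chart_mem_maximalAtlas x) _ (mem_chart_target (Model n) x)
  obtain ⟨b, hb⟩ := dChart_isInvertible (IsManifold.chart_mem_maximalAtlas x) hx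
  ext ζ
  have h2 := congrArg (fun t : MultiCov k p (Model n) => t fun i => (ζ i).comp
    (b.symm : Model n →L[ℝ] TangentSpace (𝓡 n) x)) h1
  have h3 : localSymbol (chartAt (Model n) x) s.1 (chartAt (Model n) x x) =
      (s.1 x).compContinuousLinearMap
        fun _ => ContinuousLinearMap.precomp ℝ (dChart (chartAt (Model n) x) x) :=
    congrArg (fun w => (s.1 w).compContinuousLinearMap
      fun _ => ContinuousLinearMap.precomp ℝ (dChart (chartAt (Model n) x) w))
      ((chartAt (Model n) x).left_inv hx)
  rw [h3, ← hb] at h2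
  simp only [ContinuousMultilinearMap.compContinuousLinearMap_apply] at h2
  refine Eq.trans (congrArg (s.1 x) (funext fun i => ?_)) h2
  ext v
  simp

/-- Contravariant tensor fields given in every chart, compatibly with the changes of charts, glue to
a global one. -/
theorem exists_symbol
    (S : OpenPartialHomeomorph M (Model n) → Model n → MultiCov k p (Model n))
    (hmem : ∀ φ ∈ IsManifold.maximalAtlas (𝓡 n) ∞ M, ∀ y ∈ φ.target,
      S φ y ∈ symbolFibre k p (Model n))
    (hS : ∀ φ ∈ IsManifold.maximalAtlas (𝓡 n) ∞ M, ContDiffOn ℝ ∞ (S φ) φ.target)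
    (htr : ∀ e ∈ IsManifold.maximalAtlas (𝓡 n) ∞ M, ∀ φ ∈ IsManifold.maximalAtlas (𝓡 n) ∞ M,
      ∀ z ∈ e.target ∩ e.symm ⁻¹' φ.source, S φ ((φ ∘ e.symm) z) =
        (S e z).compContinuousLinearMap
          fun _ => ContinuousLinearMap.precomp ℝ (fderiv ℝ (φ ∘ e.symm) z)) :
    ∃ s : Symbol n M k p, ∀ φ ∈ IsManifold.maximalAtlas (𝓡 n) ∞ M, ∀ y ∈ φ.target,
      localSymbol φ s.1 y = S φ y := by
  let s : Π x : M, MultiCov k p (TangentSpace (𝓡 n) x) := fun x =>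
    (S (chartAt (Model n) x) (chartAt (Model n) x x)).compContinuousLinearMap
      fun _ => ContinuousLinearMap.precomp ℝ (dChart (chartAt (Model n) x) x).inverse
  have key : ∀ φ ∈ IsManifold.maximalAtlas (𝓡 n) ∞ M, ∀ y ∈ φ.target,
      localSymbol φ s y = S φ y := by
    intro φ hφ y hy
    refine localSymbol_of_eq hφ hy ?_
    set x := φ.symm y with hx
    have hxφ : x ∈ φ.source := φ.map_target hy
    set e := chartAt (Model n) x with he
    have heA : e ∈ IsManifold.maximalAtlas (𝓡 n) ∞ M := IsManifold.chart_mem_maximalAtlas x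
    have hxe : x ∈ e.source := mem_chart_source _ x
    have hz : e x ∈ e.target ∩ e.symm ⁻¹' φ.source :=
      ⟨e.map_source hxe, by simpa only [Set.mem_preimage, e.left_inv hxe] using hxφ⟩
    have hyx : (φ ∘ e.symm) (e x) = y := by
      simp only [Function.comp_apply, e.left_inv hxe]
      exact φ.right_inv hy
    have h1 := htr e heA φ hφ (e x) hz
    rw [hyx] at h1
    obtain ⟨a, ha⟩ := dChart_isInvertible heA hxe
    obtain ⟨b, hb⟩ := dChart_isInvertible hφ hxφ
    have h2 := fderiv_transition_comp heA hφ hxe hxφ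
    rw [h1]
    ext ζ
    change S e (e x) _ = S e (e x) _
    refine congrArg (S e (e x)) (funext fun i => ?_)
    ext v
    have h3 : fderiv ℝ (φ ∘ e.symm) (e x) v = b (a.symm v) := by
      have := congrArg (fun L : TangentSpace (𝓡 n) x →L[ℝ] Model n => L (a.symm v)) h2
      rw [← ha, ← hb] at this
      simpa using this
    change ζ i ((dChart e x).inverse v) =
      ζ i ((dChart φ x).inverse (fderiv ℝ (φ ∘ e.symm) (e x) v))
    rw [h3, ← ha, ← hb]
    simp
  refine ⟨⟨s, fun x => symbolFibre_comp (hmem _ (IsManifold.chart_mem_maximalAtlas x) _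
    (mem_chart_target _ x)) _, fun φ hφ => (hS φ hφ).congr fun y hy => key φ hφ y hy⟩, key⟩

/-- Every smooth form on `ℝⁿ` is, near a given point of a chart, the expression of a global form. -/
theorem exists_form [T2Space M] (hφ : φ ∈ IsManifold.maximalAtlas (𝓡 n) ∞ M) {y : Model n}
    (hy : y ∈ φ.target) {β : Model n → Model n [⋀^Fin p]→L[ℝ] ℝ} (hβ : ContDiff ℝ ∞ β) :
    ∃ θ : Form n M p, localForm φ θ.1 =ᶠ[𝓝 y] β := by
  have hx : φ.symm y ∈ φ.source := φ.map_target hy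
  obtain ⟨f, -, hf⟩ := (SmoothBumpFunction.nhds_basis_tsupport (I := 𝓡 n) (φ.symm y)).mem_iff.1
    (φ.open_source.mem_nhds hx)
  let θ : Π x : M, TangentSpace (𝓡 n) x [⋀^Fin p]→L[ℝ] ℝ := fun x =>
    (f x • β (φ x)).compContinuousLinearMap (dChart φ x)
  have h1 : ∀ z ∈ φ.target, localForm φ θ z = f (φ.symm z) • β z := fun z hz =>
    localForm_of_eq hφ hz (by
      change (f (φ.symm z) • β (φ (φ.symm z))).compContinuousLinearMap _ = _
      rw [φ.right_inv hz])
  have hfs : ∀ ψ ∈ IsManifold.maximalAtlas (𝓡 n) ∞ M,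
      ContDiffOn ℝ ∞ (f ∘ ψ.symm) ψ.target := fun ψ hψ => by
    rw [← contMDiffOn_iff_contDiffOn]
    exact f.contMDiff.comp_contMDiffOn (contMDiffOn_symm_of_mem_maximalAtlas hψ)
  refine ⟨⟨θ, fun ψ hψ z hz => ContDiffAt.contDiffWithinAt ?_⟩, ?_⟩
  · by_cases hzφ : ψ.symm z ∈ φ.source
    · have ho := ψ.isOpen_inter_preimage_symm φ.open_source
      have hn := ho.mem_nhds (show z ∈ ψ.target ∩ ψ.symm ⁻¹' φ.source from ⟨hz, hzφ⟩)
      have hτ := contDiffOn_transition hψ hφ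
      have h2 : localForm ψ θ =ᶠ[𝓝 z] fun u => pull (fderiv ℝ (φ ∘ ψ.symm) u)
          ((f ∘ ψ.symm) u • β ((φ ∘ ψ.symm) u)) := by
        filter_upwards [hn] with u hu
        rw [localForm_transition hψ hφ θ hu,
          show localForm φ θ ((φ ∘ ψ.symm) u) = _ from h1 _ (φ.map_source hu.2)]
        simp only [Function.comp_apply, φ.left_inv hu.2]
        rfl
      refine ContDiffAt.congr_of_eventuallyEq ?_ h2
      have h3 := ((hfs ψ hψ).contDiffAt (ψ.open_target.mem_nhds hz)).smul
        (hβ.contDiffAt.comp z (hτ.contDiffAt hn))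
      exact (contDiff_pull.contDiffAt.comp z
        ((hτ.fderiv_of_isOpen ho (m := ∞) (by simp)).contDiffAt hn)).clm_apply h3
    · have hz' : ψ.symm z ∈ (tsupport f)ᶜ := fun h => hzφ (hf h)
      have h2 : localForm ψ θ =ᶠ[𝓝 z] fun _ => 0 := by
        filter_upwards [(ψ.symm.continuousAt hz).preimage_mem_nhds
          ((isClosed_tsupport f).isOpen_compl.mem_nhds hz')] with u hu
        have : f (ψ.symm u) = 0 := image_eq_zero_of_notMem_tsupport hu
        change ((f (ψ.symm u) • β (φ (ψ.symm u))).compContinuousLinearMap _).compContinuousLinearMap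
          _ = 0
        rw [this, zero_smul]
        rfl
      exact contDiffAt_const.congr_of_eventuallyEq h2
  · have h2 : ∀ᶠ z in 𝓝 y, f (φ.symm z) = 1 :=
      (φ.symm.continuousAt hy).eventually f.eventuallyEq_one
    filter_upwards [h2, φ.open_target.mem_nhds hy] with z hz hz'
    rw [h1 z hz', hz, one_smul]

/-- Differential operators given in every chart, compatibly with the changes of charts, glue to
a global one. -/
theorem exists_diffOp
    (V : OpenPartialHomeomorph M (Model n) → (Model n → Model n [⋀^Fin p]→L[ℝ] ℝ) → Model n → ℝ)
    (hV : ∀ φ ∈ IsManifold.maximalAtlas (𝓡 n) ∞ M, IsLocOp φ.target k (V φ))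
    (htr : ∀ e ∈ IsManifold.maximalAtlas (𝓡 n) ∞ M, ∀ φ ∈ IsManifold.maximalAtlas (𝓡 n) ∞ M,
      ∀ z ∈ e.target ∩ e.symm ⁻¹' φ.source, ∀ θ : Form n M p,
        V φ (localForm φ θ.1) ((φ ∘ e.symm) z) = V e (localForm e θ.1) z) :
    ∃ D : DiffOp n M k p, ∀ φ ∈ IsManifold.maximalAtlas (𝓡 n) ∞ M, ∀ θ : Form n M p,
      ∀ y ∈ φ.target, D.1 θ (φ.symm y) = V φ (localForm φ θ.1) y := by
  let d : Form n M p → M → ℝ := fun θ x =>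
    V (chartAt (Model n) x) (localForm (chartAt (Model n) x) θ.1) (chartAt (Model n) x x)
  have hd : ∀ θ : Form n M p, ∀ φ ∈ IsManifold.maximalAtlas (𝓡 n) ∞ M, ∀ y ∈ φ.target,
      d θ (φ.symm y) = V φ (localForm φ θ.1) y := by
    intro θ φ hφ y hy
    have hx := φ.map_target hy
    have hxe := mem_chart_source (Model n) (φ.symm y)
    have h := htr φ hφ (chartAt (Model n) (φ.symm y)) (IsManifold.chart_mem_maximalAtlas _) y
      ⟨hy, hxe⟩ θ
    exact h
  have hsm : ∀ θ : Form n M p, ContMDiff (𝓡 n) 𝓘(ℝ, ℝ) ∞ (d θ) := by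
    intro θ x
    have he : chartAt (Model n) x ∈ IsManifold.maximalAtlas (𝓡 n) ∞ M :=
      IsManifold.chart_mem_maximalAtlas x
    set e := chartAt (Model n) x
    have hxe : x ∈ e.source := mem_chart_source _ x
    obtain ⟨C, hC, hCV⟩ := hV e he
    have h1 : ContDiffOn ℝ ∞ (fun y => V e (localForm e θ.1) y) e.target := by
      refine ContDiffOn.congr (f := fun y => ∑ i ∈ Finset.range (k + 1),
        C i y (iteratedFDeriv ℝ i (localForm e θ.1) y)) ?_ fun y hy => hCV _ (θ.2 e he) y hy
      exact ContDiffOn.sum fun i _ => (hC i).clm_apply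
        (contDiffOn_iteratedFDeriv e.open_target (θ.2 e he) i)
    have h2 : ContMDiffOn (𝓡 n) 𝓘(ℝ, ℝ) ∞ ((fun y => V e (localForm e θ.1) y) ∘ e) e.source :=
      (contMDiffOn_iff_contDiffOn.2 h1).comp (contMDiffOn_of_mem_maximalAtlas he)
        fun z hz => e.map_source hz
    refine (h2.contMDiffAt (e.open_source.mem_nhds hxe)).congr_of_eventuallyEq ?_
    filter_upwards [e.open_source.mem_nhds hxe] with z hz
    have h3 := hd θ e he (e z) (e.map_source hz)
    rwa [e.left_inv hz] at h3
  have hlin : ∀ x, ∃ C : (i : ℕ) → (Model n [×i]→L[ℝ] (Model n [⋀^Fin p]→L[ℝ] ℝ)) →L[ℝ] ℝ,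
      ∀ θ : Form n M p, d θ x = ∑ i ∈ Finset.range (k + 1),
        C i (iteratedFDeriv ℝ i (localForm (chartAt (Model n) x) θ.1) (chartAt (Model n) x x)) := by
    intro x
    obtain ⟨C, -, hCV⟩ := hV _ (IsManifold.chart_mem_maximalAtlas x)
    exact ⟨fun i => C i (chartAt (Model n) x x), fun θ => hCV _
      (θ.2 _ (IsManifold.chart_mem_maximalAtlas x)) _ (mem_chart_target _ x)⟩
  have hcd : ∀ (θ : Form n M p) (x : M) (i : ℕ), ContDiffAt ℝ i
      (localForm (chartAt (Model n) x) θ.1) (chartAt (Model n) x x) := fun θ x i =>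
    ((θ.2 _ (IsManifold.chart_mem_maximalAtlas x)).contDiffAt
      ((chartAt (Model n) x).open_target.mem_nhds (mem_chart_target _ x))).of_le
        (by exact_mod_cast le_top)
  let D : Form n M p →ₗ[ℝ] C^∞⟮𝓡 n, M; ℝ⟯ :=
    { toFun := fun θ => ⟨d θ, hsm θ⟩
      map_add' := fun θ θ' => by
        ext x
        obtain ⟨C, hC⟩ := hlin x
        change d (θ + θ') x = d θ x + d θ' x
        rw [hC, hC, hC, ← Finset.sum_add_distrib]
        refine Finset.sum_congr rfl fun i _ => ?_
        rw [← map_add]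
        exact congrArg _ (iteratedFDeriv_add_apply (hcd θ x i) (hcd θ' x i))
      map_smul' := fun c θ => by
        ext x
        obtain ⟨C, hC⟩ := hlin x
        change d (c • θ) x = c * d θ x
        rw [hC, hC, Finset.mul_sum]
        refine Finset.sum_congr rfl fun i _ => ?_
        rw [← smul_eq_mul, ← map_smul]
        exact congrArg _ (iteratedFDeriv_const_smul_apply (a := c) (hcd θ x i)) }
  refine ⟨⟨D, fun φ hφ => ?_⟩, fun φ hφ θ y hy => hd θ φ hφ y hy⟩
  obtain ⟨C, hC, hCV⟩ := hV φ hφ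
  exact ⟨C, hC, fun θ y hy => (hd θ φ hφ y hy).trans (hCV _ (θ.2 φ hφ) y hy)⟩

end Charts

/-! ### Operators of order at most one in a chart -/

section LocalOperators

variable {n p : ℕ} {δ κ : ℝ}

/-- The operator `f ↦ a(∂f) + κ (div a) f + c f` of order one. -/
def firstOrderOp {F : Type*} [NormedAddCommGroup F] [NormedSpace ℝ F] (κ : ℝ)
    (a : Model n → (Model n →L[ℝ] F) →L[ℝ] ℝ) (c : Model n → F →L[ℝ] ℝ) (f : Model n → F)
    (y : Model n) : ℝ :=
  a y (fderiv ℝ f y) + κ * contr (fderiv ℝ a y) (f y) + c y (f y)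

theorem fderiv_firstOrderOp {F : Type*} [NormedAddCommGroup F] [NormedSpace ℝ F]
    {U : Set (Model n)} (hU : IsOpen U) {a : Model n → (Model n →L[ℝ] F) →L[ℝ] ℝ}
    {c : Model n → F →L[ℝ] ℝ} {f : Model n → F} (ha : ContDiffOn ℝ ∞ a U)
    (hc : ContDiffOn ℝ ∞ c U) (hf : ContDiffOn ℝ ∞ f U) {y : Model n} (hy : y ∈ U) :
    fderiv ℝ (firstOrderOp κ a c f) y =
      fderiv ℝ (fun z => a z (fderiv ℝ f z) + κ * contr (fderiv ℝ a z) (f z)) y +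
        fderiv ℝ (fun z => c z (f z)) y := by
  have hn := hU.mem_nhds hy
  have h3 : ContDiffOn ℝ ∞ (fun z => contr (fderiv ℝ a z)) U :=
    contr.contDiff.comp_contDiffOn (ha.fderiv_of_isOpen hU (by simp))
  have h4 : ContDiffOn ℝ ∞ (fun z => a z (fderiv ℝ f z) + κ * contr (fderiv ℝ a z) (f z)) U :=
    (ha.clm_apply (hf.fderiv_of_isOpen hU (by simp))).add
      (contDiffOn_const.mul (h3.clm_apply hf))
  exact fderiv_add ((h4.contDiffAt hn).differentiableAt (by simp))
    (((hc.clm_apply hf).contDiffAt hn).differentiableAt (by simp))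

theorem isLocOp_zeroOrder {U : Set (Model n)} {N : ℕ}
    {c : Model n → (Model n [⋀^Fin p]→L[ℝ] ℝ) →L[ℝ] ℝ} (hc : ContDiffOn ℝ ∞ c U) :
    IsLocOp U N fun f y => c y (f y) :=
  isLocOp_jet (j := 0) (Nat.zero_le N) (B := fun y => (c y).comp
    (continuousMultilinearCurryFin0 ℝ (Model n) (Model n [⋀^Fin p]→L[ℝ]
      ℝ)).toContinuousLinearEquiv.toContinuousLinearMap) (hc.clm_comp contDiffOn_const)

theorem isLocOp_firstOrderOp {U : Set (Model n)} (hU : IsOpen U)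
    {a : Model n → (Model n →L[ℝ] Model n [⋀^Fin p]→L[ℝ] ℝ) →L[ℝ] ℝ}
    {c : Model n → (Model n [⋀^Fin p]→L[ℝ] ℝ) →L[ℝ] ℝ}
    (ha : ContDiffOn ℝ ∞ a U) (hc : ContDiffOn ℝ ∞ c U) :
    IsLocOp U 1 (firstOrderOp κ a c) := by
  have h1 : IsLocOp U 1 fun (f : Model n → Model n [⋀^Fin p]→L[ℝ] ℝ) y => a y (fderiv ℝ f y) :=
    isLocOp_jet (j := 1) le_rfl (B := fun y => (a y).comp
      (continuousMultilinearCurryFin1 ℝ (Model n) (Model n [⋀^Fin p]→L[ℝ]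
        ℝ)).toContinuousLinearEquiv.toContinuousLinearMap) (ha.clm_comp contDiffOn_const)
      |>.congr fun f _ y _ => by
        refine congrArg (a y) ?_
        ext1 v
        change _ = iteratedFDeriv ℝ 1 f y (Fin.snoc 0 v)
        rw [iteratedFDeriv_one_apply]
        rfl
  have h2 : ContDiffOn ℝ ∞ (fun y => contr (fderiv ℝ a y)) U :=
    contr.contDiff.comp_contDiffOn (ha.fderiv_of_isOpen hU (by simp))
  exact (h1.add ((isLocOp_zeroOrder (h2.const_smul κ)).add (isLocOp_zeroOrder hc))).congr
    fun f _ y _ => by simp [firstOrderOp, add_assoc]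

theorem zeroOrder_equivariant {X : Model n → Model n} {y : Model n}
    {σ : Model n → MultiCov 0 p (Model n)}
    {f : Model n → Model n [⋀^Fin p]→L[ℝ] ℝ} (hσ : DifferentiableAt ℝ σ y)
    (hmem : σ y ∈ symbolFibre 0 p (Model n)) (hf : DifferentiableAt ℝ f y) :
    fderiv ℝ (fun z => cosymb0 (σ z) (f z)) y (X y) - cosymb0 (σ y) (lieFormLocal X f y) =
      cosymb0 (lieSymbolLocal X σ y) (f y) := by
  have h1 : HasFDerivAt (fun z => cosymb0 (σ z)) (cosymb0.comp (fderiv ℝ σ y)) y :=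
    (cosymb0 (n := n) (p := p)).hasFDerivAt.comp y hσ.hasFDerivAt
  rw [(h1.clm_apply hf.hasFDerivAt).fderiv, lieFormLocal, lieSymbolLocal, map_sub, map_sub,
    sub_apply, cosymb0_gl hmem]
  simp only [add_apply, ContinuousLinearMap.comp_apply, ContinuousLinearMap.flip_apply]
  ring

theorem cosymb1_lieSymbolLocal (hw : IsWeight n p δ) {X : Model n → Model n} {z : Model n}
    {σ : Model n → MultiCov 1 p (Model n)} (hσ : DifferentiableAt ℝ σ z)
    (hmem : σ z ∈ symbolFibre 1 p (Model n)) (L : Model n →L[ℝ] Model n [⋀^Fin p]→L[ℝ] ℝ) :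
    cosymb1 (lieSymbolLocal X σ z) L = fderiv ℝ (fun z => cosymb1 (σ z)) z (X z) L -
      cosymb1 (σ z) (L.comp (fderiv ℝ X z) + (δ * traceL (fderiv ℝ X z)) • L) := by
  have h3 : HasFDerivAt (fun z => cosymb1 (σ z)) (cosymb1.comp (fderiv ℝ σ z)) z :=
    (cosymb1 (n := n) (p := p)).hasFDerivAt.comp z hσ.hasFDerivAt
  have h4 : L.comp (fderiv ℝ X z) + (δ * traceL (fderiv ℝ X z)) • L =
      L.comp (fderiv ℝ X z) - (glFormL (fderiv ℝ X z)).comp L := by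
    rw [glFormL_of_isWeight hw]
    ext1 v
    simp
  rw [h3.fderiv, h4, ← cosymb1_gl hmem, lieSymbolLocal, map_sub]
  rfl

set_option maxHeartbeats 800000 in
/-- In a chart, the operator with principal symbol `σ₁` and symmetrised coefficient `σ₀` depends
equivariantly on `(σ₁, σ₀)`. -/
theorem firstOrderOp_equivariant (hw : IsWeight n p δ) (hκ : κ * (1 + δ) = δ) {U : Set (Model n)}
    (hU : IsOpen U) {X : Model n → Model n} {y : Model n} (hy : y ∈ U)
    {σ₁ : Model n → MultiCov 1 p (Model n)} {σ₀ : Model n → MultiCov 0 p (Model n)}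
    {f : Model n → Model n [⋀^Fin p]→L[ℝ] ℝ} (hX : ContDiffOn ℝ ∞ X U)
    (h₁ : ContDiffOn ℝ ∞ σ₁ U) (h₀ : ContDiffOn ℝ ∞ σ₀ U)
    (hm₁ : ∀ z, σ₁ z ∈ symbolFibre 1 p (Model n)) (hm₀ : ∀ z, σ₀ z ∈ symbolFibre 0 p (Model n))
    (hf : ContDiffOn ℝ ∞ f U) :
    fderiv ℝ (firstOrderOp κ (fun z => cosymb1 (σ₁ z)) (fun z => cosymb0 (σ₀ z)) f) y (X y) -
      firstOrderOp κ (fun z => cosymb1 (σ₁ z)) (fun z => cosymb0 (σ₀ z)) (lieFormLocal X f) y =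
    firstOrderOp κ (fun z => cosymb1 (lieSymbolLocal X σ₁ z))
      (fun z => cosymb0 (lieSymbolLocal X σ₀ z)) f y := by
  have hn := hU.mem_nhds hy
  have h2 : (2 : WithTop ℕ∞) ≤ ∞ := WithTop.coe_le_coe.2 le_top
  set a := fun z => cosymb1 (σ₁ z) with ha
  set a' := fun z => cosymb1 (lieSymbolLocal X σ₁ z) with ha'
  have haU : ContDiffOn ℝ ∞ a U := cosymb1.contDiff.comp_contDiffOn h₁
  have haU' : ContDiffOn ℝ ∞ a' U :=
    cosymb1.contDiff.comp_contDiffOn (contDiffOn_lieSymbolLocal hU hX h₁)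
  have hLf : ∀ᶠ z in 𝓝 y, lieFormLocal X f z =
      fderiv ℝ f z (X z) + (δ * traceL (fderiv ℝ X z)) • f z :=
    Filter.Eventually.of_forall fun z => by rw [lieFormLocal, hw, sub_neg_eq_add]
  have hLa : ∀ᶠ z in 𝓝 y, ∀ L, a' z L = fderiv ℝ a z (X z) L -
      a z (L.comp (fderiv ℝ X z) + (δ * traceL (fderiv ℝ X z)) • L) := by
    filter_upwards [hn] with z hz L
    exact cosymb1_lieSymbolLocal hw ((h₁.contDiffAt (hU.mem_nhds hz)).differentiableAt (by simp))
      (hm₁ z) L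
  have e1 := firstOrder_equivariant hκ ((hX.contDiffAt hn).of_le h2) ((haU.contDiffAt hn).of_le h2)
    ((hf.contDiffAt hn).of_le h2) ((haU'.contDiffAt hn).differentiableAt (by simp)) hLf hLa
  have e2 := zeroOrder_equivariant (X := X) ((h₀.contDiffAt hn).differentiableAt (by simp)) (hm₀ y)
    ((hf.contDiffAt hn).differentiableAt (by simp))
  rw [fderiv_firstOrderOp (c := fun z => cosymb0 (σ₀ z)) hU haU
    (cosymb0.contDiff.comp_contDiffOn h₀) hf hy, add_apply, firstOrderOp, firstOrderOp, ← e1, ← e2]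
  ring

end LocalOperators

/-! ### Expressions of global objects in charts -/

section Charts

variable {n k p : ℕ} {M : Type*} [TopologicalSpace M] [ChartedSpace (Model n) M]
  [IsManifold (𝓡 n) ∞ M] {e φ : OpenPartialHomeomorph M (Model n)}

theorem localSymbol_mem (φ : OpenPartialHomeomorph M (Model n)) (s : Symbol n M k p) (y : Model n) :
    localSymbol φ s.1 y ∈ symbolFibre k p (Model n) :=
  symbolFibre_comp (s.2.1 _) _

theorem diffOp_zero_local (D : DiffOp n M 0 p) (hφ : φ ∈ IsManifold.maximalAtlas (𝓡 n) ∞ M) :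
    ∃ c : Model n → (Model n [⋀^Fin p]→L[ℝ] ℝ) →L[ℝ] ℝ, ContDiffOn ℝ ∞ c φ.target ∧
      ∀ θ : Form n M p, ∀ y ∈ φ.target, D.1 θ (φ.symm y) = c y (localForm φ θ.1 y) := by
  obtain ⟨A, hA, h⟩ := D.2 φ hφ
  refine ⟨fun y => (A 0 y).comp (continuousMultilinearCurryFin0 ℝ (Model n) (Model n [⋀^Fin p]→L[ℝ]
    ℝ)).symm.toContinuousLinearEquiv.toContinuousLinearMap, (hA 0).clm_comp contDiffOn_const,
    fun θ y hy => ?_⟩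
  rw [h θ y hy, Finset.sum_range_one]
  rfl

theorem diffOp_one_local (D : DiffOp n M 1 p) (hφ : φ ∈ IsManifold.maximalAtlas (𝓡 n) ∞ M) :
    ∃ (a : Model n → (Model n →L[ℝ] Model n [⋀^Fin p]→L[ℝ] ℝ) →L[ℝ] ℝ)
      (c : Model n → (Model n [⋀^Fin p]→L[ℝ] ℝ) →L[ℝ] ℝ),
      ContDiffOn ℝ ∞ a φ.target ∧ ContDiffOn ℝ ∞ c φ.target ∧
      ∀ θ : Form n M p, ∀ y ∈ φ.target, D.1 θ (φ.symm y) =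
        a y (fderiv ℝ (localForm φ θ.1) y) + c y (localForm φ θ.1 y) := by
  obtain ⟨A, hA, h⟩ := D.2 φ hφ
  refine ⟨fun y => (A 1 y).comp (continuousMultilinearCurryFin1 ℝ (Model n) (Model n [⋀^Fin p]→L[ℝ]
    ℝ)).symm.toContinuousLinearEquiv.toContinuousLinearMap,
    fun y => (A 0 y).comp (continuousMultilinearCurryFin0 ℝ (Model n) (Model n [⋀^Fin p]→L[ℝ]
    ℝ)).symm.toContinuousLinearEquiv.toContinuousLinearMap, (hA 1).clm_comp contDiffOn_const,
    (hA 0).clm_comp contDiffOn_const, fun θ y hy => ?_⟩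
  rw [h θ y hy, Finset.sum_range_succ, Finset.sum_range_one, add_comm]
  refine congrArg₂ (· + ·) (congrArg (A 1 y) ?_) rfl
  ext1 v
  exact iteratedFDeriv_one_apply (𝕜 := ℝ) (f := localForm φ θ.1) v

theorem diffOp_lie_local {D : DiffOp n M k p} (hφ : φ ∈ IsManifold.maximalAtlas (𝓡 n) ∞ M)
    {V : (Model n → Model n [⋀^Fin p]→L[ℝ] ℝ) → Model n → ℝ}
    (hV : ∀ θ : Form n M p, ∀ y ∈ φ.target, D.1 θ (φ.symm y) = V (localForm φ θ.1) y)
    (X : Vect n M) (θ : Form n M p) {y : Model n} (hy : y ∈ φ.target) :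
    (lieDiffOp X D).1 θ (φ.symm y) =
      fderiv ℝ (V (localForm φ θ.1)) y (localVect φ X y) - V (localForm φ (lieForm X θ).1) y := by
  have h1 : (lieDiffOp X D).1 θ (φ.symm y) =
      lieFun X (D.1 θ) (φ.symm y) - D.1 (lieForm X θ) (φ.symm y) := rfl
  have h2 : (D.1 θ ∘ φ.symm) =ᶠ[𝓝 y] V (localForm φ θ.1) := by
    filter_upwards [φ.open_target.mem_nhds hy] with z hz using hV θ z hz
  rw [h1, lieFun_local hφ X _ hy, hV _ y hy, h2.fderiv_eq]

theorem localForm_lieForm_eventuallyEq (hφ : φ ∈ IsManifold.maximalAtlas (𝓡 n) ∞ M)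
    (X : Vect n M) (θ : Form n M p) {y : Model n} (hy : y ∈ φ.target) :
    localForm φ (lieForm X θ).1 =ᶠ[𝓝 y] lieFormLocal (localVect φ X) (localForm φ θ.1) := by
  filter_upwards [φ.open_target.mem_nhds hy] with z hz using localForm_lieFormAt hφ X θ.2 hz

theorem localSymbol_lieSymbol_eventuallyEq (hφ : φ ∈ IsManifold.maximalAtlas (𝓡 n) ∞ M)
    (X : Vect n M) (s : Symbol n M k p) {y : Model n} (hy : y ∈ φ.target) :
    localSymbol φ (lieSymbol X s).1 =ᶠ[𝓝 y]
      lieSymbolLocal (localVect φ X) (localSymbol φ s.1) := by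
  filter_upwards [φ.open_target.mem_nhds hy] with z hz using localSymbol_lieSymbolAt hφ X s.2 hz

end Charts

/-! ### Isomorphisms from correspondences -/

/-- A bijective linear correspondence is the graph of a linear isomorphism. -/
theorem exists_linearEquiv_of_rel {V W : Type*} [AddCommGroup V] [Module ℝ V] [AddCommGroup W]
    [Module ℝ W] (R : V → W → Prop)
    (hadd : ∀ v w v' w', R v w → R v' w' → R (v + v') (w + w'))
    (hsmul : ∀ (c : ℝ) v w, R v w → R (c • v) (c • w))
    (hex : ∀ v, ∃ w, R v w) (hsur : ∀ w, ∃ v, R v w)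
    (hr : ∀ w, R 0 w → w = 0) (hl : ∀ v, R v 0 → v = 0) :
    ∃ Q : V ≃ₗ[ℝ] W, ∀ v w, R v w ↔ Q v = w := by
  choose f hf using hex
  have huniq : ∀ v w, R v w → f v = w := by
    intro v w h
    have h1 := hadd _ _ _ _ (hf v) (hsmul (-1) _ _ h)
    rw [neg_one_smul, neg_one_smul, add_neg_cancel] at h1
    exact sub_eq_zero.1 (by rw [sub_eq_add_neg]; exact hr _ h1)
  let F : V →ₗ[ℝ] W :=
    { toFun := f
      map_add' := fun v v' => huniq _ _ (hadd _ _ _ _ (hf v) (hf v'))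
      map_smul' := fun c v => huniq _ _ (hsmul c _ _ (hf v)) }
  have hF : Function.Bijective F := by
    refine ⟨(injective_iff_map_eq_zero F).2 fun v hv => hl v ?_, fun w => ?_⟩
    · have h1 := hf v
      rwa [show f v = 0 from hv] at h1
    · obtain ⟨v, hv⟩ := hsur w
      exact ⟨v, huniq _ _ hv⟩
  exact ⟨LinearEquiv.ofBijective F hF, fun v w => ⟨huniq v w, fun h => h ▸ hf v⟩⟩

/-! ### Operators of order zero -/

section Global

variable {n k p : ℕ} {M : Type*} [TopologicalSpace M] [ChartedSpace (Model n) M]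
  [IsManifold (𝓡 n) ∞ M] {e φ : OpenPartialHomeomorph M (Model n)}

theorem contDiffOn_cosymb0 (hφ : φ ∈ IsManifold.maximalAtlas (𝓡 n) ∞ M) (s : Symbol n M 0 p) :
    ContDiffOn ℝ ∞ (fun y => cosymb0 (localSymbol φ s.1 y)) φ.target :=
  cosymb0.contDiff.comp_contDiffOn (s.2.2 φ hφ)

theorem contDiffOn_cosymb1 (hφ : φ ∈ IsManifold.maximalAtlas (𝓡 n) ∞ M) (s : Symbol n M 1 p) :
    ContDiffOn ℝ ∞ (fun y => cosymb1 (localSymbol φ s.1 y)) φ.target :=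
  cosymb1.contDiff.comp_contDiffOn (s.2.2 φ hφ)

theorem cosymb0_transition (he : e ∈ IsManifold.maximalAtlas (𝓡 n) ∞ M)
    (hφ : φ ∈ IsManifold.maximalAtlas (𝓡 n) ∞ M) (s : Symbol n M 0 p) {z : Model n}
    (hz : z ∈ e.target ∩ e.symm ⁻¹' φ.source) (w : Model n [⋀^Fin p]→L[ℝ] ℝ) :
    cosymb0 (localSymbol φ s.1 ((φ ∘ e.symm) z)) w =
      cosymb0 (localSymbol e s.1 z) (pull (fderiv ℝ (φ ∘ e.symm) z) w) := by
  rw [localSymbol_transition he hφ s.1 hz, cosymb0_comp (localSymbol_mem e s z)]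
  rfl

theorem cosymb1_transition (he : e ∈ IsManifold.maximalAtlas (𝓡 n) ∞ M)
    (hφ : φ ∈ IsManifold.maximalAtlas (𝓡 n) ∞ M) (s : Symbol n M 1 p) {z : Model n}
    (hz : z ∈ e.target ∩ e.symm ⁻¹' φ.source) (L : Model n →L[ℝ] Model n [⋀^Fin p]→L[ℝ] ℝ) :
    cosymb1 (localSymbol φ s.1 ((φ ∘ e.symm) z)) L =
      cosymb1 (localSymbol e s.1 z) ((pull (fderiv ℝ (φ ∘ e.symm) z)).comp
        (L.comp (fderiv ℝ (φ ∘ e.symm) z))) := by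
  rw [localSymbol_transition he hφ s.1 hz, cosymb1_comp (localSymbol_mem e s z)]

/-- A global form with a prescribed value at a point and vanishing derivative there. -/
theorem exists_form_value [T2Space M] (hφ : φ ∈ IsManifold.maximalAtlas (𝓡 n) ∞ M) {y : Model n}
    (hy : y ∈ φ.target) (w : Model n [⋀^Fin p]→L[ℝ] ℝ) :
    ∃ θ : Form n M p, localForm φ θ.1 y = w ∧ fderiv ℝ (localForm φ θ.1) y = 0 := by
  obtain ⟨θ, hθ⟩ := exists_form hφ hy (contDiff_const (c := w))
  exact ⟨θ, hθ.self_of_nhds, by rw [hθ.fderiv_eq]; simp⟩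

/-- A global form vanishing at a point with prescribed derivative there. -/
theorem exists_form_fderiv [T2Space M] (hφ : φ ∈ IsManifold.maximalAtlas (𝓡 n) ∞ M) {y : Model n}
    (hy : y ∈ φ.target) (L : Model n →L[ℝ] Model n [⋀^Fin p]→L[ℝ] ℝ) :
    ∃ θ : Form n M p, localForm φ θ.1 y = 0 ∧ fderiv ℝ (localForm φ θ.1) y = L := by
  obtain ⟨θ, hθ⟩ := exists_form (β := fun z => L (z - y)) hφ hy
    (L.contDiff.comp (contDiff_id.sub contDiff_const))
  refine ⟨θ, by simpa using hθ.self_of_nhds, ?_⟩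
  rw [hθ.fderiv_eq]
  exact (L.hasFDerivAt.comp y ((hasFDerivAt_id y).sub_const y)).fderiv

/-- The operator `D` of order zero is the pairing of forms with the `p`-vector field `s`. -/
def IsPairing (D : DiffOp n M 0 p) (s : Symbol n M 0 p) : Prop :=
  ∀ φ ∈ IsManifold.maximalAtlas (𝓡 n) ∞ M, ∀ θ : Form n M p, ∀ y ∈ φ.target,
    D.1 θ (φ.symm y) = cosymb0 (localSymbol φ s.1 y) (localForm φ θ.1 y)

theorem exists_isPairing_left (s : Symbol n M 0 p) : ∃ D : DiffOp n M 0 p, IsPairing D s := by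
  obtain ⟨D, hD⟩ := exists_diffOp (M := M) (k := 0) (p := p)
    (fun φ f y => cosymb0 (localSymbol φ s.1 y) (f y))
    (fun φ hφ => isLocOp_zeroOrder (contDiffOn_cosymb0 hφ s))
    (fun e he φ hφ z hz θ => by
      rw [cosymb0_transition he hφ s hz, localForm_transition he hφ θ.1 hz]
      rfl)
  exact ⟨D, hD⟩

theorem exists_isPairing_right [T2Space M] (D : DiffOp n M 0 p) :
    ∃ s : Symbol n M 0 p, IsPairing D s := by
  have h : ∀ φ, ∃ c : Model n → (Model n [⋀^Fin p]→L[ℝ] ℝ) →L[ℝ] ℝ,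
      φ ∈ IsManifold.maximalAtlas (𝓡 n) ∞ M → ContDiffOn ℝ ∞ c φ.target ∧
      ∀ θ : Form n M p, ∀ y ∈ φ.target, D.1 θ (φ.symm y) = c y (localForm φ θ.1 y) := fun φ => by
    by_cases hφ : φ ∈ IsManifold.maximalAtlas (𝓡 n) ∞ M
    · obtain ⟨c, hc⟩ := diffOp_zero_local D hφ
      exact ⟨c, fun _ => hc⟩
    · exact ⟨0, fun h => absurd h hφ⟩
  choose c hc using h
  obtain ⟨s, hs⟩ := exists_symbol (M := M) (fun φ y => symb0 (c φ y))
    (fun φ _ y _ => symb0_mem _)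
    (fun φ hφ => symb0.contDiff.comp_contDiffOn (hc φ hφ).1)
    (fun e he φ hφ z hz => by
      have hzφ : (φ ∘ e.symm) z ∈ φ.target := φ.map_source hz.2
      have hx : φ.symm ((φ ∘ e.symm) z) = e.symm z := φ.left_inv hz.2
      ext ζ
      obtain ⟨θ, hθ, -⟩ := exists_form_value hφ hzφ (decomp0 ζ)
      have h1 := (hc φ hφ).2 θ _ hzφ
      rw [hx, (hc e he).2 θ z hz.1, hθ, localForm_transition he hφ θ.1 hz, hθ,
        ← decomp0_comp] at h1
      exact h1.symm)
  refine ⟨s, fun φ hφ θ y hy => ?_⟩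
  rw [hs φ hφ y hy, cosymb0_symb0, (hc φ hφ).2 θ y hy]

theorem IsPairing.lie {D : DiffOp n M 0 p} {s : Symbol n M 0 p} (h : IsPairing D s) (X : Vect n M) :
    IsPairing (lieDiffOp X D) (lieSymbol X s) := by
  intro φ hφ θ y hy
  have hn := φ.open_target.mem_nhds hy
  rw [diffOp_lie_local (V := fun f y => cosymb0 (localSymbol φ s.1 y) (f y)) hφ (h φ hφ) X θ hy,
    (localForm_lieForm_eventuallyEq hφ X θ hy).self_of_nhds,
    (localSymbol_lieSymbol_eventuallyEq hφ X s hy).self_of_nhds]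
  exact zeroOrder_equivariant (((s.2.2 φ hφ).contDiffAt hn).differentiableAt (by simp))
    (localSymbol_mem φ s y) (((θ.2 φ hφ).contDiffAt hn).differentiableAt (by simp))

theorem diffOp_eq_zero {D : DiffOp n M k p}
    (h : ∀ φ ∈ IsManifold.maximalAtlas (𝓡 n) ∞ M, ∀ θ : Form n M p, ∀ y ∈ φ.target,
      D.1 θ (φ.symm y) = 0) : D = 0 := by
  ext θ x
  have h1 := h _ (IsManifold.chart_mem_maximalAtlas x) θ _ (mem_chart_target (Model n) x)
  rwa [(chartAt (Model n) x).left_inv (mem_chart_source _ x)] at h1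

theorem localSymbol_add (φ : OpenPartialHomeomorph M (Model n)) (s t : Symbol n M k p) :
    localSymbol φ (s + t).1 = fun y => localSymbol φ s.1 y + localSymbol φ t.1 y := rfl

theorem localSymbol_smul (φ : OpenPartialHomeomorph M (Model n)) (c : ℝ) (s : Symbol n M k p) :
    localSymbol φ (c • s).1 = fun y => c • localSymbol φ s.1 y := rfl

theorem localSymbol_zero (φ : OpenPartialHomeomorph M (Model n)) :
    localSymbol φ (0 : Symbol n M k p).1 = fun _ => 0 := rfl

set_option maxHeartbeats 1600000 in
/-- Operators of order zero are equivariantly isomorphic to `p`-vector fields. -/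
theorem exists_equiv_zero [T2Space M] : ∃ Q : DiffOp n M 0 p ≃ₗ[ℝ] Symbol n M 0 p,
    ∀ (X : Vect n M) (D : DiffOp n M 0 p), Q (lieDiffOp X D) = lieSymbol X (Q D) := by
  obtain ⟨Q, hQ⟩ := exists_linearEquiv_of_rel (IsPairing (n := n) (M := M) (p := p))
    (fun D s D' s' h h' φ hφ θ y hy => by
      rw [localSymbol_add, map_add, add_apply, ← h φ hφ θ y hy, ← h' φ hφ θ y hy]
      rfl)
    (fun c D s h φ hφ θ y hy => by
      rw [localSymbol_smul, map_smul, smul_apply, ← h φ hφ θ y hy]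
      rfl)
    exists_isPairing_right exists_isPairing_left
    (fun s h => symbol_eq_zero fun φ hφ y hy => by
      rw [← symb0_cosymb0 (localSymbol_mem φ s y)]
      have h0 : cosymb0 (localSymbol φ s.1 y) = 0 := by
        ext w
        obtain ⟨θ, hθ, -⟩ := exists_form_value hφ hy w
        rw [← hθ, ← h φ hφ θ y hy]
        rfl
      rw [h0, map_zero])
    (fun D h => diffOp_eq_zero fun φ hφ θ y hy => by
      rw [h φ hφ θ y hy, localSymbol_zero, map_zero, zero_apply])
  exact ⟨Q, fun X D => (hQ _ _).1 (((hQ D (Q D)).2 rfl).lie X)⟩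

/-! ### Operators of order one -/

variable {δ κ : ℝ}

/-- The operator `D` of order one has the principal symbol `s.1`, and `s.2` is its symmetrised
coefficient of order zero. -/
def IsSplit (κ : ℝ) (D : DiffOp n M 1 p) (s : Symbol n M 1 p × Symbol n M 0 p) : Prop :=
  ∀ φ ∈ IsManifold.maximalAtlas (𝓡 n) ∞ M, ∀ θ : Form n M p, ∀ y ∈ φ.target,
    D.1 θ (φ.symm y) = firstOrderOp κ (fun z => cosymb1 (localSymbol φ s.1.1 z))
      (fun z => cosymb0 (localSymbol φ s.2.1 z)) (localForm φ θ.1) y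

/-- Invariance of the first-order part under changes of charts. -/
theorem firstOrder_charts (hw : IsWeight n p δ) (hκ : κ * (1 + δ) = δ)
    (he : e ∈ IsManifold.maximalAtlas (𝓡 n) ∞ M) (hφ : φ ∈ IsManifold.maximalAtlas (𝓡 n) ∞ M)
    {a b : Model n → (Model n →L[ℝ] Model n [⋀^Fin p]→L[ℝ] ℝ) →L[ℝ] ℝ}
    (ha : ContDiffOn ℝ ∞ a e.target) (hb : ContDiffOn ℝ ∞ b φ.target)
    (hab : ∀ z ∈ e.target ∩ e.symm ⁻¹' φ.source, ∀ L, b ((φ ∘ e.symm) z) L =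
      a z ((pull (fderiv ℝ (φ ∘ e.symm) z)).comp (L.comp (fderiv ℝ (φ ∘ e.symm) z))))
    (θ : Form n M p) {z : Model n} (hz : z ∈ e.target ∩ e.symm ⁻¹' φ.source) :
    b ((φ ∘ e.symm) z) (fderiv ℝ (localForm φ θ.1) ((φ ∘ e.symm) z)) +
        κ * contr (fderiv ℝ b ((φ ∘ e.symm) z)) (localForm φ θ.1 ((φ ∘ e.symm) z)) =
      a z (fderiv ℝ (localForm e θ.1) z) + κ * contr (fderiv ℝ a z) (localForm e θ.1 z) := by
  have ho := e.isOpen_inter_preimage_symm φ.open_source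
  have hn := ho.mem_nhds hz
  have hτ : ContDiffAt ℝ 2 (φ ∘ e.symm) z :=
    ((contDiffOn_transition he hφ).contDiffAt hn).of_le (WithTop.coe_le_coe.2 le_top)
  have hzφ := φ.open_target.mem_nhds (show (φ ∘ e.symm) z ∈ φ.target from φ.map_source hz.2)
  have hx : e.symm z ∈ e.source := e.map_target hz.1
  obtain ⟨A, hA⟩ := dChart_isInvertible he hx
  obtain ⟨B, hB⟩ := dChart_isInvertible hφ hz.2
  have hT : fderiv ℝ (φ ∘ e.symm) z = ((A.symm.trans B : Model n ≃L[ℝ] Model n) :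
      Model n →L[ℝ] Model n) := by
    have h := fderiv_transition_comp he hφ hx hz.2
    rw [e.right_inv hz.1, ← hA, ← hB] at h
    ext1 v
    have h1 := congrArg (fun L : TangentSpace (𝓡 n) (e.symm z) →L[ℝ] Model n => L (A.symm v)) h
    simpa using h1
  obtain ⟨P', hP, hP'⟩ := hasFDerivAt_pull hw hτ _ hT
  exact firstOrder_transition hκ hτ _ hT hP hP'
    ((ha.contDiffAt (e.open_target.mem_nhds hz.1)).differentiableAt (by simp))
    ((hb.contDiffAt hzφ).differentiableAt (by simp))
    (((θ.2 φ hφ).contDiffAt hzφ).differentiableAt (by simp))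
    (by filter_upwards [hn] with u hu using localForm_transition he hφ θ.1 hu)
    (by filter_upwards [hn] with u hu using hab u hu)

theorem exists_isSplit_left (hw : IsWeight n p δ) (hκ : κ * (1 + δ) = δ)
    (s : Symbol n M 1 p × Symbol n M 0 p) : ∃ D : DiffOp n M 1 p, IsSplit κ D s := by
  obtain ⟨D, hD⟩ := exists_diffOp (M := M) (k := 1) (p := p)
    (fun φ => firstOrderOp κ (fun z => cosymb1 (localSymbol φ s.1.1 z))
      (fun z => cosymb0 (localSymbol φ s.2.1 z)))
    (fun φ hφ => isLocOp_firstOrderOp φ.open_target (contDiffOn_cosymb1 hφ s.1)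
      (contDiffOn_cosymb0 hφ s.2))
    (fun e he φ hφ z hz θ => by
      rw [firstOrderOp, firstOrderOp, firstOrder_charts hw hκ he hφ (contDiffOn_cosymb1 he s.1)
        (contDiffOn_cosymb1 hφ s.1) (fun z hz L => cosymb1_transition he hφ s.1 hz L) θ hz,
        cosymb0_transition he hφ s.2 hz, localForm_transition he hφ θ.1 hz]
      rfl)
  exact ⟨D, hD⟩

set_option maxHeartbeats 1600000 in
/-- The change of charts of the first derivative of a form vanishing at a point. -/
theorem fderiv_localForm_of_eq_zero (he : e ∈ IsManifold.maximalAtlas (𝓡 n) ∞ M)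
    (hφ : φ ∈ IsManifold.maximalAtlas (𝓡 n) ∞ M) (θ : Form n M p) {z : Model n}
    (hz : z ∈ e.target ∩ e.symm ⁻¹' φ.source) (h0 : localForm φ θ.1 ((φ ∘ e.symm) z) = 0) :
    fderiv ℝ (localForm e θ.1) z = (pull (fderiv ℝ (φ ∘ e.symm) z)).comp
      ((fderiv ℝ (localForm φ θ.1) ((φ ∘ e.symm) z)).comp (fderiv ℝ (φ ∘ e.symm) z)) := by
  have ho := e.isOpen_inter_preimage_symm φ.open_source
  have hn := ho.mem_nhds hz
  have hτ := contDiffOn_transition he hφ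
  have hzφ := φ.open_target.mem_nhds (show (φ ∘ e.symm) z ∈ φ.target from φ.map_source hz.2)
  have h1 : localForm e θ.1 =ᶠ[𝓝 z] fun u => pull (fderiv ℝ (φ ∘ e.symm) u)
      (localForm φ θ.1 ((φ ∘ e.symm) u)) := by
    filter_upwards [hn] with u hu using localForm_transition he hφ θ.1 hu
  have h2 : DifferentiableAt ℝ (fun u => pull (p := p) (fderiv ℝ (φ ∘ e.symm) u)) z :=
    (contDiff_pull.contDiffAt.differentiableAt (by simp)).comp z
      (((hτ.fderiv_of_isOpen ho (m := ∞) (by simp)).contDiffAt hn).differentiableAt (by simp))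
  have h3 : HasFDerivAt (fun u => localForm φ θ.1 ((φ ∘ e.symm) u)) _ z :=
    (((θ.2 φ hφ).contDiffAt hzφ).differentiableAt (by simp)).hasFDerivAt.comp z
      ((hτ.contDiffAt hn).differentiableAt (by simp)).hasFDerivAt
  rw [h1.fderiv_eq, (h2.hasFDerivAt.clm_apply h3).fderiv, h0, map_zero, add_zero]

set_option maxHeartbeats 1600000 in
/-- Every operator of order one splits. Forms vanishing at a point show that the principal symbol is
a tensor; then `c - κ div a` is one by `firstOrder_charts`. -/
theorem exists_isSplit_right [T2Space M] (hw : IsWeight n p δ) (hκ : κ * (1 + δ) = δ)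
    (D : DiffOp n M 1 p) : ∃ s : Symbol n M 1 p × Symbol n M 0 p, IsSplit κ D s := by
  have h : ∀ φ, ∃ (a : Model n → (Model n →L[ℝ] Model n [⋀^Fin p]→L[ℝ] ℝ) →L[ℝ] ℝ)
      (c : Model n → (Model n [⋀^Fin p]→L[ℝ] ℝ) →L[ℝ] ℝ),
      φ ∈ IsManifold.maximalAtlas (𝓡 n) ∞ M →
      ContDiffOn ℝ ∞ a φ.target ∧ ContDiffOn ℝ ∞ c φ.target ∧
      ∀ θ : Form n M p, ∀ y ∈ φ.target, D.1 θ (φ.symm y) =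
        a y (fderiv ℝ (localForm φ θ.1) y) + c y (localForm φ θ.1 y) := fun φ => by
    by_cases hφ : φ ∈ IsManifold.maximalAtlas (𝓡 n) ∞ M
    · obtain ⟨a, c, hac⟩ := diffOp_one_local D hφ
      exact ⟨a, c, fun _ => hac⟩
    · exact ⟨0, 0, fun h => absurd h hφ⟩
  choose a c hac using h
  have hx : ∀ e φ : OpenPartialHomeomorph M (Model n), ∀ z ∈ e.target ∩ e.symm ⁻¹' φ.source,
      φ.symm ((φ ∘ e.symm) z) = e.symm z := fun e φ z hz => φ.left_inv hz.2
  -- comparing the two expressions of `D` on forms vanishing at a point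
  have hab : ∀ e ∈ IsManifold.maximalAtlas (𝓡 n) ∞ M, ∀ φ ∈ IsManifold.maximalAtlas (𝓡 n) ∞ M,
      ∀ z ∈ e.target ∩ e.symm ⁻¹' φ.source, ∀ L, a φ ((φ ∘ e.symm) z) L =
        a e z ((pull (fderiv ℝ (φ ∘ e.symm) z)).comp (L.comp (fderiv ℝ (φ ∘ e.symm) z))) := by
    intro e he φ hφ z hz L
    have hzφ : (φ ∘ e.symm) z ∈ φ.target := φ.map_source hz.2
    obtain ⟨θ, h0, h1⟩ := exists_form_fderiv hφ hzφ L
    have h2 := (hac φ hφ).2.2 θ _ hzφ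
    have h3 : localForm e θ.1 z = 0 := by
      rw [localForm_transition he hφ θ.1 hz, h0]
      rfl
    rw [hx e φ z hz, (hac e he).2.2 θ z hz.1, h0, h1, h3, map_zero, map_zero, add_zero, add_zero,
      fderiv_localForm_of_eq_zero he hφ θ hz h0, h1] at h2
    exact h2.symm
  obtain ⟨s₁, hs₁⟩ := exists_symbol (M := M) (fun φ y => symb1 (a φ y))
    (fun φ _ y _ => symb1_mem _)
    (fun φ hφ => symb1.contDiff.comp_contDiffOn (hac φ hφ).1)
    (fun e he φ hφ z hz => by
      ext ζ
      refine (hab e he φ hφ z hz (decomp1 ζ)).trans ?_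
      rw [pull, ← decomp1_comp]
      rfl)
  obtain ⟨s₀, hs₀⟩ := exists_symbol (M := M)
    (fun φ y => symb0 (c φ y - κ • contr (fderiv ℝ (a φ) y)))
    (fun φ _ y _ => symb0_mem _)
    (fun φ hφ => symb0.contDiff.comp_contDiffOn ((hac φ hφ).2.1.sub
      (ContDiffOn.const_smul κ (contr.contDiff.comp_contDiffOn
        ((hac φ hφ).1.fderiv_of_isOpen φ.open_target (by simp))))))
    (fun e he φ hφ z hz => by
      have hzφ : (φ ∘ e.symm) z ∈ φ.target := φ.map_source hz.2
      ext ζ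
      obtain ⟨θ, h0, -⟩ := exists_form_value hφ hzφ (decomp0 ζ)
      have h1 := (hac φ hφ).2.2 θ _ hzφ
      have h2 := firstOrder_charts hw hκ he hφ (hac e he).1 (hac φ hφ).1 (hab e he φ hφ) θ hz
      have h3 : localForm e θ.1 z = decomp0 fun i => (ζ i).comp (fderiv ℝ (φ ∘ e.symm) z) := by
        rw [localForm_transition he hφ θ.1 hz, h0, ← decomp0_comp]
      rw [hx e φ z hz, (hac e he).2.2 θ z hz.1, h3, h0] at h1
      rw [h0, h3] at h2
      change (c φ ((φ ∘ e.symm) z) - κ • contr (fderiv ℝ (a φ) ((φ ∘ e.symm) z))) (decomp0 ζ) =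
        (c e z - κ • contr (fderiv ℝ (a e) z))
          (decomp0 fun i => (ζ i).comp (fderiv ℝ (φ ∘ e.symm) z))
      simp only [sub_apply, smul_apply, smul_eq_mul]
      linarith)
  refine ⟨(s₁, s₀), fun φ hφ θ y hy => ?_⟩
  have h1 : (fun z => cosymb1 (localSymbol φ s₁.1 z)) =ᶠ[𝓝 y] a φ := by
    filter_upwards [φ.open_target.mem_nhds hy] with z hz
    rw [hs₁ φ hφ z hz, cosymb1_symb1]
  rw [firstOrderOp, h1.fderiv_eq, hs₀ φ hφ y hy, cosymb0_symb0, hs₁ φ hφ y hy, cosymb1_symb1,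
    (hac φ hφ).2.2 θ y hy]
  simp only [sub_apply, smul_apply, smul_eq_mul]
  ring

set_option maxHeartbeats 1600000 in
theorem IsSplit.lie (hw : IsWeight n p δ) (hκ : κ * (1 + δ) = δ) {D : DiffOp n M 1 p}
    {s : Symbol n M 1 p × Symbol n M 0 p} (h : IsSplit κ D s) (X : Vect n M) :
    IsSplit κ (lieDiffOp X D) (lieSymbol X s.1, lieSymbol X s.2) := by
  intro φ hφ θ y hy
  rw [diffOp_lie_local hφ (h φ hφ) X θ hy]
  have h1 := localForm_lieForm_eventuallyEq hφ X θ hy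
  have h2 := localSymbol_lieSymbol_eventuallyEq hφ X s.1 hy
  have h3 := localSymbol_lieSymbol_eventuallyEq hφ X s.2 hy
  have h4 : (fun z => cosymb1 (localSymbol φ (lieSymbol X s.1).1 z)) =ᶠ[𝓝 y] fun z =>
      cosymb1 (lieSymbolLocal (localVect φ X) (localSymbol φ s.1.1) z) := by
    filter_upwards [h2] with z hz
    rw [hz]
  have key := firstOrderOp_equivariant hw hκ φ.open_target hy (contDiffOn_localVect hφ X)
    (s.1.2.2 φ hφ) (s.2.2.2 φ hφ) (localSymbol_mem φ s.1) (localSymbol_mem φ s.2) (θ.2 φ hφ)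
  have e1 : firstOrderOp κ (fun z => cosymb1 (localSymbol φ s.1.1 z))
      (fun z => cosymb0 (localSymbol φ s.2.1 z)) (localForm φ (lieForm X θ).1) y =
      firstOrderOp κ (fun z => cosymb1 (localSymbol φ s.1.1 z))
      (fun z => cosymb0 (localSymbol φ s.2.1 z))
      (lieFormLocal (localVect φ X) (localForm φ θ.1)) y := by
    rw [firstOrderOp, firstOrderOp, h1.fderiv_eq, h1.self_of_nhds]
  have e2 : firstOrderOp κ (fun z => cosymb1 (localSymbol φ (lieSymbol X s.1).1 z))
      (fun z => cosymb0 (localSymbol φ (lieSymbol X s.2).1 z)) (localForm φ θ.1) y =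
      firstOrderOp κ (fun z => cosymb1 (lieSymbolLocal (localVect φ X) (localSymbol φ s.1.1) z))
      (fun z => cosymb0 (lieSymbolLocal (localVect φ X) (localSymbol φ s.2.1) z))
      (localForm φ θ.1) y := by
    rw [firstOrderOp, firstOrderOp, h4.fderiv_eq, h2.self_of_nhds, h3.self_of_nhds]
  rw [e1, e2]
  exact key

set_option maxHeartbeats 1600000 in
/-- If `p`-forms are densities of weight `δ` and `κ (1 + δ) = δ`, taking the principal symbol and
the symmetrised coefficient of order zero is an equivariant isomorphism. -/
theorem exists_equiv_one [T2Space M] (hw : IsWeight n p δ) (hκ : κ * (1 + δ) = δ) :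
    ∃ Q : DiffOp n M 1 p ≃ₗ[ℝ] (Symbol n M 1 p × Symbol n M 0 p),
      ∀ (X : Vect n M) (D : DiffOp n M 1 p),
        Q (lieDiffOp X D) = (lieSymbol X (Q D).1, lieSymbol X (Q D).2) := by
  have hd : ∀ φ ∈ IsManifold.maximalAtlas (𝓡 n) ∞ M, ∀ s : Symbol n M 1 p, ∀ y ∈ φ.target,
      DifferentiableAt ℝ (fun z => cosymb1 (localSymbol φ s.1 z)) y := fun φ hφ s y hy =>
    ((contDiffOn_cosymb1 hφ s).contDiffAt (φ.open_target.mem_nhds hy)).differentiableAt (by simp)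
  obtain ⟨Q, hQ⟩ := exists_linearEquiv_of_rel (IsSplit (n := n) (M := M) (p := p) κ)
    (fun D s D' s' h h' φ hφ θ y hy => by
      have e1 : fderiv ℝ (fun z => cosymb1 (localSymbol φ (s + s').1.1 z)) y =
          fderiv ℝ (fun z => cosymb1 (localSymbol φ s.1.1 z)) y +
            fderiv ℝ (fun z => cosymb1 (localSymbol φ s'.1.1 z)) y := by
        rw [← fderiv_fun_add (hd φ hφ _ y hy) (hd φ hφ _ y hy), Prod.fst_add, localSymbol_add]
        simp only [map_add]
      have e2 : (D + D').1 θ (φ.symm y) = D.1 θ (φ.symm y) + D'.1 θ (φ.symm y) := rfl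
      rw [e2, h φ hφ θ y hy, h' φ hφ θ y hy, firstOrderOp, firstOrderOp, firstOrderOp, e1,
        Prod.fst_add, Prod.snd_add, localSymbol_add, localSymbol_add]
      simp only [map_add, add_apply]
      ring)
    (fun c D s h φ hφ θ y hy => by
      have e1 : fderiv ℝ (fun z => cosymb1 (localSymbol φ (c • s).1.1 z)) y =
          c • fderiv ℝ (fun z => cosymb1 (localSymbol φ s.1.1 z)) y := by
        rw [← fderiv_fun_const_smul (hd φ hφ _ y hy), Prod.smul_fst, localSymbol_smul]
        simp only [map_smul]
      have e2 : (c • D).1 θ (φ.symm y) = c * D.1 θ (φ.symm y) := rfl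
      rw [e2, h φ hφ θ y hy, firstOrderOp, firstOrderOp, e1,
        Prod.smul_fst, Prod.smul_snd, localSymbol_smul, localSymbol_smul]
      simp only [map_smul, smul_apply, smul_eq_mul]
      ring)
    (exists_isSplit_right hw hκ) (exists_isSplit_left hw hκ)
    (fun s h => by
      have e0 : ∀ (φ : OpenPartialHomeomorph M (Model n)) (θ : Form n M p) (y : Model n),
          (0 : DiffOp n M 1 p).1 θ (φ.symm y) = 0 := fun _ _ _ => rfl
      have e1 : ∀ φ ∈ IsManifold.maximalAtlas (𝓡 n) ∞ M, ∀ y ∈ φ.target,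
          cosymb1 (localSymbol φ s.1.1 y) = 0 := fun φ hφ y hy => by
        ext L
        obtain ⟨θ, h0, h1⟩ := exists_form_fderiv hφ hy L
        have h2 := h φ hφ θ y hy
        rw [e0, firstOrderOp, h0, h1, map_zero, map_zero, mul_zero, add_zero, add_zero] at h2
        exact h2.symm
      have hs₁ : s.1 = 0 := symbol_eq_zero fun φ hφ y hy => by
        rw [← symb1_cosymb1 (localSymbol_mem φ s.1 y), e1 φ hφ y hy, map_zero]
      refine Prod.ext hs₁ (symbol_eq_zero fun φ hφ y hy => ?_)
      have e2 : cosymb0 (localSymbol φ s.2.1 y) = 0 := by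
        ext w
        obtain ⟨θ, h0, -⟩ := exists_form_value hφ hy w
        have h2 := h φ hφ θ y hy
        rw [e0, firstOrderOp, hs₁, localSymbol_zero, h0] at h2
        simpa using h2.symm
      rw [← symb0_cosymb0 (localSymbol_mem φ s.2 y), e2, map_zero])
    (fun D h => diffOp_eq_zero fun φ hφ θ y hy => by
      rw [h φ hφ θ y hy, firstOrderOp, Prod.fst_zero, Prod.snd_zero, localSymbol_zero,
        localSymbol_zero]
      simp)
  exact ⟨Q, fun X D => (hQ _ _).1 (((hQ D (Q D)).2 rfl).lie hw hκ X)⟩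

end Global

end FormOps

end

theorem mainTheorem9 (n : ℕ) (hn : 1 < n) (M : Type*) [TopologicalSpace M]
    [ChartedSpace (FormOps.Model n) M] [IsManifold (𝓡 n) ∞ M] [T2Space M]
    [SecondCountableTopology M] [ConnectedSpace M] :
    (∀ p : ℕ, ∃ Q : FormOps.DiffOp n M 0 p ≃ₗ[ℝ] FormOps.Symbol n M 0 p,
      ∀ (X : FormOps.Vect n M) (D : FormOps.DiffOp n M 0 p),
        Q (FormOps.lieDiffOp X D) = FormOps.lieSymbol X (Q D)) ∧
    (∀ p : ℕ, p = 0 ∨ p = n →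
      ∃ Q : FormOps.DiffOp n M 1 p ≃ₗ[ℝ] (FormOps.Symbol n M 1 p × FormOps.Symbol n M 0 p),
        ∀ (X : FormOps.Vect n M) (D : FormOps.DiffOp n M 1 p),
          Q (FormOps.lieDiffOp X D) =
            (FormOps.lieSymbol X (Q D).1, FormOps.lieSymbol X (Q D).2)) := by
  refine ⟨fun p => FormOps.exists_equiv_zero, ?_⟩
  rintro p (rfl | rfl)
  · exact FormOps.exists_equiv_one (κ := 0) FormOps.isWeight_zero (by norm_num)
  · exact FormOps.exists_equiv_one (κ := 1 / 2) FormOps.isWeight_top (by norm_num)
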